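/- **Setting.** There are arms $1,\dots,K$, a parameter set $\Theta$ (arbitrary), known mean reward functions $\mu_1,\dots,\mu_K:\Theta\to\mathbb R$ (arbitrary) and an unknown true parameter $\theta^*\in\Theta$. The successive rewards of arm $k$ are i.i.d. with mean $\mu_k(\theta^*)$ and are sub-Gaussian with known variance proxy $\sigma^2>0$, i.e. $\mathbb E\, e^{s(R_k-\mathbb E R_k)}\le e^{\sigma^2s^2/2}$ for all $s\in\mathbb R$; rewards of different arms are independent. Let $k^*$ be an optimal arm, $\mu_{k^*}(\theta^*)=\max_\ell\mu_\ell(\theta^*)$, and $\Delta_k=\mu_{k^*}(\theta^*)-\mu_k(\theta^*)$. Arm $k$ is sub-optimal if $\Delta_k>0$, and competitive if for every $\epsilon>0$ there is $\theta\in\Theta$ with $|\mu_{k^*}(\theta^*)-\mu_{k^*}(\theta)|<\epsilon$ and $\mu_k(\theta)=\max_\ell\mu_\ell(\theta)$. **Algorithms.** Let $n_k(t)$ be the number of pulls of arm $k$ in the first $t$ rounds and $\hat\mu_k(t)$ the empirical mean of its rewards. In round $t+1$ ($t\ge 0$), put $$\hat\Theta_t=\Big\{\theta\in\Theta:\ |\mu_k(\theta)-\hat\mu_k(t)|<\sqrt{2\alpha\sigma^2\log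 t/n_k(t)}\ \text{ for all } k\Big\},$$ and let $\mathcal C_t$ be the set of arms $k$ with $\mu_k(\theta)=\max_\ell\mu_\ell(\theta)$ for some $\theta\in\hat\Theta_t$, or the set of all arms if $\hat\Theta_t=\emptyset$. UCB-C pulls an arm of $\mathcal C_t$ that maximizes $\hat\mu_k(t)+\sqrt{2\alpha\sigma^2\log t/n_k(t)}$. TS-C draws independent samples $S_{k,t}\sim\mathcal N(\hat\mu_k(t),\beta\sigma^2/n_k(t))$ and pulls an arm of $\mathcal C_t$ that maximizes $S_{k,t}$. For an arm with $n_k(t)=0$ the confidence radius, the UCB index and the sample are $+\infty$. Ties are broken by an arbitrary fixed rule. **Theorem.** Let $\alpha>2$ and let $k$ be a competitive sub-optimal arm. Under UCB-C, for every $T$, $$\mathbb E[n_k(T)]\le \frac{8\alpha\sigma^2\log T}{\Delta_k^2}+\frac{2\alpha}{\alpha-2}+\sum_{t=1}^{T}2Kt^{1-\alpha},$$ and $\mathbb E[n_k(T)]=O(\log T)$ as $T\to\infty$. Under TS-C with $\beta>1$, for every $T$, $$\mathbb E[n_k(T)]\le \frac{9\beta\sigma^2\log T}{2\Delta_k^2}+3+e^{11\beta\sigma^2}+2\sum_{t=1}^{T}\Big(\frac1{t\Delta_k^2}\Big)^{2\beta}+\sum_{t=1}^{T}2Kt^{1-\alpha},$$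 and $\mathbb E[n_k(T)]=O(\log T)$ as $T\to\infty$. (For $T=0$ the term $\log T$ is read as $0$.) -/

import Mathlib

open MeasureTheory ProbabilityTheory Filter Asymptotics
open scoped NNReal

noncomputable section

namespace StructuredBandit

/-- The arm `k` attains the largest mean reward at the parameter `θ`. -/
def IsBestAt {K : ℕ} {Θ : Type*} (μ : Fin K → Θ → ℝ) (k : Fin K) (θ : Θ) : Prop :=
  ∀ l, μ l θ ≤ μ k θ

/-- The sub-optimality gap of the arm `k`, where `kstar` is the optimal arm and `θstar` the true
parameter. -/
def gap {K : ℕ} {Θ : Type*} (μ : Fin K → Θ → ℝ) (θstar : Θ) (kstar k : Fin K) : ℝ :=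
  μ kstar θstar - μ k θstar

/-- The arm `k` is competitive: for every `ε > 0` it is a best arm at some parameter `θ` at which
the mean reward of the optimal arm `kstar` is within `ε` of its true value. -/
def IsCompetitive {K : ℕ} {Θ : Type*} (μ : Fin K → Θ → ℝ) (θstar : Θ) (kstar k : Fin K) : Prop :=
  ∀ ε : ℝ, 0 < ε → ∃ θ : Θ, |μ kstar θstar - μ kstar θ| < ε ∧ IsBestAt μ k θ

/-- Empirical mean of the arm `k` after `n k` pulls, when `x k m` is the reward of its
`m`-th pull (counted from `0`). -/
def empMean {K : ℕ} (x : Fin K → ℕ → ℝ) (n : Fin K → ℕ) (k : Fin K) : ℝ :=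
  (∑ m ∈ Finset.range (n k), x k m) / (n k : ℝ)

/-- The confidence radius `√(2 α σ² log t / n)` of an arm pulled `n` times in the first `t`
rounds; it is `+∞` for an arm that has not been pulled. -/
def confRadius (α σ : ℝ) (t n : ℕ) : EReal :=
  if n = 0 then ⊤ else ((√(2 * α * σ ^ 2 * Real.log t / n) : ℝ) : EReal)

/-- The confidence set after `t` rounds, given the numbers of pulls `n` and the empirical
means `m`. -/
def confSet {K : ℕ} {Θ : Type*} (μ : Fin K → Θ → ℝ) (α σ : ℝ) (t : ℕ) (n : Fin K → ℕ)
    (m : Fin K → ℝ) : Set Θ :=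
  {θ | ∀ k, ((|μ k θ - m k| : ℝ) : EReal) < confRadius α σ t (n k)}

open Classical in
/-- The set of arms that are competitive with respect to the confidence set; all arms if the
confidence set is empty. -/
def competitiveSet {K : ℕ} {Θ : Type*} (μ : Fin K → Θ → ℝ) (α σ : ℝ) (t : ℕ) (n : Fin K → ℕ)
    (m : Fin K → ℝ) : Finset (Fin K) :=
  if confSet μ α σ t n m = ∅ then Finset.univ
  else Finset.univ.filter fun k => ∃ θ ∈ confSet μ α σ t n m, IsBestAt μ k θ

open Classical in
/-- The maximizers of the index `I` over the set of arms `C`. -/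
def argmaxOn {K : ℕ} (C : Finset (Fin K)) (I : Fin K → EReal) : Finset (Fin K) :=
  C.filter fun k => ∀ l ∈ C, I l ≤ I k

/-- The UCB index `m k + √(2 α σ² log t / n k)`. -/
def ucbIndex {K : ℕ} (α σ : ℝ) (t : ℕ) (n : Fin K → ℕ) (m : Fin K → ℝ) (k : Fin K) : EReal :=
  (m k : EReal) + confRadius α σ t (n k)

/-- The Thompson sample `m k + √(β σ² / n k) * g t k`, which has law `N(m k, β σ² / n k)` when
`g t k` is standard normal; it is `+∞` for an arm that has not been pulled. -/
def tsSample {K : ℕ} (β σ : ℝ) (g : ℕ → Fin K → ℝ) (t : ℕ) (n : Fin K → ℕ) (m : Fin K → ℝ)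
    (k : Fin K) : EReal :=
  if n k = 0 then ⊤ else ((m k + √(β * σ ^ 2 / n k) * g t k : ℝ) : EReal)

/-- A rule that breaks ties: in each round it selects one element of any non-empty set of arms. -/
def IsTieBreaking {K : ℕ} (τ : ℕ → Finset (Fin K) → Fin K) : Prop :=
  ∀ t s, s.Nonempty → τ t s ∈ s

/-- The arm pulled in round `t + 1`: a maximizer of the index over the competitive set. -/
def nextArm {K : ℕ} {Θ : Type*} (μ : Fin K → Θ → ℝ) (α σ : ℝ) (τ : ℕ → Finset (Fin K) → Fin K)
    (I : ℕ → (Fin K → ℕ) → (Fin K → ℝ) → Fin K → EReal) (x : Fin K → ℕ → ℝ) (t : ℕ)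
    (n : Fin K → ℕ) : Fin K :=
  τ t (argmaxOn (competitiveSet μ α σ t n (empMean x n)) (I t n (empMean x n)))

/-- `pulls μ α σ τ I x T k` is the number of pulls of the arm `k` in the first `T` rounds, when the
competitive arms are ranked by the index `I` and the `m`-th pull of the arm `l` is rewarded
by `x l m`. -/
def pulls {K : ℕ} {Θ : Type*} (μ : Fin K → Θ → ℝ) (α σ : ℝ) (τ : ℕ → Finset (Fin K) → Fin K)
    (I : ℕ → (Fin K → ℕ) → (Fin K → ℝ) → Fin K → EReal) (x : Fin K → ℕ → ℝ) :
    ℕ → Fin K → ℕ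
  | 0 => fun _ => 0
  | t + 1 => fun k =>
      pulls μ α σ τ I x t k + if nextArm μ α σ τ I x t (pulls μ α σ τ I x t) = k then 1 else 0

/-- Number of pulls under UCB-C. -/
def ucbcPulls {K : ℕ} {Θ : Type*} (μ : Fin K → Θ → ℝ) (α σ : ℝ)
    (τ : ℕ → Finset (Fin K) → Fin K) (x : Fin K → ℕ → ℝ) : ℕ → Fin K → ℕ :=
  pulls μ α σ τ (ucbIndex α σ) x

/-- Number of pulls under TS-C, driven by the noise `g`. -/
def tscPulls {K : ℕ} {Θ : Type*} (μ : Fin K → Θ → ℝ) (α β σ : ℝ)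
    (τ : ℕ → Finset (Fin K) → Fin K) (x : Fin K → ℕ → ℝ) (g : ℕ → Fin K → ℝ) : ℕ → Fin K → ℕ :=
  pulls μ α σ τ (tsSample β σ g) x

/-- The rewards `X k m` of the successive pulls of the arms are independent, and those of the
arm `k` have law `ν k`. -/
structure IsRewardTable {K : ℕ} {Ω : Type*} [MeasurableSpace Ω] (P : Measure Ω)
    (ν : Fin K → Measure ℝ) (X : Fin K → ℕ → Ω → ℝ) : Prop where
  measurable : ∀ k m, Measurable (X k m)
  map_eq : ∀ k m, P.map (X k m) = ν k
  indep : iIndepFun (fun p : Fin K × ℕ => X p.1 p.2) P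

/-- The variables `G t k` are independent standard normal, and independent of the rewards. -/
structure IsSamplingNoise {K : ℕ} {Ω : Type*} [MeasurableSpace Ω] (P : Measure Ω)
    (X : Fin K → ℕ → Ω → ℝ) (G : ℕ → Fin K → Ω → ℝ) : Prop where
  measurable : ∀ t k, Measurable (G t k)
  map_eq : ∀ t k, P.map (G t k) = gaussianReal 0 1
  indep : iIndepFun (fun q : ℕ × Fin K => G q.1 q.2) P
  indep_rewards : IndepFun (fun ω (p : Fin K × ℕ) => X p.1 p.2 ω)
    (fun ω (q : ℕ × Fin K) => G q.1 q.2 ω) P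

end StructuredBandit

end

/-! Every pull of the sub-optimal arm `k` is charged to a cause, and each cause is counted in
expectation. Let `badEvent` at `t` say that some arm, at some pull count up to `t`, leaves its
confidence band. A union bound over arms and counts gives probability at most `2Kt^(1-α)`. Off this
event the true parameter lies in the confidence set, so the optimal arm `ks` belongs to the
competitive set and competes with `k`.

UCB-C: if `ks` competes and `k` wins, optimism forces `Δ` below twice the radius of `k`, hence `n_k
< 8ασ² log t/Δ²` (`lt_of_nextArm_ucb`). Each pull count of `k` is used once, so such rounds are few,
and `2α/(α-2) ≥ 1` absorbs the rounding.

TS-C: put `κ = βσ²/Δ²`. Apart from bad events, counts `n_k < κr²` and overestimates of `k` by `bΔ`,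
the pulls of `k` are split by the value of its sample along levels `μ* - aΔ`. Given the history, `k`
wins with a sample below a level at most as often as `ks` is pulled, times the odds that the sample
of `ks` falls below that level (`noiseLaw_nextArm_le`). In the middle layers a Gaussian tail enters
as a further factor, because the sample of `k` must also exceed the previous level. The top layer is
bounded by a Gaussian tail alone. Summing over rounds and re-indexing by the pull counts of `ks`
leaves `totalOdds`, an expectation over sample means of fixed size.

To bound it with explicit constants, the Gaussian odds function is dominated by the mixture `∫_1^∞
(s+5/4) exp(sz - s²/2) ds` (`odds_le_oddsMaj`). Sub-Gaussianity of the rewards and `β ≥ 1` cancel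
the Gaussian weight under the expectation, and integral comparison sums the result (`totalOdds_le`).
Taking `r² = 4.5 log T + const` yields `4.5 κ log T + c₀ + c₁κ + c₂κ^(3/2)`.

The remainder has to fit under `exp(11βσ²)` plus the power sum. Writing `κ = sw` with `s = Δ^(-2)`,
`w = βσ²`, the exponential wins for small `s` and the powers for large `s`
(`sampling_cost_le_tscSlack`). Small horizons are covered by `n_k(T) ≤ T`. -/

namespace StructuredBandit

/-! ### Deterministic trajectories: pull counts and the UCB-C selection rule. -/

section Deterministic

variable {K : ℕ} {Θ : Type*} {μ : Fin K → Θ → ℝ} {α σ : ℝ} {τ : ℕ → Finset (Fin K) → Fin K}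
  {I : ℕ → (Fin K → ℕ) → (Fin K → ℝ) → Fin K → EReal} {x : Fin K → ℕ → ℝ}

/-- The arm pulled in round `t + 1` along the trajectory of the algorithm. -/
noncomputable def armAt (μ : Fin K → Θ → ℝ) (α σ : ℝ) (τ : ℕ → Finset (Fin K) → Fin K)
    (I : ℕ → (Fin K → ℕ) → (Fin K → ℝ) → Fin K → EReal) (x : Fin K → ℕ → ℝ) (t : ℕ) : Fin K :=
  nextArm μ α σ τ I x t (pulls μ α σ τ I x t)

lemma pulls_succ (t : ℕ) (k : Fin K) :
    pulls μ α σ τ I x (t + 1) k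
      = pulls μ α σ τ I x t k + if armAt μ α σ τ I x t = k then 1 else 0 := rfl

lemma pulls_eq_sum (T : ℕ) (k : Fin K) :
    pulls μ α σ τ I x T k = ∑ t ∈ Finset.range T, if armAt μ α σ τ I x t = k then 1 else 0 := by
  induction T with
  | zero => rfl
  | succ T ih => rw [pulls_succ, Finset.sum_range_succ, ih]

lemma pulls_le (t : ℕ) (k : Fin K) : pulls μ α σ τ I x t k ≤ t := by
  rw [pulls_eq_sum]
  refine (Finset.sum_le_sum (g := fun _ => 1) fun i _ => by split_ifs <;> simp).trans ?_
  simp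

/-- The pull counts of an arm at the rounds in which it is pulled are `0, 1, 2, …`. -/
lemma sum_ite_armAt {M : Type*} [AddCommMonoid M] (f : ℕ → M) (T : ℕ) (k : Fin K) :
    ∑ t ∈ Finset.range T,
        (if armAt μ α σ τ I x t = k then f (pulls μ α σ τ I x t k) else 0)
      = ∑ n ∈ Finset.range (pulls μ α σ τ I x T k), f n := by
  induction T with
  | zero => rfl
  | succ T ih =>
    rw [Finset.sum_range_succ, ih, pulls_succ]
    split_ifs with h
    · rw [Finset.sum_range_succ]
    · simp

lemma competitiveSet_nonempty (t : ℕ) (n : Fin K → ℕ) (m : Fin K → ℝ) (k₀ : Fin K) :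
    (competitiveSet μ α σ t n m).Nonempty := by
  classical
  unfold competitiveSet
  split_ifs with h
  · exact ⟨k₀, Finset.mem_univ _⟩
  · obtain ⟨θ, hθ⟩ := Set.nonempty_iff_ne_empty.2 h
    obtain ⟨l, -, hl⟩ := Finset.exists_max_image Finset.univ (fun l => μ l θ) ⟨k₀, Finset.mem_univ _⟩
    exact ⟨l, by simpa using ⟨θ, hθ, fun j => hl j (Finset.mem_univ _)⟩⟩

lemma mem_argmaxOn {C : Finset (Fin K)} {J : Fin K → EReal} {k : Fin K} :
    k ∈ argmaxOn C J ↔ k ∈ C ∧ ∀ l ∈ C, J l ≤ J k := by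
  simp [argmaxOn]

lemma argmaxOn_nonempty {C : Finset (Fin K)} (hC : C.Nonempty) (J : Fin K → EReal) :
    (argmaxOn C J).Nonempty := by
  obtain ⟨l, hl, h⟩ := Finset.exists_max_image C J hC
  exact ⟨l, mem_argmaxOn.2 ⟨hl, h⟩⟩

lemma nextArm_mem (hτ : IsTieBreaking τ) (k₀ : Fin K) (t : ℕ) (n : Fin K → ℕ) :
    nextArm μ α σ τ I x t n ∈
      argmaxOn (competitiveSet μ α σ t n (empMean x n)) (I t n (empMean x n)) :=
  hτ _ _ (argmaxOn_nonempty (competitiveSet_nonempty _ _ _ k₀) _)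

lemma mem_competitiveSet_of_mem_confSet {θ : Θ} {l : Fin K} {t : ℕ} {n : Fin K → ℕ}
    {m : Fin K → ℝ} (hθ : θ ∈ confSet μ α σ t n m) (hl : IsBestAt μ l θ) :
    l ∈ competitiveSet μ α σ t n m := by
  classical
  have : confSet μ α σ t n m ≠ ∅ := Set.nonempty_iff_ne_empty.1 ⟨θ, hθ⟩
  simp only [competitiveSet, this, if_false, Finset.mem_filter, Finset.mem_univ, true_and]
  exact ⟨θ, hθ, hl⟩

lemma abs_sub_lt_of_mem_confSet {θ : Θ} {l : Fin K} {t : ℕ} {n : Fin K → ℕ}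
    {m : Fin K → ℝ} (hθ : θ ∈ confSet μ α σ t n m) (hl : n l ≠ 0) :
    |μ l θ - m l| < √(2 * α * σ ^ 2 * Real.log t / n l) := by
  have := hθ l
  simp only [confRadius, hl, if_false] at this
  exact_mod_cast this

/-- On the event that the true parameter lies in the confidence set, UCB-C pulls a sub-optimal arm
only as long as its number of pulls is below `8 α σ² log t / Δ²`. -/
lemma lt_of_nextArm_ucb (hτ : IsTieBreaking τ) {θ : Θ} {ks k : Fin K} (hks : IsBestAt μ ks θ)
    (hgap : 0 < gap μ θ ks k) {t : ℕ} {n : Fin K → ℕ}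
    (hθ : θ ∈ confSet μ α σ t n (empMean x n))
    (hk : nextArm μ α σ τ (ucbIndex α σ) x t n = k) (hn : n k ≠ 0) :
    (n k : ℝ) < 8 * α * σ ^ 2 * Real.log t / gap μ θ ks k ^ 2 := by
  have hmem := nextArm_mem (μ := μ) (α := α) (σ := σ) (I := ucbIndex α σ) (x := x) hτ ks t n
  rw [hk, mem_argmaxOn] at hmem
  have hle := hmem.2 ks (mem_competitiveSet_of_mem_confSet hθ hks)
  have hk1 := abs_sub_lt_of_mem_confSet hθ hn
  unfold ucbIndex at hle
  -- An unpulled optimal arm has infinite index and cannot lose to a pulled arm.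
  by_cases hs : n ks = 0
  · simp only [confRadius, hs, if_true, hn, if_false] at hle
    rw [← EReal.coe_add] at hle
    simp at hle
    exact absurd hle (by rw [← EReal.coe_add]; exact EReal.coe_ne_top _)
  · have hs1 := abs_sub_lt_of_mem_confSet hθ hs
    simp only [confRadius, hs, hn, if_false] at hle
    rw [← EReal.coe_add, ← EReal.coe_add, EReal.coe_le_coe_iff] at hle
    have h1 := (abs_lt.1 hk1).1
    have h2 := (abs_lt.1 hs1).2
    -- Optimism: `μ*` is below the index of `ks`, which is at most the index of `k`, which is below
    -- `μ_k` plus two radii.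
    have h3 : gap μ θ ks k < 2 * √(2 * α * σ ^ 2 * Real.log t / n k) := by
      unfold gap; linarith
    have h4 : 0 < 2 * α * σ ^ 2 * Real.log t / n k := Real.sqrt_pos.1 (by linarith)
    have h5 : gap μ θ ks k ^ 2 < 4 * (2 * α * σ ^ 2 * Real.log t / n k) := by
      have := Real.sq_sqrt h4.le
      nlinarith
    have hn0 : (0 : ℝ) < n k := by exact_mod_cast Nat.pos_of_ne_zero hn
    rw [lt_div_iff₀ (by positivity)]
    have h6 := mul_lt_mul_of_pos_right h5 hn0
    have h7 : 4 * (2 * α * σ ^ 2 * Real.log t / n k) * n k = 8 * α * σ ^ 2 * Real.log t := by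
      field_simp; ring
    linarith

end Deterministic

/-! ### Measurability of the arm choice and of the pull counts. -/

section Measurability

variable {K : ℕ} {Θ : Type*} {μ : Fin K → Θ → ℝ} {α σ : ℝ} {τ : ℕ → Finset (Fin K) → Fin K}

lemma isOpen_mem_confSet (θ : Θ) (t : ℕ) (n : Fin K → ℕ) :
    IsOpen {m : Fin K → ℝ | θ ∈ confSet μ α σ t n m} := by
  have : {m : Fin K → ℝ | θ ∈ confSet μ α σ t n m}
      = ⋂ l, {m : Fin K → ℝ | ((|μ l θ - m l| : ℝ) : EReal) < confRadius α σ t (n l)} := by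
    ext m; simp [confSet]
  rw [this]
  refine isOpen_iInter_of_finite fun l => isOpen_lt ?_ continuous_const
  exact continuous_coe_real_ereal.comp (by fun_prop)

/-- The union over `θ` may be uncountable. It is measurable because the strict inequalities in
`confSet` make each member of the union open. -/
lemma measurable_exists_confSet (p : Θ → Prop) (t : ℕ) (n : Fin K → ℕ) :
    Measurable fun m : Fin K → ℝ => ∃ θ ∈ confSet μ α σ t n m, p θ := by
  rw [← measurableSet_setOfPred]
  have : {m : Fin K → ℝ | ∃ θ ∈ confSet μ α σ t n m, p θ}
      = ⋃ θ ∈ {θ | p θ}, {m : Fin K → ℝ | θ ∈ confSet μ α σ t n m} := by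
    ext m; simp [and_comm]
  rw [this]
  exact (isOpen_biUnion fun θ _ => isOpen_mem_confSet θ t n).measurableSet

lemma measurable_mem_competitiveSet (t : ℕ) (n : Fin K → ℕ) (l : Fin K) :
    Measurable fun m : Fin K → ℝ => l ∈ competitiveSet μ α σ t n m := by
  -- The implication form includes the empty confidence set, for which every arm is competitive.
  have : (fun m : Fin K → ℝ => l ∈ competitiveSet μ α σ t n m)
      = fun m => (∃ θ ∈ confSet μ α σ t n m, True) → ∃ θ ∈ confSet μ α σ t n m, IsBestAt μ l θ := by
    classical
    ext m
    unfold competitiveSet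
    split_ifs with h
    · simp [h]
    · have : ∃ θ, θ ∈ confSet μ α σ t n m := Set.nonempty_iff_ne_empty.2 h
      simp [this]
  rw [this]
  exact (measurable_exists_confSet _ t n).imp (measurable_exists_confSet _ t n)

variable {S : Type*} [MeasurableSpace S] {x : S → Fin K → ℕ → ℝ}
  {I : S → ℕ → (Fin K → ℕ) → (Fin K → ℝ) → Fin K → EReal}

lemma measurable_empMean (hx : ∀ l m, Measurable fun s => x s l m) (n : Fin K → ℕ) :
    Measurable fun s => empMean (x s) n := by
  refine measurable_pi_lambda _ fun l => ?_
  unfold empMean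
  exact (Finset.measurable_sum _ fun m _ => hx l m).div_const _

/-- The tie-breaking rule needs no regularity: the argmax set takes finitely many values, and the
event of choosing an arm is a union of its level sets. -/
lemma measurable_nextArm (hx : ∀ l m, Measurable fun s => x s l m)
    (hI : ∀ t n l, Measurable fun p : S × (Fin K → ℝ) => I p.1 t n p.2 l)
    (t : ℕ) (n : Fin K → ℕ) :
    Measurable fun s => nextArm μ α σ τ (I s) (x s) t n := by
  classical
  refine measurable_to_countable' fun k => ?_
  set A : S → Finset (Fin K) := fun s =>
    argmaxOn (competitiveSet μ α σ t n (empMean (x s) n)) (I s t n (empMean (x s) n)) with hA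
  have hm := measurable_empMean hx n
  have hC : ∀ l, Measurable fun s => l ∈ competitiveSet μ α σ t n (empMean (x s) n) :=
    fun l => (measurable_mem_competitiveSet t n l).comp hm
  have hJ : ∀ l, Measurable fun s => I s t n (empMean (x s) n) l :=
    fun l => (hI t n l).comp (measurable_id.prodMk hm)
  have hmem : ∀ l, Measurable fun s => l ∈ A s := fun l => by
    simp only [hA, mem_argmaxOn]
    refine (hC l).and (Measurable.forall fun j => (hC j).imp ?_)
    exact measurableSet_setOfPred.1 (measurableSet_le (hJ j) (hJ l))
  have hset : ∀ B : Finset (Fin K), MeasurableSet {s | A s = B} := fun B => by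
    simp only [Finset.ext_iff]
    exact measurableSet_setOfPred.2 (Measurable.forall fun l => (hmem l).iff measurable_const)
  have : (fun s => nextArm μ α σ τ (I s) (x s) t n) ⁻¹' {k}
      = ⋃ B ∈ {B : Finset (Fin K) | τ t B = k}, {s | A s = B} := by
    ext s; simp [nextArm, hA]
  rw [this]
  exact MeasurableSet.biUnion (Set.to_countable _) fun B _ => hset B

/-- Count vectors form a countable space, so measurability for each fixed `n` suffices. -/
lemma measurable_nextArm_comp (hx : ∀ l m, Measurable fun s => x s l m)
    (hI : ∀ t n l, Measurable fun p : S × (Fin K → ℝ) => I p.1 t n p.2 l) (t : ℕ)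
    {N : S → Fin K → ℕ} (h : Measurable N) :
    Measurable fun s => nextArm μ α σ τ (I s) (x s) t (N s) :=
  Measurable.comp (g := fun p : S × (Fin K → ℕ) => nextArm μ α σ τ (I p.1) (x p.1) t p.2)
    (f := fun s => (s, N s)) (measurable_from_prod_countable_left fun n =>
      measurable_nextArm hx hI t n) (measurable_id.prodMk h)

lemma measurable_armAt_of_pulls (hx : ∀ l m, Measurable fun s => x s l m)
    (hI : ∀ t n l, Measurable fun p : S × (Fin K → ℝ) => I p.1 t n p.2 l) (t : ℕ)
    (h : Measurable fun s => pulls μ α σ τ (I s) (x s) t) :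
    Measurable fun s => armAt μ α σ τ (I s) (x s) t :=
  measurable_nextArm_comp hx hI t h

lemma measurable_pulls (hx : ∀ l m, Measurable fun s => x s l m)
    (hI : ∀ t n l, Measurable fun p : S × (Fin K → ℝ) => I p.1 t n p.2 l) (t : ℕ) :
    Measurable fun s => pulls μ α σ τ (I s) (x s) t := by
  induction t with
  | zero => exact measurable_const
  | succ t ih =>
    have h3 : Measurable fun s => armAt μ α σ τ (I s) (x s) t :=
      measurable_armAt_of_pulls hx hI t ih
    refine measurable_pi_lambda _ fun k => ?_
    simp only [pulls_succ]
    refine Measurable.add (measurable_pi_iff.1 ih k) ?_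
    exact Measurable.ite (h3 (measurableSet_singleton k)) measurable_const measurable_const

lemma measurable_armAt (hx : ∀ l m, Measurable fun s => x s l m)
    (hI : ∀ t n l, Measurable fun p : S × (Fin K → ℝ) => I p.1 t n p.2 l) (t : ℕ) :
    Measurable fun s => armAt μ α σ τ (I s) (x s) t :=
  measurable_armAt_of_pulls hx hI t (measurable_pulls hx hI t)

lemma measurable_ucbIndex (t : ℕ) (n : Fin K → ℕ) (l : Fin K) :
    Measurable fun p : S × (Fin K → ℝ) => ucbIndex α σ t n p.2 l := by
  unfold ucbIndex
  exact (measurable_coe_real_ereal.comp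
    ((measurable_pi_apply l).comp measurable_snd)).add measurable_const

lemma measurable_tsSample {β : ℝ} {g : S → ℕ → Fin K → ℝ}
    (hg : ∀ t l, Measurable fun s => g s t l) (t : ℕ) (n : Fin K → ℕ) (l : Fin K) :
    Measurable fun p : S × (Fin K → ℝ) => tsSample β σ (g p.1) t n p.2 l := by
  unfold tsSample
  split_ifs
  · exact measurable_const
  · exact measurable_coe_real_ereal.comp (((measurable_pi_apply l).comp measurable_snd).add
      (((hg t l).comp measurable_fst).const_mul _))

end Measurability

/-! ### Independence of the current noise from the history. -/

section Independence

variable {Ω : Type*} [MeasurableSpace Ω] {P : Measure Ω} [IsProbabilityMeasure P]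

/-- The law of `(f, (g, h))` factors completely, and re-associating the triple product gives the
claim. -/
lemma indepFun_prodMk_of_indepFun {A B C : Type*} [MeasurableSpace A] [MeasurableSpace B]
    [MeasurableSpace C] {f : Ω → A} {g : Ω → B} {h : Ω → C} (hf : Measurable f)
    (hg : Measurable g) (hh : Measurable h) (h1 : IndepFun f (fun ω => (g ω, h ω)) P)
    (h2 : IndepFun g h P) : IndepFun (fun ω => (f ω, g ω)) h P := by
  have h3 : IndepFun f g P := h1.comp (φ := id) (ψ := Prod.fst) measurable_id measurable_fst
  have := Measure.isProbabilityMeasure_map (μ := P) hf.aemeasurable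
  have := Measure.isProbabilityMeasure_map (μ := P) hg.aemeasurable
  have := Measure.isProbabilityMeasure_map (μ := P) hh.aemeasurable
  rw [indepFun_iff_map_prod_eq_prod_map_map (hf.prodMk hg).aemeasurable hh.aemeasurable]
  rw [indepFun_iff_map_prod_eq_prod_map_map hf.aemeasurable hg.aemeasurable] at h3
  rw [indepFun_iff_map_prod_eq_prod_map_map hg.aemeasurable hh.aemeasurable] at h2
  rw [indepFun_iff_map_prod_eq_prod_map_map hf.aemeasurable (hg.prodMk hh).aemeasurable, h2] at h1
  rw [h3]
  apply MeasurableEquiv.prodAssoc.map_measurableEquiv_injective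
  rw [Measure.prodAssoc_prod, ← h1, Measure.map_map MeasurableEquiv.prodAssoc.measurable
    ((hf.prodMk hg).prodMk hh)]
  rfl

variable {K : ℕ} {Θ : Type*} {μ : Fin K → Θ → ℝ} {α β σ : ℝ} {τ : ℕ → Finset (Fin K) → Fin K}

/-- Causality: round `s + 1` reads only `g s`, so the counts after `t` rounds depend on the noise
with index below `t`. -/
lemma tscPulls_congr {x : Fin K → ℕ → ℝ} {g g' : ℕ → Fin K → ℝ} {t : ℕ}
    (h : ∀ s < t, g s = g' s) :
    tscPulls μ α β σ τ x g t = tscPulls μ α β σ τ x g' t := by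
  induction t with
  | zero => rfl
  | succ t ih =>
    have ih' := ih fun s hs => h s (hs.trans (Nat.lt_succ_self t))
    have ht := h t (Nat.lt_succ_self t)
    funext k
    unfold tscPulls at ih' ⊢
    simp only [pulls_succ, armAt, ih']
    have : nextArm μ α σ τ (tsSample β σ g) x t (pulls μ α σ τ (tsSample β σ g') x t)
        = nextArm μ α σ τ (tsSample β σ g') x t (pulls μ α σ τ (tsSample β σ g') x t) := by
      unfold nextArm
      congr 2
      funext l
      simp only [tsSample, ht]
    rw [this]
    congr

variable {ν : Fin K → Measure ℝ} {X : Fin K → ℕ → Ω → ℝ} {G : ℕ → Fin K → Ω → ℝ}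

lemma measurable_tscPulls {S : Type*} [MeasurableSpace S] {x : S → Fin K → ℕ → ℝ}
    {g : S → ℕ → Fin K → ℝ} (hx : ∀ l m, Measurable fun s => x s l m)
    (hg : ∀ t l, Measurable fun s => g s t l) (t : ℕ) :
    Measurable fun s => tscPulls μ α β σ τ (x s) (g s) t :=
  measurable_pulls hx (measurable_tsSample hg) t

/-- The noise of round `t + 1` is independent of the rewards and of the first `t` rounds. -/
lemma indepFun_history (hX : IsRewardTable P ν X) (hG : IsSamplingNoise P X G) (t : ℕ) :
    IndepFun (fun ω => ((fun l m => X l m ω : Fin K → ℕ → ℝ),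
        tscPulls μ α β σ τ (fun l m => X l m ω) (fun s l => G s l ω) t))
      (fun ω l => G t l ω) P := by
  classical
  set A : Finset (ℕ × Fin K) := Finset.range t ×ˢ Finset.univ with hA
  set B : Finset (ℕ × Fin K) := {t} ×ˢ Finset.univ with hB
  have hAB : Disjoint A B := by
    rw [Finset.disjoint_left]
    rintro ⟨s, l⟩ h1 h2
    simp [hA, hB] at h1 h2
    omega
  have hmG : ∀ q : ℕ × Fin K, Measurable (fun ω => G q.1 q.2 ω) := fun q => hG.measurable _ _
  have h2 := hG.indep.indepFun_finset A B hAB hmG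
  have hmA : Measurable fun ω (i : A) => G i.1.1 i.1.2 ω := measurable_pi_lambda _ fun i => hmG _
  have hmB : Measurable fun ω (i : B) => G i.1.1 i.1.2 ω := measurable_pi_lambda _ fun i => hmG _
  have hmX : Measurable fun ω (p : Fin K × ℕ) => X p.1 p.2 ω :=
    measurable_pi_lambda _ fun i => hX.measurable _ _
  have h1 : IndepFun (fun ω (p : Fin K × ℕ) => X p.1 p.2 ω)
      (fun ω => ((fun (i : A) => G i.1.1 i.1.2 ω), (fun (i : B) => G i.1.1 i.1.2 ω))) P :=
    hG.indep_rewards.comp (φ := id) (ψ := fun g : ℕ × Fin K → ℝ =>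
      ((fun (i : A) => g i.1), (fun (i : B) => g i.1))) measurable_id
      ((measurable_pi_lambda _ fun i => measurable_pi_apply _).prodMk
        (measurable_pi_lambda _ fun i => measurable_pi_apply _))
  have h3 := indepFun_prodMk_of_indepFun hmX hmA hmB h1 h2
  -- Past noise is padded by zeros to a full array. By `tscPulls_congr` this leaves the history
  -- unchanged and exhibits it as a measurable function of rewards and past noise.
  let E : (A → ℝ) → ℕ → Fin K → ℝ := fun p s l => if h : (s, l) ∈ A then p ⟨(s, l), h⟩ else 0
  have hE : ∀ s l, Measurable fun q : (Fin K × ℕ → ℝ) × (A → ℝ) => E q.2 s l := fun s l => by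
    simp only [E]
    split_ifs with h
    · exact (measurable_pi_apply _).comp measurable_snd
    · exact measurable_const
  have hx : ∀ l m, Measurable fun q : (Fin K × ℕ → ℝ) × (A → ℝ) => q.1 (l, m) := fun l m =>
    (measurable_pi_apply _).comp measurable_fst
  have hφ : Measurable fun q : (Fin K × ℕ → ℝ) × (A → ℝ) =>
      ((fun l m => q.1 (l, m) : Fin K → ℕ → ℝ),
        tscPulls μ α β σ τ (fun l m => q.1 (l, m)) (E q.2) t) :=
    (measurable_pi_lambda _ fun l => measurable_pi_lambda _ fun m => hx l m).prodMk
      (measurable_tscPulls hx hE t)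
  have hψ : Measurable fun (v : B → ℝ) (l : Fin K) => v ⟨(t, l), by simp [hB]⟩ :=
    measurable_pi_lambda _ fun l => measurable_pi_apply _
  have h4 := h3.comp hφ hψ
  have e : (fun ω => ((fun l m => X l m ω : Fin K → ℕ → ℝ),
        tscPulls μ α β σ τ (fun l m => X l m ω) (fun s l => G s l ω) t))
      = (fun q : (Fin K × ℕ → ℝ) × (A → ℝ) => ((fun l m => q.1 (l, m) : Fin K → ℕ → ℝ),
        tscPulls μ α β σ τ (fun l m => q.1 (l, m)) (E q.2) t)) ∘
        (fun ω => ((fun (p : Fin K × ℕ) => X p.1 p.2 ω), (fun (i : A) => G i.1.1 i.1.2 ω))) := by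
    funext ω
    simp only [Function.comp, Prod.mk.injEq, true_and]
    refine tscPulls_congr fun s hs => ?_
    funext l
    simp [E, hA, hs]
  rw [e]
  exact h4

/-- The law of the noise of one round. -/
noncomputable abbrev noiseLaw (K : ℕ) : Measure (Fin K → ℝ) := Measure.pi fun _ => gaussianReal 0 1

lemma map_noise (hG : IsSamplingNoise P X G) (t : ℕ) :
    P.map (fun ω l => G t l ω) = noiseLaw K := by
  have h := hG.indep.precomp (g := fun l : Fin K => (t, l)) (fun a b h => by simpa using h)
  rw [iIndepFun_iff_map_fun_eq_pi_map fun l => (hG.measurable t l).aemeasurable] at h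
  simpa [hG.map_eq] using h

/-- Freezing: given the history, the noise of the round may be integrated out as a fresh standard
normal vector. -/
lemma lintegral_noise (hX : IsRewardTable P ν X) (hG : IsSamplingNoise P X G) (t : ℕ)
    {h : ((Fin K → ℕ → ℝ) × (Fin K → ℕ)) × (Fin K → ℝ) → ENNReal} (hh : Measurable h) :
    ∫⁻ ω, h (((fun l m => X l m ω),
        tscPulls μ α β σ τ (fun l m => X l m ω) (fun s l => G s l ω) t), fun l => G t l ω) ∂P
      = ∫⁻ ω, ∫⁻ v, h (((fun l m => X l m ω),
        tscPulls μ α β σ τ (fun l m => X l m ω) (fun s l => G s l ω) t), v) ∂(noiseLaw K) ∂P := by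
  have hmV : Measurable fun ω l => G t l ω := measurable_pi_lambda _ fun l => hG.measurable t l
  have hmU : Measurable fun ω => ((fun l m => X l m ω : Fin K → ℕ → ℝ),
        tscPulls μ α β σ τ (fun l m => X l m ω) (fun s l => G s l ω) t) :=
    (measurable_pi_lambda _ fun l => measurable_pi_lambda _ fun m => hX.measurable l m).prodMk
      (measurable_tscPulls (fun l m => hX.measurable l m) (fun s l => hG.measurable s l) t)
  have hi := indepFun_history (μ := μ) (α := α) (β := β) (σ := σ) (τ := τ) hX hG t
  rw [indepFun_iff_map_prod_eq_prod_map_map hmU.aemeasurable hmV.aemeasurable, map_noise hG] at hi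
  calc _ = ∫⁻ p, h p ∂(P.map fun ω => (((fun l m => X l m ω : Fin K → ℕ → ℝ),
        tscPulls μ α β σ τ (fun l m => X l m ω) (fun s l => G s l ω) t), fun l => G t l ω)) :=
        (lintegral_map hh (hmU.prodMk hmV)).symm
    _ = _ := by
      rw [hi, lintegral_prod _ hh.aemeasurable, lintegral_map hh.lintegral_prod_right' hmU]

end Independence

/-! ### One Thompson step: arm `k` against the optimal arm. -/

section OneStep

/-- Upper tail of the standard normal law. -/
noncomputable def gaussTail (z : ℝ) : ENNReal := gaussianReal 0 1 (Set.Ioi z)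

/-- Distribution function of the standard normal law. -/
noncomputable def gaussCdf (z : ℝ) : ENNReal := gaussianReal 0 1 (Set.Iic z)

lemma gaussTail_pos (z : ℝ) : 0 < gaussTail z := by
  have h := (gaussianReal_absolutelyContinuous' 0 (v := 1) one_ne_zero)
  refine pos_iff_ne_zero.2 fun h0 => ?_
  have := h h0
  simp at this

lemma gaussTail_ne_top (z : ℝ) : gaussTail z ≠ ⊤ := measure_ne_top _ _

lemma gaussTail_antitone : Antitone gaussTail := fun _ _ h => measure_mono (Set.Ioi_subset_Ioi h)

lemma gaussCdf_mono : Monotone gaussCdf := fun _ _ h => measure_mono (Set.Iic_subset_Iic.2 h)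

lemma gaussCdf_add_gaussTail (z : ℝ) : gaussCdf z + gaussTail z = 1 := by
  have := prob_add_prob_compl (μ := gaussianReal 0 1) (measurableSet_Iic (a := z))
  rwa [Set.compl_Iic] at this

/-- The events `> a` and `≤ b` are negatively correlated: with distribution function `F`, `F(b) -
F(a) ≤ (1 - F(a))F(b)` reduces to `F(b) ≤ 1`. -/
lemma gaussianReal_Ioc_le (a b : ℝ) :
    gaussianReal 0 1 (Set.Ioi a ∩ Set.Iic b) ≤ gaussTail a * gaussCdf b := by
  rw [Set.Ioi_inter_Iic]
  rcases le_total b a with h | h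
  · simp [Set.Ioc_eq_empty_of_le h]
  have h1 : gaussCdf a + gaussianReal 0 1 (Set.Ioc a b) = gaussCdf b := by
    unfold gaussCdf
    rw [← measure_union (by rw [Set.disjoint_left]; intro x hx hx'; exact absurd hx'.1 (not_lt.2 hx))
      measurableSet_Ioc, Set.Iic_union_Ioc_eq_Iic h]
  have h2 := gaussCdf_add_gaussTail a
  have hb : gaussCdf b ≤ 1 := prob_le_one
  have ha : gaussCdf a ≠ ⊤ := measure_ne_top _ _
  have h3 : gaussCdf a + gaussianReal 0 1 (Set.Ioc a b)
      ≤ gaussCdf a + gaussTail a * gaussCdf b := by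
    rw [h1]
    calc gaussCdf b = (gaussCdf a + gaussTail a) * gaussCdf b := by rw [h2, one_mul]
      _ = gaussCdf a * gaussCdf b + gaussTail a * gaussCdf b := add_mul _ _ _
      _ ≤ gaussCdf a * 1 + gaussTail a * gaussCdf b := by gcongr
      _ = _ := by rw [mul_one]
  exact (ENNReal.add_le_add_iff_left ha).1 h3

/-- The odds of a standard normal variable not exceeding `z`. -/
noncomputable def gaussOdds (z : ℝ) : ENNReal := gaussCdf z / gaussTail z

lemma gaussOdds_mul (z : ℝ) : gaussOdds z * gaussTail z = gaussCdf z :=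
  ENNReal.div_mul_cancel (gaussTail_pos z).ne' (gaussTail_ne_top z)

lemma gaussOdds_mono : Monotone gaussOdds := fun _ _ h =>
  ENNReal.div_le_div (gaussCdf_mono h) (gaussTail_antitone h)

variable {K : ℕ} {Θ : Type*} {μ : Fin K → Θ → ℝ} {α β σ : ℝ} {τ : ℕ → Finset (Fin K) → Fin K}

/-- The odds of the Thompson sample of an arm with empirical mean `m` after `j` pulls lying
below `y`; zero for an arm that has not been pulled. -/
noncomputable def sampleOdds (β σ y m : ℝ) (j : ℕ) : ENNReal :=
  if j = 0 then 0 else gaussOdds ((y - m) / √(β * σ ^ 2 / j))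

lemma prod_eq_mul_mul_prod_erase {M : Type*} [CommMonoid M] (f : Fin K → M) {a b : Fin K}
    (h : a ≠ b) :
    ∏ l, f l = f a * f b * ∏ l ∈ (Finset.univ.erase a).erase b, f l := by
  rw [← Finset.mul_prod_erase Finset.univ f (Finset.mem_univ a),
    ← Finset.mul_prod_erase (Finset.univ.erase a) f (a := b) (by simp [h.symm]), mul_assoc]

/-- Given the history, pulling `k` with a sample below `y` is less likely than pulling the optimal
arm, up to the odds of the sample of the optimal arm. -/
lemma noiseLaw_nextArm_le (hβ : 0 < β) (hσ : 0 < σ) (hτ : IsTieBreaking τ) {ks k : Fin K}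
    (hne : ks ≠ k) {x : Fin K → ℕ → ℝ} {t : ℕ} {n : Fin K → ℕ}
    (hks : ks ∈ competitiveSet μ α σ t n (empMean x n)) (hn : n k ≠ 0) (y : ℝ)
    {A : Set ℝ} {q : ENNReal}
    (hq : ∀ b, gaussianReal 0 1 (A ∩ Set.Iic b) ≤ q * gaussCdf b) :
    noiseLaw K {v | nextArm μ α σ τ (tsSample β σ fun _ => v) x t n = k ∧ v k ∈ A ∧
        empMean x n k + √(β * σ ^ 2 / n k) * v k ≤ y}
      ≤ q * sampleOdds β σ y (empMean x n ks) (n ks) *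
        noiseLaw K {v | nextArm μ α σ τ (tsSample β σ fun _ => v) x t n = ks} := by
  classical
  set m := empMean x n with hm
  set C := competitiveSet μ α σ t n m with hC
  have hmem : ∀ v, nextArm μ α σ τ (tsSample β σ fun _ => v) x t n ∈
      argmaxOn C (tsSample β σ (fun _ => v) t n m) := fun v => nextArm_mem hτ k t n
  have hS : ∀ (l : Fin K) (v : Fin K → ℝ), n l ≠ 0 → tsSample β σ (fun _ => v) t n m l
      = ((m l + √(β * σ ^ 2 / n l) * v l : ℝ) : EReal) := fun l v h => by simp [tsSample, h]
  have hst : ∀ l, n l ≠ 0 → 0 < √(β * σ ^ 2 / n l) := fun l hl => by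
    have : (0 : ℝ) < n l := by exact_mod_cast Nat.pos_of_ne_zero hl
    positivity
  have hbelow : ∀ l (v : Fin K → ℝ), n l ≠ 0 →
      (m l + √(β * σ ^ 2 / n l) * v l ≤ y ↔ v l ∈ Set.Iic ((y - m l) / √(β * σ ^ 2 / n l))) :=
    fun l v hl => by
      rw [Set.mem_Iic, le_div_iff₀ (hst l hl)]
      constructor <;> intro h <;> linarith
  -- An unpulled optimal arm has an infinite sample, so `k` is never chosen; this matches the value
  -- `0` of `sampleOdds`.
  rcases eq_or_ne (n ks) 0 with h0 | h0
  · have : {v | nextArm μ α σ τ (tsSample β σ fun _ => v) x t n = k ∧ v k ∈ A ∧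
        m k + √(β * σ ^ 2 / n k) * v k ≤ y} = ∅ := by
      ext v
      simp only [Set.mem_ofPred_eq, Set.mem_empty_iff_false, iff_false, not_and]
      intro h
      have h1 := hmem v
      rw [h, mem_argmaxOn] at h1
      have h2 := h1.2 ks hks
      rw [hS k v hn] at h2
      simp only [tsSample, h0, if_true, top_le_iff] at h2
      exact absurd h2 (EReal.coe_ne_top _)
    rw [this, measure_empty]
    exact zero_le
  · set b := (y - m k) / √(β * σ ^ 2 / n k) with hb
    set c := (y - m ks) / √(β * σ ^ 2 / n ks) with hc
    -- `B l`: arm `l` does not compete, or its sample is at most `y`. The competitive set depends on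
    -- the history only, so each condition concerns a single coordinate.
    let B : Fin K → Set ℝ := fun l =>
      {r | l ∈ C → tsSample β σ (fun _ _ => r) t n m l ≤ (y : EReal)}
    have hB : ∀ l (v : Fin K → ℝ), v l ∈ B l ↔
      (l ∈ C → tsSample β σ (fun _ => v) t n m l ≤ (y : EReal)) := fun l v => by
        simp only [B, Set.mem_ofPred_eq, tsSample]
    -- The event lies in the box `D1`. In `D2` the sample of `ks` is instead above `y`, which makes
    -- `ks` the only maximizer. The boxes differ only in the coordinates `ks` and `k`, so the ratio
    -- of their product measures is explicit.
    let D1 : Fin K → Set ℝ := fun l =>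
      if l = ks then Set.Iic c else if l = k then A ∩ Set.Iic b else B l
    let D2 : Fin K → Set ℝ := fun l =>
      if l = ks then Set.Ioi c else if l = k then Set.Iic b else B l
    have hsub1 : {v | nextArm μ α σ τ (tsSample β σ fun _ => v) x t n = k ∧ v k ∈ A ∧
        m k + √(β * σ ^ 2 / n k) * v k ≤ y} ⊆ Set.univ.pi D1 := by
      rintro v ⟨h, hvA, hvy⟩ l -
      have h1 := hmem v
      rw [h, mem_argmaxOn] at h1
      have hall : ∀ l ∈ C, tsSample β σ (fun _ => v) t n m l ≤ (y : EReal) := fun l hl => by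
        refine (h1.2 l hl).trans ?_
        rw [hS k v hn]
        exact_mod_cast hvy
      simp only [D1]
      split_ifs with e1 e2
      · subst e1
        have := hall l hks
        rw [hS l v h0] at this
        exact (hbelow l v h0).1 (by exact_mod_cast this)
      · subst e2
        exact ⟨hvA, (hbelow l v hn).1 hvy⟩
      · exact (hB l v).2 (hall l)
    have hsub2 : Set.univ.pi D2 ⊆
        {v | nextArm μ α σ τ (tsSample β σ fun _ => v) x t n = ks} := by
      intro v hv
      have hvs : (y : EReal) < tsSample β σ (fun _ => v) t n m ks := by
        have := hv ks (Set.mem_univ _)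
        simp only [D2, if_true] at this
        rw [hS ks v h0, EReal.coe_lt_coe_iff]
        by_contra hcon
        exact absurd (Set.mem_Ioi.1 this) (not_lt.2 ((hbelow ks v h0).1 (not_lt.1 hcon)))
      have hoth : ∀ l ∈ C, l ≠ ks → tsSample β σ (fun _ => v) t n m l ≤ (y : EReal) := by
        intro l hl hlk
        have := hv l (Set.mem_univ _)
        simp only [D2, if_neg hlk] at this
        split_ifs at this with e
        · subst e
          rw [hS l v hn]
          exact_mod_cast (hbelow l v hn).2 this
        · exact (hB l v).1 this hl
      have h1 := hmem v
      rw [mem_argmaxOn] at h1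
      by_contra hcon
      exact absurd ((h1.2 ks hks).trans (hoth _ h1.1 hcon)) (not_le.2 hvs)
    have hP1 : noiseLaw K (Set.univ.pi D1) = gaussCdf c * gaussianReal 0 1 (A ∩ Set.Iic b) *
        ∏ l ∈ (Finset.univ.erase ks).erase k, gaussianReal 0 1 (B l) := by
      rw [Measure.pi_pi, prod_eq_mul_mul_prod_erase _ hne]
      congr 1
      · simp [D1, hne.symm, gaussCdf]
      · refine Finset.prod_congr rfl fun l hl => ?_
        simp only [Finset.mem_erase] at hl
        simp [D1, hl.1, hl.2.1]
    have hP2 : noiseLaw K (Set.univ.pi D2) = gaussTail c * gaussCdf b *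
        ∏ l ∈ (Finset.univ.erase ks).erase k, gaussianReal 0 1 (B l) := by
      rw [Measure.pi_pi, prod_eq_mul_mul_prod_erase _ hne]
      congr 1
      · simp [D2, hne.symm, gaussCdf, gaussTail]
      · refine Finset.prod_congr rfl fun l hl => ?_
        simp only [Finset.mem_erase] at hl
        simp [D2, hl.1, hl.2.1]
    calc _ ≤ noiseLaw K (Set.univ.pi D1) := measure_mono hsub1
      _ ≤ gaussCdf c * (q * gaussCdf b) *
          ∏ l ∈ (Finset.univ.erase ks).erase k, gaussianReal 0 1 (B l) := by
        rw [hP1]; gcongr; exact hq b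
      _ = q * sampleOdds β σ y (m ks) (n ks) * noiseLaw K (Set.univ.pi D2) := by
        rw [hP2, ← gaussOdds_mul c, sampleOdds, if_neg h0, ← hc]; ring
      _ ≤ _ := by gcongr

lemma noiseLaw_apply (l : Fin K) {A : Set ℝ} (hA : MeasurableSet A) :
    noiseLaw K {v | v l ∈ A} = gaussianReal 0 1 A :=
  (measurePreserving_eval (fun _ : Fin K => gaussianReal 0 1) l).measure_preimage
    hA.nullMeasurableSet

end OneStep

/-! ### Concentration of the empirical means. -/

section Concentration

variable {K : ℕ} {Θ : Type*} {μ : Fin K → Θ → ℝ} {θ : Θ} {α : ℝ} {σ : ℝ≥0}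
  {ν : Fin K → Measure ℝ}
  {Ω : Type*} {X : Fin K → ℕ → Ω → ℝ}

/-- Sum of the deviations of the first `n` rewards `x` from the mean `c`. -/
noncomputable def sumDev (x : ℕ → ℝ) (c : ℝ) (n : ℕ) : ℝ := ∑ m ∈ Finset.range n, (x m - c)

lemma empMean_sub {x : Fin K → ℕ → ℝ} {n : Fin K → ℕ} {l : Fin K} (h : n l ≠ 0) (c : ℝ) :
    empMean x n l - c = sumDev (x l) c (n l) / n l := by
  have : (n l : ℝ) ≠ 0 := by exact_mod_cast h
  simp only [empMean, sumDev, Finset.sum_sub_distrib, Finset.sum_const, Finset.card_range,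
    nsmul_eq_mul]
  field_simp

/-- The event that some arm deviates from its mean by more than the confidence radius. -/
def badEvent (μ : Fin K → Θ → ℝ) (θ : Θ) (α : ℝ) (σ : ℝ≥0) (X : Fin K → ℕ → Ω → ℝ) (t : ℕ) :
    Set Ω :=
  ⋃ l, ⋃ j ∈ Finset.Icc 1 t,
    {ω | √(2 * α * σ ^ 2 * Real.log t * j) ≤ |sumDev (fun m => X l m ω) (μ l θ) j|}

lemma badEvent_zero : badEvent μ θ α σ X 0 = ∅ := by simp [badEvent]

/-- `badEvent` ranges over all counts `1 ≤ j ≤ t`, hence controls the random counts too. An unpulled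
arm imposes no constraint. -/
lemma mem_confSet_of_notMem_badEvent {t : ℕ} {n : Fin K → ℕ} {ω : Ω} (hn : ∀ l, n l ≤ t)
    (h : ω ∉ badEvent μ θ α σ X t) :
    θ ∈ confSet μ α σ t n (empMean (fun l m => X l m ω) n) := by
  intro l
  unfold confRadius
  split_ifs with h0
  · exact EReal.coe_lt_top _
  · rw [EReal.coe_lt_coe_iff]
    by_contra hcon
    refine h ?_
    simp only [badEvent, Set.mem_iUnion]
    refine ⟨l, n l, Finset.mem_Icc.2 ⟨Nat.one_le_iff_ne_zero.2 h0, hn l⟩, ?_⟩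
    have hp : (0 : ℝ) < n l := by exact_mod_cast Nat.pos_of_ne_zero h0
    rw [abs_sub_comm, empMean_sub h0, abs_div, abs_of_pos hp, not_lt, le_div_iff₀ hp] at hcon
    rw [Set.mem_ofPred_eq]
    refine le_trans (le_of_eq ?_) hcon
    rw [← Real.sqrt_sq hp.le, ← Real.sqrt_mul' _ (by positivity), Real.sqrt_sq hp.le]
    congr 1
    field_simp

variable [MeasurableSpace Ω] {P : Measure Ω}

lemma measurable_sumDev (hX : IsRewardTable P ν X) (l : Fin K) (c : ℝ) (n : ℕ) :
    Measurable fun ω => sumDev (fun m => X l m ω) c n :=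
  Finset.measurable_sum _ fun m _ => (hX.measurable l m).sub_const c

lemma hasSubgaussianMGF_sumDev [IsProbabilityMeasure P] (hX : IsRewardTable P ν X)
    (hsubG : ∀ l, HasSubgaussianMGF (fun r => r - μ l θ) (σ ^ 2) (ν l)) (l : Fin K) (n : ℕ) :
    HasSubgaussianMGF (fun ω => sumDev (fun m => X l m ω) (μ l θ) n) (n * σ ^ 2) P := by
  have h1 : ∀ m, HasSubgaussianMGF (fun ω => X l m ω - μ l θ) (σ ^ 2) P := fun m => by
    have := hsubG l
    rw [← hX.map_eq l m] at this
    exact HasSubgaussianMGF.of_map (hX.measurable l m).aemeasurable this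
  have h2 : iIndepFun (fun m ω => X l m ω - μ l θ) P :=
    (hX.indep.precomp (g := fun m : ℕ => (l, m)) (fun a b h => by simpa using h)).comp
      (fun _ r => r - μ l θ) (fun _ => measurable_id.sub_const _)
  have h3 := HasSubgaussianMGF.sum_of_iIndepFun h2 (s := Finset.range n) (fun m _ => h1 m)
  simpa [sumDev] using h3

lemma measurableSet_badEvent (hX : IsRewardTable P ν X) (t : ℕ) :
    MeasurableSet (badEvent μ θ α σ X t) := by
  refine MeasurableSet.iUnion fun l => Finset.measurableSet_biUnion _ fun j _ => ?_
  exact measurableSet_le measurable_const (measurable_sumDev hX l _ j).abs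

lemma measure_abs_sumDev_ge_le [IsProbabilityMeasure P] (hX : IsRewardTable P ν X)
    (hsubG : ∀ l, HasSubgaussianMGF (fun r => r - μ l θ) (σ ^ 2) (ν l)) (l : Fin K) (n : ℕ)
    {ε : ℝ} (hε : 0 ≤ ε) :
    P {ω | ε ≤ |sumDev (fun m => X l m ω) (μ l θ) n|}
      ≤ ENNReal.ofReal (2 * Real.exp (-ε ^ 2 / (2 * (n * σ ^ 2)))) := by
  have h := hasSubgaussianMGF_sumDev (P := P) hX hsubG l n
  have h1 := h.measure_ge_le hε
  have h2 := h.neg.measure_ge_le hε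
  have hsub : {ω | ε ≤ |sumDev (fun m => X l m ω) (μ l θ) n|}
      ⊆ {ω | ε ≤ sumDev (fun m => X l m ω) (μ l θ) n}
        ∪ {ω | ε ≤ (-fun ω => sumDev (fun m => X l m ω) (μ l θ) n) ω} := by
    intro ω hω
    simp only [Set.mem_union, Set.mem_ofPred_eq] at hω ⊢
    exact le_abs.1 hω
  have h3 := (measureReal_mono (μ := P) hsub).trans (measureReal_union_le _ _)
  rw [← ENNReal.ofReal_toReal (measure_ne_top P _)]
  refine ENNReal.ofReal_le_ofReal ?_
  push_cast at h1 h2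
  change P.real _ ≤ _
  linarith

/-- Union bound over `K` arms and `t` counts. At the confidence radius the two-sided sub-Gaussian
tail is exactly `2t^(-α)`, whatever the count. -/
lemma measure_badEvent_le [IsProbabilityMeasure P] (hσ : 0 < σ) (hα : 0 ≤ α)
    (hX : IsRewardTable P ν X)
    (hsubG : ∀ l, HasSubgaussianMGF (fun r => r - μ l θ) (σ ^ 2) (ν l)) {t : ℕ} (ht : 1 ≤ t) :
    P (badEvent μ θ α σ X t) ≤ ENNReal.ofReal (2 * K * (t : ℝ) ^ (1 - α)) := by
  have ht0 : (0 : ℝ) < t := by exact_mod_cast ht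
  have hlog : 0 ≤ Real.log t := Real.log_nonneg (by exact_mod_cast ht)
  have hσ' : (0 : ℝ) < σ := by exact_mod_cast hσ
  have h1 : ∀ l, ∀ j ∈ Finset.Icc 1 t,
      P {ω | √(2 * α * σ ^ 2 * Real.log t * j) ≤ |sumDev (fun m => X l m ω) (μ l θ) j|}
        ≤ ENNReal.ofReal (2 * (t : ℝ) ^ (-α)) := by
    intro l j hj
    refine (measure_abs_sumDev_ge_le hX hsubG l j (Real.sqrt_nonneg _)).trans
      (ENNReal.ofReal_le_ofReal (le_of_eq ?_))
    have hj0 : (0 : ℝ) < j := by exact_mod_cast (Finset.mem_Icc.1 hj).1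
    rw [Real.sq_sqrt (by positivity), Real.rpow_def_of_pos ht0]
    congr 2
    field_simp
  calc P (badEvent μ θ α σ X t)
      ≤ ∑ l, ∑ j ∈ Finset.Icc 1 t,
        P {ω | √(2 * α * σ ^ 2 * Real.log t * j) ≤ |sumDev (fun m => X l m ω) (μ l θ) j|} := by
        refine (measure_iUnion_le _).trans ?_
        rw [tsum_fintype]
        exact Finset.sum_le_sum fun l _ => measure_biUnion_finset_le _ _
    _ ≤ ∑ _l : Fin K, ∑ _j ∈ Finset.Icc 1 t, ENNReal.ofReal (2 * (t : ℝ) ^ (-α)) :=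
        Finset.sum_le_sum fun l _ => Finset.sum_le_sum fun j hj => h1 l j hj
    _ = ENNReal.ofReal (2 * K * (t : ℝ) ^ (1 - α)) := by
        simp only [Finset.sum_const, Finset.card_univ, Fintype.card_fin, Nat.card_Icc,
          add_tsub_cancel_right, nsmul_eq_mul]
        rw [← ENNReal.ofReal_natCast, ← ENNReal.ofReal_natCast, ← ENNReal.ofReal_mul (by positivity),
          ← ENNReal.ofReal_mul (by positivity)]
        congr 1
        rw [show (1 : ℝ) - α = 1 + -α by ring, Real.rpow_add ht0, Real.rpow_one]
        ring

lemma measure_sumDev_ge_le [IsProbabilityMeasure P] (hX : IsRewardTable P ν X)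
    (hsubG : ∀ l, HasSubgaussianMGF (fun r => r - μ l θ) (σ ^ 2) (ν l)) (l : Fin K) {n : ℕ}
    (hn : n ≠ 0) {δ : ℝ} (hδ : 0 ≤ δ) :
    P {ω | n * δ ≤ sumDev (fun m => X l m ω) (μ l θ) n}
      ≤ ENNReal.ofReal (Real.exp (-(n * δ ^ 2 / (2 * σ ^ 2)))) := by
  have h1 := (hasSubgaussianMGF_sumDev (P := P) hX hsubG l n).measure_ge_le
    (ε := n * δ) (by positivity)
  rw [← ENNReal.ofReal_toReal (measure_ne_top P _)]
  refine ENNReal.ofReal_le_ofReal (h1.trans (le_of_eq ?_))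
  congr 1
  push_cast
  have : (n : ℝ) ≠ 0 := by exact_mod_cast hn
  rcases eq_or_ne (σ : ℝ) 0 with h | h
  · simp [h]
  · field_simp

end Concentration

/-! ### Counting lemmas and passage from `ENNReal` to real bounds. -/

section Counting

/-- The threshold `max L 1` puts the count `0` among the small ones, and it costs nothing since
`⌈max L 1⌉ ≤ L + 1` still holds. -/
lemma sum_ite_lt_le {L : ℝ} (hL : 0 ≤ L) (N : ℕ) :
    ∑ n ∈ Finset.range N, (if (n : ℝ) < max L 1 then (1 : ENNReal) else 0)
      ≤ ENNReal.ofReal (L + 1) := by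
  have hM : (0 : ℝ) ≤ max L 1 := le_max_of_le_left hL
  calc ∑ n ∈ Finset.range N, (if (n : ℝ) < max L 1 then (1 : ENNReal) else 0)
      = ((Finset.range N).filter fun n : ℕ => (n : ℝ) < max L 1).card := by
        rw [Finset.sum_ite]; simp
    _ ≤ (⌈max L 1⌉₊ : ENNReal) := by
        have : ((Finset.range N).filter fun n : ℕ => (n : ℝ) < max L 1)
            ⊆ Finset.range ⌈max L 1⌉₊ := by
          intro n hn
          exact Finset.mem_range.2 (Nat.lt_ceil.2 (Finset.mem_filter.1 hn).2)
        exact_mod_cast (Finset.card_le_card this).trans (Finset.card_range _).le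
    _ ≤ ENNReal.ofReal (L + 1) := by
        rw [← ENNReal.ofReal_natCast]
        refine ENNReal.ofReal_le_ofReal ?_
        rcases le_total L 1 with h | h
        · rw [max_eq_right h]; simp; linarith
        · rw [max_eq_left h]; exact (Nat.ceil_lt_add_one hL).le

lemma integral_natCast_le {Ω : Type*} [MeasurableSpace Ω] {P : Measure Ω} {N : Ω → ℕ}
    (hN : Measurable N) {B : ℝ} (hB : 0 ≤ B)
    (h : ∫⁻ ω, (N ω : ENNReal) ∂P ≤ ENNReal.ofReal B) : ∫ ω, (N ω : ℝ) ∂P ≤ B := by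
  rw [integral_eq_lintegral_of_nonneg_ae (Eventually.of_forall fun ω => Nat.cast_nonneg _)
    (measurable_from_nat.comp hN).aestronglyMeasurable]
  simp only [ENNReal.ofReal_natCast]
  exact ENNReal.toReal_le_of_le_ofReal hB h

lemma integrable_natCast_of_le {Ω : Type*} [MeasurableSpace Ω] {P : Measure Ω}
    [IsFiniteMeasure P] {N : Ω → ℕ} (hN : Measurable N) {T : ℕ} (h : ∀ ω, N ω ≤ T) :
    Integrable (fun ω => (N ω : ℝ)) P :=
  Integrable.of_bound (measurable_from_nat.comp hN).aestronglyMeasurable T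
    (Eventually.of_forall fun ω => by
      rw [Real.norm_of_nonneg (Nat.cast_nonneg _)]; exact_mod_cast h ω)

lemma sum_Icc_rpow_le {s : ℝ} (hs : s < -1) :
    ∃ C : ℝ, ∀ T : ℕ, ∑ t ∈ Finset.Icc 1 T, (t : ℝ) ^ s ≤ C :=
  ⟨∑' t : ℕ, (t : ℝ) ^ s, fun _ => (Real.summable_nat_rpow.2 hs).sum_le_tsum _
    fun _ _ => Real.rpow_nonneg (Nat.cast_nonneg _) _⟩

lemma isBigO_log_of_le {f : ℕ → ℝ} {a b : ℝ} (h0 : ∀ T, 0 ≤ f T)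
    (h : ∀ T : ℕ, f T ≤ a * Real.log T + b) : f =O[atTop] fun T : ℕ => Real.log T := by
  refine IsBigO.of_bound (a + |b|) ?_
  -- From `T = 3` on, `log T ≥ 1` absorbs the additive constant.
  filter_upwards [eventually_ge_atTop 3] with T hT
  have h3 : (3 : ℝ) ≤ T := by exact_mod_cast hT
  have hlog : 1 ≤ Real.log T := by
    rw [Real.le_log_iff_exp_le (by linarith)]
    exact (Real.exp_one_lt_d9.le.trans (by norm_num)).trans h3
  rw [Real.norm_of_nonneg (h0 T), Real.norm_of_nonneg (by linarith)]
  have := h T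
  have := le_abs_self b
  have := abs_nonneg b
  nlinarith

end Counting

/-! ### The bound for UCB-C. -/

section UCB

variable {K : ℕ} {Θ : Type*} {μ : Fin K → Θ → ℝ} {θ : Θ} {ks k : Fin K} {α : ℝ} {σ : ℝ≥0}
  {τ : ℕ → Finset (Fin K) → Fin K} {ν : Fin K → Measure ℝ}
  {Ω : Type*} [MeasurableSpace Ω] {P : Measure Ω} {X : Fin K → ℕ → Ω → ℝ}

lemma measurable_ucbcPulls (hX : IsRewardTable P ν X) (T : ℕ) :
    Measurable fun ω => ucbcPulls μ α σ τ (fun l m => X l m ω) T k :=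
  measurable_pi_iff.1 (measurable_pulls (x := fun ω l m => X l m ω) (I := fun _ => ucbIndex α σ)
    (fun l m => hX.measurable l m) (fun t n l => measurable_ucbIndex t n l) T) k

/-- The bad event at `t = 0` is empty, so the sum may be shifted to start at `1`, where the bound
`2Kt^(1-α)` is available. -/
lemma sum_range_measure_badEvent_le (T : ℕ) :
    ∑ t ∈ Finset.range T, P (badEvent μ θ α σ X t)
      ≤ ∑ t ∈ Finset.Icc 1 T, P (badEvent μ θ α σ X t) := by
  calc ∑ t ∈ Finset.range T, P (badEvent μ θ α σ X t)
      ≤ ∑ t ∈ Finset.range (T + 1), P (badEvent μ θ α σ X t) :=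
        Finset.sum_le_sum_of_subset (Finset.range_subset_range.2 (Nat.le_succ T))
    _ = ∑ t ∈ Finset.Icc 1 T, P (badEvent μ θ α σ X t) := by
        rw [Finset.sum_range_succ', badEvent_zero, measure_empty, add_zero,
          Finset.range_eq_Ico, Finset.sum_Ico_add' (fun t => P (badEvent μ θ α σ X t)) 0 T 1]
        rfl

variable [IsProbabilityMeasure P]

lemma sum_measure_badEvent_le (hσ : 0 < σ) (hα : 0 ≤ α) (hX : IsRewardTable P ν X)
    (hsubG : ∀ l, HasSubgaussianMGF (fun r => r - μ l θ) (σ ^ 2) (ν l)) (T : ℕ) :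
    ∑ t ∈ Finset.range T, P (badEvent μ θ α σ X t)
      ≤ ENNReal.ofReal (∑ t ∈ Finset.Icc 1 T, 2 * (K : ℝ) * (t : ℝ) ^ (1 - α)) := by
  rw [ENNReal.ofReal_sum_of_nonneg fun t _ => by positivity]
  refine (sum_range_measure_badEvent_le T).trans (Finset.sum_le_sum fun t ht => ?_)
  exact measure_badEvent_le hσ hα hX hsubG (Finset.mem_Icc.1 ht).1

/-- A round pulling `k` either is bad or has a pull count of `k` below `max L 1`, and each count
occurs in only one such round. -/
lemma lintegral_ucbcPulls_le (hks : IsBestAt μ ks θ) (hgap : 0 < gap μ θ ks k) (hσ : 0 < σ)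
    (hα : 0 < α) (hτ : IsTieBreaking τ) (hX : IsRewardTable P ν X)
    (hsubG : ∀ l, HasSubgaussianMGF (fun r => r - μ l θ) (σ ^ 2) (ν l)) (T : ℕ) :
    ∫⁻ ω, (ucbcPulls μ α σ τ (fun l m => X l m ω) T k : ENNReal) ∂P
      ≤ ENNReal.ofReal (8 * α * (σ : ℝ) ^ 2 * Real.log T / gap μ θ ks k ^ 2 + 1
          + ∑ t ∈ Finset.Icc 1 T, 2 * (K : ℝ) * (t : ℝ) ^ (1 - α)) := by
  have hT0 : 0 ≤ Real.log T := Real.log_natCast_nonneg T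
  set L := 8 * α * (σ : ℝ) ^ 2 * Real.log T / gap μ θ ks k ^ 2 with hL
  have hL0 : 0 ≤ L := by positivity
  have hpt : ∀ ω, (ucbcPulls μ α σ τ (fun l m => X l m ω) T k : ENNReal)
      ≤ ENNReal.ofReal (L + 1)
        + ∑ t ∈ Finset.range T, (badEvent μ θ α σ X t).indicator 1 ω := by
    intro ω
    set x : Fin K → ℕ → ℝ := fun l m => X l m ω with hx
    refine le_trans ?_ (add_le_add_left (sum_ite_lt_le hL0
      (pulls μ α σ τ (ucbIndex α σ) x T k)) _)
    rw [← sum_ite_armAt, ← Finset.sum_add_distrib, ucbcPulls, pulls_eq_sum]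
    push_cast
    refine Finset.sum_le_sum fun t ht => ?_
    by_cases hk : armAt μ α σ τ (ucbIndex α σ) x t = k
    · rw [if_pos hk, if_pos hk]
      by_cases hb : ω ∈ badEvent μ θ α σ X t
      · rw [Set.indicator_of_mem hb]; simp
      · have hθ := mem_confSet_of_notMem_badEvent
          (n := pulls μ α σ τ (ucbIndex α σ) x t) (fun l => pulls_le t l) hb
        rw [if_pos]
        · simp
        · by_cases hn : pulls μ α σ τ (ucbIndex α σ) x t k = 0
          · rw [hn]; simp
          · refine lt_max_of_lt_left ((lt_of_nextArm_ucb hτ hks hgap hθ hk hn).trans_le ?_)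
            rw [hL]
            have htT : t < T := Finset.mem_range.1 ht
            have : Real.log t ≤ Real.log T := by
              -- At `t = 0` the default value `Real.log 0 = 0` is used.
              rcases Nat.eq_zero_or_pos t with h | h
              · simp [h, hT0]
              · exact Real.log_le_log (by exact_mod_cast h) (by exact_mod_cast htT.le)
            gcongr
    · simp [hk]
  calc _ ≤ ∫⁻ ω, (ENNReal.ofReal (L + 1)
        + ∑ t ∈ Finset.range T, (badEvent μ θ α σ X t).indicator 1 ω) ∂P := lintegral_mono hpt
    _ = ENNReal.ofReal (L + 1) + ∑ t ∈ Finset.range T, P (badEvent μ θ α σ X t) := by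
      rw [lintegral_add_left measurable_const, lintegral_finsetSum _ fun t _ =>
        measurable_one.indicator (measurableSet_badEvent hX t)]
      simp [lintegral_indicator_one (measurableSet_badEvent hX _)]
    _ ≤ _ := by
      rw [ENNReal.ofReal_add (by positivity)
        (Finset.sum_nonneg fun t _ => by positivity)]
      gcongr
      exact sum_measure_badEvent_le hσ hα.le hX hsubG T

end UCB

/-! ### Layers of the sample of `k` under TS-C. -/

section Thompson

variable {K : ℕ} {Θ : Type*} {μ : Fin K → Θ → ℝ} {θ : Θ} {ks k : Fin K} {α β : ℝ} {σ : ℝ≥0}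
  {τ : ℕ → Finset (Fin K) → Fin K} {ν : Fin K → Measure ℝ}
  {Ω : Type*} [MeasurableSpace Ω] {P : Measure Ω} {X : Fin K → ℕ → Ω → ℝ}
  {G : ℕ → Fin K → Ω → ℝ}

lemma measurable_empMean_comp {S : Type*} [MeasurableSpace S] {x : S → Fin K → ℕ → ℝ}
    (hx : ∀ l m, Measurable fun s => x s l m) {N : S → Fin K → ℕ} (hN : Measurable N) :
    Measurable fun s => empMean (x s) (N s) :=
  Measurable.comp (g := fun p : S × (Fin K → ℕ) => empMean (x p.1) p.2)
    (f := fun s => (s, N s)) (measurable_from_prod_countable_left fun n =>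
      measurable_empMean hx n) (measurable_id.prodMk hN)

lemma measurable_sampleOdds (y : ℝ) (j : ℕ) : Measurable fun m => sampleOdds β σ y m j := by
  unfold sampleOdds
  split_ifs
  · exact measurable_const
  · exact gaussOdds_mono.measurable.comp (by fun_prop)

lemma measurable_sampleOdds_comp {S : Type*} [MeasurableSpace S] {m : S → ℝ}
    (hm : Measurable m) {j : S → ℕ} (hj : Measurable j) (y : ℝ) :
    Measurable fun s => sampleOdds β σ y (m s) (j s) :=
  Measurable.comp (g := fun p : ℝ × ℕ => sampleOdds β σ y p.1 p.2)
    (f := fun s => (m s, j s)) (measurable_from_prod_countable_left fun n =>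
      measurable_sampleOdds y n) (hm.prodMk hj)

/-- Rewards and pull counts of the first `t` rounds of TS-C. -/
noncomputable def tsHistory (μ : Fin K → Θ → ℝ) (α β : ℝ) (σ : ℝ≥0)
    (τ : ℕ → Finset (Fin K) → Fin K) (X : Fin K → ℕ → Ω → ℝ) (G : ℕ → Fin K → Ω → ℝ) (t : ℕ)
    (ω : Ω) : (Fin K → ℕ → ℝ) × (Fin K → ℕ) :=
  ((fun l m => X l m ω), tscPulls μ α β σ τ (fun l m => X l m ω) (fun s l => G s l ω) t)

/-- The arm pulled by TS-C in round `t + 1`. -/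
noncomputable def tsArm (μ : Fin K → Θ → ℝ) (α β : ℝ) (σ : ℝ≥0)
    (τ : ℕ → Finset (Fin K) → Fin K) (X : Fin K → ℕ → Ω → ℝ) (G : ℕ → Fin K → Ω → ℝ) (t : ℕ)
    (ω : Ω) : Fin K :=
  armAt μ α σ τ (tsSample β σ fun s l => G s l ω) (fun l m => X l m ω) t

/-- The arm chosen in round `t + 1` from a history and the noise of the round. -/
noncomputable def tsChoice (μ : Fin K → Θ → ℝ) (α β : ℝ) (σ : ℝ≥0)
    (τ : ℕ → Finset (Fin K) → Fin K) (t : ℕ)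
    (p : ((Fin K → ℕ → ℝ) × (Fin K → ℕ)) × (Fin K → ℝ)) : Fin K :=
  nextArm μ α σ τ (tsSample β σ fun _ => p.2) p.1.1 t p.1.2

lemma measurable_tsChoice (t : ℕ) : Measurable (tsChoice μ α β σ τ t) :=
  measurable_nextArm_comp
    (S := ((Fin K → ℕ → ℝ) × (Fin K → ℕ)) × (Fin K → ℝ)) (x := fun p => p.1.1)
    (I := fun p => tsSample β σ fun _ => p.2) (fun l m => by fun_prop)
    (measurable_tsSample (S := ((Fin K → ℕ → ℝ) × (Fin K → ℕ)) × (Fin K → ℝ))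
      (g := fun p _ => p.2) fun s l => by fun_prop) t (N := fun p => p.1.2) (by fun_prop)

/-- The mean of the sample of an arm and its deviation, as functions of the history and the
noise. -/
noncomputable def tsValue (β : ℝ) (σ : ℝ≥0) (l : Fin K)
    (p : ((Fin K → ℕ → ℝ) × (Fin K → ℕ)) × (Fin K → ℝ)) : ℝ :=
  empMean p.1.1 p.1.2 l + √(β * σ ^ 2 / p.1.2 l) * p.2 l

lemma measurable_tsValue (l : Fin K) : Measurable (tsValue β σ l) := by
  have h1 : Measurable fun p : ((Fin K → ℕ → ℝ) × (Fin K → ℕ)) × (Fin K → ℝ) =>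
      empMean p.1.1 p.1.2 :=
    measurable_empMean_comp (S := ((Fin K → ℕ → ℝ) × (Fin K → ℕ)) × (Fin K → ℝ))
      (x := fun p => p.1.1) (fun l m => by fun_prop) (N := fun p => p.1.2) (by fun_prop)
  have h2 : Measurable fun p : ((Fin K → ℕ → ℝ) × (Fin K → ℕ)) × (Fin K → ℝ) =>
      ((p.1.2 l : ℕ) : ℝ) := measurable_from_nat.comp (by fun_prop)
  exact (measurable_pi_iff.1 h1 l).add ((h2.const_div _).sqrt.mul (by fun_prop))

lemma measurable_tsHistory (hX : IsRewardTable P ν X) (hG : IsSamplingNoise P X G) (t : ℕ) :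
    Measurable (tsHistory μ α β σ τ X G t) :=
  (measurable_pi_lambda _ fun l => measurable_pi_lambda _ fun m => hX.measurable l m).prodMk
    (measurable_tscPulls (fun l m => hX.measurable l m) (fun s l => hG.measurable s l) t)

lemma measurable_tsArm (hX : IsRewardTable P ν X) (hG : IsSamplingNoise P X G) (t : ℕ) :
    Measurable (tsArm μ α β σ τ X G t) :=
  measurable_armAt (x := fun ω l m => X l m ω) (I := fun ω => tsSample β σ fun s l => G s l ω)
    (fun l m => hX.measurable l m)
    (measurable_tsSample (g := fun ω s l => G s l ω) fun s l => hG.measurable s l) t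

lemma lintegral_indicator_one_comp {A : Type*} [MeasurableSpace A] {Q : Measure Ω} {f : Ω → A}
    (hf : Measurable f) {D : Set A} (hD : MeasurableSet D) :
    ∫⁻ ω, D.indicator 1 (f ω) ∂Q = Q (f ⁻¹' D) := by
  rw [← lintegral_indicator_one (hf hD)]
  rfl

variable [IsProbabilityMeasure P]

/-- Integrates `noiseLaw_nextArm_le` over the histories in `H`. The lower cut-off is in `EReal` so
that `⊥` gives a layer without one; `q` is the price of exceeding it. -/
lemma measure_layer_le (hβ : 0 < β) (hσ : 0 < σ) (hτ : IsTieBreaking τ) (hne : ks ≠ k)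
    (hX : IsRewardTable P ν X) (hG : IsSamplingNoise P X G) (t : ℕ)
    {H : Set ((Fin K → ℕ → ℝ) × (Fin K → ℕ))} (hH : MeasurableSet H) (ylo : EReal) (y : ℝ)
    {q : ENNReal} (hHk : ∀ u ∈ H, u.2 k ≠ 0)
    (hHs : ∀ u ∈ H, ks ∈ competitiveSet μ α σ t u.2 (empMean u.1 u.2))
    (hq : ∀ u ∈ H, ∀ b, gaussianReal 0 1
      ({r | ylo < ((empMean u.1 u.2 k + √(β * σ ^ 2 / u.2 k) * r : ℝ) : EReal)} ∩ Set.Iic b)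
        ≤ q * gaussCdf b) :
    P {ω | tsHistory μ α β σ τ X G t ω ∈ H ∧ tsArm μ α β σ τ X G t ω = k ∧
        ylo < (tsValue β σ k (tsHistory μ α β σ τ X G t ω, fun l => G t l ω) : EReal) ∧
        tsValue β σ k (tsHistory μ α β σ τ X G t ω, fun l => G t l ω) ≤ y}
      ≤ ∫⁻ ω, (if tsArm μ α β σ τ X G t ω = ks then
          q * sampleOdds β σ y (empMean (tsHistory μ α β σ τ X G t ω).1
            (tsHistory μ α β σ τ X G t ω).2 ks) ((tsHistory μ α β σ τ X G t ω).2 ks)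
          else 0) ∂P := by
  let D : Set (((Fin K → ℕ → ℝ) × (Fin K → ℕ)) × (Fin K → ℝ)) :=
    {p | p.1 ∈ H ∧ tsChoice μ α β σ τ t p = k ∧ ylo < (tsValue β σ k p : EReal) ∧
      tsValue β σ k p ≤ y}
  have hmv := measurable_tsValue (β := β) (σ := σ) k
  have hmc := measurable_tsChoice (μ := μ) (α := α) (β := β) (σ := σ) (τ := τ) t
  have hD : MeasurableSet D :=
    (measurable_fst hH).inter ((hmc (measurableSet_singleton k)).inter
      ((measurableSet_lt measurable_const (measurable_coe_real_ereal.comp hmv)).inter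
        (measurableSet_le hmv measurable_const)))
  let ρ : (Fin K → ℕ → ℝ) × (Fin K → ℕ) → ENNReal := fun u =>
    q * sampleOdds β σ y (empMean u.1 u.2 ks) (u.2 ks)
  have hρ : Measurable ρ := by
    refine (measurable_sampleOdds_comp (measurable_pi_iff.1 (measurable_empMean_comp
      (S := (Fin K → ℕ → ℝ) × (Fin K → ℕ)) (x := fun u => u.1) (fun l m => by fun_prop)
      (N := fun u => u.2) (by fun_prop)) ks) (by fun_prop) y).const_mul q
  let F : ((Fin K → ℕ → ℝ) × (Fin K → ℕ)) × (Fin K → ℝ) → ENNReal := fun p =>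
    if tsChoice μ α β σ τ t p = ks then ρ p.1 else 0
  have hF : Measurable F :=
    Measurable.ite (hmc (measurableSet_singleton ks)) (hρ.comp measurable_fst) measurable_const
  have hU := measurable_tsHistory (μ := μ) (α := α) (β := β) (σ := σ) (τ := τ) hX hG t
  have hV : Measurable fun ω l => G t l ω := measurable_pi_lambda _ fun l => hG.measurable t l
  have e1 : P {ω | tsHistory μ α β σ τ X G t ω ∈ H ∧ tsArm μ α β σ τ X G t ω = k ∧
        ylo < (tsValue β σ k (tsHistory μ α β σ τ X G t ω, fun l => G t l ω) : EReal) ∧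
        tsValue β σ k (tsHistory μ α β σ τ X G t ω, fun l => G t l ω) ≤ y}
      = ∫⁻ ω, D.indicator 1 (tsHistory μ α β σ τ X G t ω, fun l => G t l ω) ∂P :=
    (lintegral_indicator_one_comp (hU.prodMk hV) hD).symm
  rw [e1]
  refine (lintegral_noise hX hG t (measurable_one.indicator hD)).trans_le ?_
  refine le_trans (lintegral_mono fun ω => ?_)
    (lintegral_noise (μ := μ) (α := α) (β := β) (σ := σ) (τ := τ) hX hG t hF).ge
  change ∫⁻ v, D.indicator 1 (tsHistory μ α β σ τ X G t ω, v) ∂_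
    ≤ ∫⁻ v, F (tsHistory μ α β σ τ X G t ω, v) ∂_
  generalize tsHistory μ α β σ τ X G t ω = u
  have e2 : ∫⁻ v, D.indicator 1 (u, v) ∂(noiseLaw K) = noiseLaw K {v | (u, v) ∈ D} :=
    lintegral_indicator_one_comp measurable_prodMk_left hD
  have e3 : ∫⁻ v, F (u, v) ∂(noiseLaw K)
      = ρ u * noiseLaw K {v | tsChoice μ α β σ τ t (u, v) = ks} := by
    have hms : MeasurableSet {v | tsChoice μ α β σ τ t (u, v) = ks} :=
      (hmc.comp measurable_prodMk_left) (measurableSet_singleton ks)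
    rw [← lintegral_indicator_const hms]
    refine lintegral_congr fun v => ?_
    simp only [F, Set.indicator_apply, Set.mem_ofPred_eq]
  rw [e2, e3]
  by_cases hu : u ∈ H
  · have h := noiseLaw_nextArm_le (μ := μ) (α := α) (x := u.1) hβ (NNReal.coe_pos.2 hσ) hτ hne
      (hHs u hu) (hHk u hu) y (hq u hu)
    refine le_trans (measure_mono ?_) h
    rintro v ⟨-, h1, h2, h3⟩
    exact ⟨h1, h2, h3⟩
  · have : {v | (u, v) ∈ D} = ∅ := by
      ext v
      simp only [Set.mem_ofPred_eq, Set.mem_empty_iff_false, iff_false]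
      exact fun h => hu h.1
    rw [this, measure_empty]
    exact zero_le

/-- For samples near or above the optimal mean no comparison with `ks` is made; the tail of the
sample of `k` is small enough. -/
lemma measure_top_layer_le (hX : IsRewardTable P ν X) (hG : IsSamplingNoise P X G) (t : ℕ)
    {H : Set ((Fin K → ℕ → ℝ) × (Fin K → ℕ))} (hH : MeasurableSet H) (y : ℝ) {q : ENNReal}
    (hq : ∀ u ∈ H, gaussianReal 0 1
      {r | y < empMean u.1 u.2 k + √(β * σ ^ 2 / u.2 k) * r} ≤ q) :
    P {ω | tsHistory μ α β σ τ X G t ω ∈ H ∧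
        y < tsValue β σ k (tsHistory μ α β σ τ X G t ω, fun l => G t l ω)} ≤ q := by
  let D : Set (((Fin K → ℕ → ℝ) × (Fin K → ℕ)) × (Fin K → ℝ)) :=
    {p | p.1 ∈ H ∧ y < tsValue β σ k p}
  have hmv := measurable_tsValue (β := β) (σ := σ) k
  have hD : MeasurableSet D :=
    (measurable_fst hH).inter (measurableSet_lt measurable_const hmv)
  have hU := measurable_tsHistory (μ := μ) (α := α) (β := β) (σ := σ) (τ := τ) hX hG t
  have hV : Measurable fun ω l => G t l ω := measurable_pi_lambda _ fun l => hG.measurable t l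
  have e1 : P {ω | tsHistory μ α β σ τ X G t ω ∈ H ∧
        y < tsValue β σ k (tsHistory μ α β σ τ X G t ω, fun l => G t l ω)}
      = ∫⁻ ω, D.indicator 1 (tsHistory μ α β σ τ X G t ω, fun l => G t l ω) ∂P :=
    (lintegral_indicator_one_comp (hU.prodMk hV) hD).symm
  rw [e1]
  refine (lintegral_noise hX hG t (measurable_one.indicator hD)).trans_le ?_
  refine (lintegral_mono (g := fun _ => q) fun ω => ?_).trans (by simp)
  change ∫⁻ v, D.indicator 1 (tsHistory μ α β σ τ X G t ω, v) ∂_ ≤ q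
  generalize tsHistory μ α β σ τ X G t ω = u
  have e2 : ∫⁻ v, D.indicator 1 (u, v) ∂(noiseLaw K) = noiseLaw K {v | (u, v) ∈ D} :=
    lintegral_indicator_one_comp measurable_prodMk_left hD
  rw [e2]
  by_cases hu : u ∈ H
  · refine le_trans ?_ (hq u hu)
    rw [← noiseLaw_apply k (measurableSet_lt measurable_const (by fun_prop))]
    exact measure_mono fun v hv => hv.2
  · have : {v | (u, v) ∈ D} = ∅ := by
      ext v
      simp only [Set.mem_ofPred_eq, Set.mem_empty_iff_false, iff_false]
      exact fun h => hu h.1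
    rw [this, measure_empty]
    exact zero_le

end Thompson

/-! ### Decomposition of the expected number of pulls under TS-C. -/

section ThompsonDecomposition

variable {K : ℕ} {Θ : Type*} {μ : Fin K → Θ → ℝ} {θ : Θ} {ks k : Fin K} {α β : ℝ} {σ : ℝ≥0}
  {τ : ℕ → Finset (Fin K) → Fin K} {ν : Fin K → Measure ℝ}
  {Ω : Type*} [MeasurableSpace Ω] {P : Measure Ω}
  {X : Fin K → ℕ → Ω → ℝ} {G : ℕ → Fin K → Ω → ℝ}

lemma measurable_tscPulls_comp (hX : IsRewardTable P ν X) (hG : IsSamplingNoise P X G) (T : ℕ) :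
    Measurable fun ω => tscPulls μ α β σ τ (fun l m => X l m ω) (fun s l => G s l ω) T k :=
  measurable_pi_iff.1 (measurable_tscPulls (x := fun ω l m => X l m ω)
    (g := fun ω s l => G s l ω) (fun l m => hX.measurable l m)
    (fun s l => hG.measurable s l) T) k

lemma setOf_lt_add_mul {y m s : ℝ} (hs : 0 < s) :
    {r : ℝ | y < m + s * r} = Set.Ioi ((y - m) / s) := by
  ext r
  rw [Set.mem_Ioi, div_lt_iff₀ hs, Set.mem_ofPred_eq]
  constructor <;> intro h <;> linarith

/-- Expected total odds of the samples of the optimal arm lying below the level `a Δ` under the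
best mean, over its first `T` pull counts. -/
noncomputable def totalOdds (P : Measure Ω) (β : ℝ) (σ : ℝ≥0) (x : ℕ → Ω → ℝ) (y : ℝ) (T : ℕ) :
    ENNReal :=
  ∑ j ∈ Finset.range T, ∫⁻ ω, sampleOdds β σ y ((∑ m ∈ Finset.range j, x m ω) / j) j ∂P

/-- Each pull count of `ks` occurs in at most one round that pulls `ks`. Re-indexing by the count
`j` replaces the adaptive empirical means by means of the first `j` rewards. -/
lemma sum_lintegral_sampleOdds_le (hX : IsRewardTable P ν X) (hG : IsSamplingNoise P X G)
    (q : ENNReal) (y : ℝ) (T : ℕ) :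
    ∑ t ∈ Finset.range T, ∫⁻ ω, (if tsArm μ α β σ τ X G t ω = ks then
          q * sampleOdds β σ y (empMean (tsHistory μ α β σ τ X G t ω).1
            (tsHistory μ α β σ τ X G t ω).2 ks) ((tsHistory μ α β σ τ X G t ω).2 ks)
          else 0) ∂P
      ≤ q * totalOdds P β σ (X ks) y T := by
  have hm : ∀ j, Measurable fun ω =>
      sampleOdds β σ y ((∑ m ∈ Finset.range j, X ks m ω) / j) j := fun j =>
    (measurable_sampleOdds y j).comp
      ((Finset.measurable_sum _ fun m _ => hX.measurable ks m).div_const _)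
  have hU := fun t => measurable_tsHistory (μ := μ) (α := α) (β := β) (σ := σ) (τ := τ) hX hG t
  have hm2 : ∀ t, Measurable fun ω => (if tsArm μ α β σ τ X G t ω = ks then
          q * sampleOdds β σ y (empMean (tsHistory μ α β σ τ X G t ω).1
            (tsHistory μ α β σ τ X G t ω).2 ks) ((tsHistory μ α β σ τ X G t ω).2 ks)
          else 0) := fun t => by
    refine Measurable.ite ((measurable_tsArm hX hG t) (measurableSet_singleton ks))
      (Measurable.const_mul (measurable_sampleOdds_comp ?_ ?_ y) q) measurable_const
    · exact measurable_pi_iff.1 (measurable_empMean_comp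
        (x := fun ω => (tsHistory μ α β σ τ X G t ω).1)
        (N := fun ω => (tsHistory μ α β σ τ X G t ω).2)
        (fun l m => hX.measurable l m) (hU t).snd) ks
    · exact measurable_pi_iff.1 (hU t).snd ks
  rw [← lintegral_finsetSum _ fun t _ => hm2 t, totalOdds, ← lintegral_finsetSum _ fun j _ => hm j,
    ← lintegral_const_mul q (Finset.measurable_sum _ fun j _ => hm j)]
  refine lintegral_mono fun ω => ?_
  rw [Finset.mul_sum]
  have := sum_ite_armAt (μ := μ) (α := α) (σ := σ) (τ := τ)
    (I := tsSample β σ fun s l => G s l ω) (x := fun l m => X l m ω)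
    (fun j => q * sampleOdds β σ y ((∑ m ∈ Finset.range j, X ks m ω) / j) j) T ks
  refine (this.le.trans (Finset.sum_le_sum_of_subset
    (Finset.range_subset_range.2 (pulls_le T ks))))

/-- The histories for which the true parameter is in the confidence set, the arm `k` has been
pulled at least `L` times, and its empirical mean is accurate. -/
def typicalHistory (μ : Fin K → Θ → ℝ) (θ : Θ) (α : ℝ) (σ : ℝ≥0) (k : Fin K) (L c : ℝ) (t : ℕ) :
    Set ((Fin K → ℕ → ℝ) × (Fin K → ℕ)) :=
  {u | θ ∈ confSet μ α σ t u.2 (empMean u.1 u.2) ∧ max L 1 ≤ u.2 k ∧ empMean u.1 u.2 k < c}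

lemma measurableSet_typicalHistory (L c : ℝ) (t : ℕ) :
    MeasurableSet (typicalHistory μ θ α σ k L c t) := by
  have h1 : Measurable fun u : (Fin K → ℕ → ℝ) × (Fin K → ℕ) => empMean u.1 u.2 :=
    measurable_empMean_comp (S := (Fin K → ℕ → ℝ) × (Fin K → ℕ)) (x := fun u => u.1)
      (fun l m => by fun_prop) (N := fun u => u.2) (by fun_prop)
  have h2 : Measurable fun u : (Fin K → ℕ → ℝ) × (Fin K → ℕ) => ((u.2 k : ℕ) : ℝ) :=
    measurable_from_nat.comp (by fun_prop)
  refine MeasurableSet.inter ?_ (MeasurableSet.inter (measurableSet_le measurable_const h2)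
    (measurableSet_lt (measurable_pi_iff.1 h1 k) measurable_const))
  have h3 : Measurable fun p : (Fin K → ℝ) × (Fin K → ℕ) => θ ∈ confSet μ α σ t p.2 p.1 :=
    measurable_from_prod_countable_left fun n =>
      measurableSet_setOfPred.1 (isOpen_mem_confSet θ t n).measurableSet
  exact measurableSet_setOfPred.2 (h3.comp (h1.prodMk measurable_snd))

/-- With at least `κr²` pulls the sample of `k` has standard deviation at most `Δ/r`. Its mean is
below `μ_k + bΔ`, so the level `μ* - aΔ` lies at least `(1-a-b)r` standard deviations higher. -/
lemma le_div_of_mem_typicalHistory (hβ : 0 < β) (hσ : 0 < σ) {κ r a b : ℝ}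
    (hgap : 0 < gap μ θ ks k)
    (hκ : κ = β * σ ^ 2 / gap μ θ ks k ^ 2) (hab : a + b ≤ 1) {t : ℕ}
    {u : (Fin K → ℕ → ℝ) × (Fin K → ℕ)}
    (hu : u ∈ typicalHistory μ θ α σ k (κ * r ^ 2) (μ k θ + b * gap μ θ ks k) t) :
    0 < √(β * σ ^ 2 / u.2 k) ∧ (1 - a - b) * r
      ≤ (μ ks θ - a * gap μ θ ks k - empMean u.1 u.2 k) / √(β * σ ^ 2 / u.2 k) := by
  have hσ' : (0 : ℝ) < σ := NNReal.coe_pos.2 hσ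
  obtain ⟨-, h1, h2⟩ := hu
  have hn : (0 : ℝ) < u.2 k := lt_of_lt_of_le one_pos ((le_max_right _ _).trans h1)
  have hs : 0 < √(β * σ ^ 2 / u.2 k) := by positivity
  refine ⟨hs, ?_⟩
  rw [le_div_iff₀ hs]
  have h3 : r * √(β * σ ^ 2 / u.2 k) ≤ gap μ θ ks k := by
    refine abs_le_of_sq_le_sq' ?_ hgap.le |>.2
    rw [mul_pow, Real.sq_sqrt (by positivity)]
    have h4 : κ * r ^ 2 ≤ u.2 k := (le_max_left _ _).trans h1
    rw [hκ, div_mul_eq_mul_div, div_le_iff₀ (by positivity)] at h4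
    rw [← mul_div_assoc, div_le_iff₀ hn]
    linarith
  have h5 : (1 - a - b) * gap μ θ ks k ≤ μ ks θ - a * gap μ θ ks k - empMean u.1 u.2 k := by
    have : gap μ θ ks k = μ ks θ - μ k θ := rfl
    linarith
  calc (1 - a - b) * r * √(β * σ ^ 2 / u.2 k) = (1 - a - b) * (r * √(β * σ ^ 2 / u.2 k)) := by ring
    _ ≤ (1 - a - b) * gap μ θ ks k := by gcongr; linarith
    _ ≤ _ := h5

variable [IsProbabilityMeasure P]

/-- The summands are, in order: bad events, small counts, overestimates of `k`, three layers paid by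
odds, and the top layer. A level far below `μ*` has small odds; nearer levels have larger odds,
compensated by the tail factor. -/
lemma lintegral_tscPulls_le (hks : IsBestAt μ ks θ) (hgap : 0 < gap μ θ ks k) (hβ : 0 < β)
    (hσ : 0 < σ) (hτ : IsTieBreaking τ) (hX : IsRewardTable P ν X)
    (hG : IsSamplingNoise P X G)
    (hsubG : ∀ l, HasSubgaussianMGF (fun r => r - μ l θ) (σ ^ 2) (ν l))
    {κ r b a₁ a₂ a₃ : ℝ} (hκ : κ = β * σ ^ 2 / gap μ θ ks k ^ 2) (hb : 0 ≤ b)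
    (h₁ : a₁ + b ≤ 1) (h₂ : a₂ + b ≤ 1) (h₃ : a₃ + b ≤ 1) (T : ℕ) :
    ∫⁻ ω, (tscPulls μ α β σ τ (fun l m => X l m ω) (fun s l => G s l ω) T k : ENNReal) ∂P
      ≤ ∑ t ∈ Finset.range T, P (badEvent μ θ α σ X t)
        + ENNReal.ofReal (κ * r ^ 2 + 1)
        + ∑ n ∈ Finset.range T, (if max (κ * r ^ 2) 1 ≤ (n : ℝ) then
            ENNReal.ofReal (Real.exp (-(n * (b * gap μ θ ks k) ^ 2 / (2 * σ ^ 2)))) else 0)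
        + totalOdds P β σ (X ks) (μ ks θ - a₁ * gap μ θ ks k) T
        + gaussTail ((1 - a₁ - b) * r) *
            totalOdds P β σ (X ks) (μ ks θ - a₂ * gap μ θ ks k) T
        + gaussTail ((1 - a₂ - b) * r) *
            totalOdds P β σ (X ks) (μ ks θ - a₃ * gap μ θ ks k) T
        + T * gaussTail ((1 - a₃ - b) * r) := by
  set Δ := gap μ θ ks k with hΔ
  set L := κ * r ^ 2 with hL
  have hσ' : (0 : ℝ) < σ := NNReal.coe_pos.2 hσ
  have hL0 : 0 ≤ L := by rw [hL, hκ]; positivity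
  have hne : ks ≠ k := by
    rintro rfl
    simp [gap] at hΔ
    linarith
  set y : ℝ → ℝ := fun a => μ ks θ - a * Δ with hy
  set H := typicalHistory μ θ α σ k L (μ k θ + b * Δ) with hH
  let U := tsHistory μ α β σ τ X G
  let S : ℕ → Ω → ℝ := fun t ω => tsValue β σ k (U t ω, fun l => G t l ω)
  let A := tsArm μ α β σ τ X G
  -- Overestimation of `k` at pull count `n`, indexed by counts rather than rounds so that each
  -- count is paid once.
  let V : ℕ → Set Ω := fun n => {ω | max L 1 ≤ (n : ℝ) ∧
    n * (b * Δ) ≤ sumDev (fun m => X k m ω) (μ k θ) n}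
  let E₁ : ℕ → Set Ω := fun t => {ω | U t ω ∈ H t ∧ A t ω = k ∧ (⊥ : EReal) < S t ω ∧
    S t ω ≤ y a₁}
  let E₂ : ℕ → Set Ω := fun t => {ω | U t ω ∈ H t ∧ A t ω = k ∧ (y a₁ : EReal) < S t ω ∧
    S t ω ≤ y a₂}
  let E₃ : ℕ → Set Ω := fun t => {ω | U t ω ∈ H t ∧ A t ω = k ∧ (y a₂ : EReal) < S t ω ∧
    S t ω ≤ y a₃}
  let E₄ : ℕ → Set Ω := fun t => {ω | U t ω ∈ H t ∧ y a₃ < S t ω}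
  have hmH : ∀ t, MeasurableSet (H t) := fun t => measurableSet_typicalHistory _ _ _
  have hHk : ∀ t, ∀ u ∈ H t, u.2 k ≠ 0 := fun t u hu h0 => by
    have := (le_max_right L 1).trans hu.2.1
    rw [h0] at this
    norm_num at this
  have hHs : ∀ t, ∀ u ∈ H t, ks ∈ competitiveSet μ α σ t u.2 (empMean u.1 u.2) := fun t u hu =>
    mem_competitiveSet_of_mem_confSet hu.1 hks
  have hq : ∀ a, a + b ≤ 1 → ∀ t, ∀ u ∈ H t, ∀ b', gaussianReal 0 1
      ({r | (y a : EReal) < ((empMean u.1 u.2 k + √(β * σ ^ 2 / u.2 k) * r : ℝ) : EReal)}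
        ∩ Set.Iic b') ≤ gaussTail ((1 - a - b) * r) * gaussCdf b' := by
    intro a ha t u hu b'
    obtain ⟨hs, hle⟩ := le_div_of_mem_typicalHistory hβ hσ hgap hκ ha hu
    simp only [EReal.coe_lt_coe_iff]
    rw [setOf_lt_add_mul hs]
    exact (gaussianReal_Ioc_le _ _).trans (by gcongr; exact gaussTail_antitone hle)
  -- The lowest layer has no lower cut-off, hence `q = 1`.
  have hE₁ : ∑ t ∈ Finset.range T, P (E₁ t) ≤ totalOdds P β σ (X ks) (y a₁) T := by
    refine (Finset.sum_le_sum fun t _ => measure_layer_le (q := 1) hβ hσ hτ hne hX hG t (hmH t) ⊥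
      (y a₁) (hHk t) (hHs t) fun u hu b' => ?_).trans
      ((sum_lintegral_sampleOdds_le hX hG 1 (y a₁) T).trans (one_mul _).le)
    rw [one_mul]
    exact measure_mono Set.inter_subset_right
  have hE₂ : ∑ t ∈ Finset.range T, P (E₂ t) ≤ gaussTail ((1 - a₁ - b) * r) *
      totalOdds P β σ (X ks) (y a₂) T :=
    (Finset.sum_le_sum fun t _ => measure_layer_le hβ hσ hτ hne hX hG t (hmH t) _
      (y a₂) (hHk t) (hHs t) (hq a₁ h₁ t)).trans (sum_lintegral_sampleOdds_le hX hG _ _ T)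
  have hE₃ : ∑ t ∈ Finset.range T, P (E₃ t) ≤ gaussTail ((1 - a₂ - b) * r) *
      totalOdds P β σ (X ks) (y a₃) T :=
    (Finset.sum_le_sum fun t _ => measure_layer_le hβ hσ hτ hne hX hG t (hmH t) _
      (y a₃) (hHk t) (hHs t) (hq a₂ h₂ t)).trans (sum_lintegral_sampleOdds_le hX hG _ _ T)
  have hE₄ : ∑ t ∈ Finset.range T, P (E₄ t) ≤ T * gaussTail ((1 - a₃ - b) * r) := by
    refine (Finset.sum_le_sum (g := fun _ => gaussTail ((1 - a₃ - b) * r)) fun t _ =>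
      measure_top_layer_le hX hG t (hmH t) (y a₃) fun u hu => ?_).trans (by simp)
    obtain ⟨hs, hle⟩ := le_div_of_mem_typicalHistory hβ hσ hgap hκ h₃ hu
    rw [setOf_lt_add_mul hs]
    exact gaussTail_antitone hle
  have hmU := fun t => measurable_tsHistory (μ := μ) (α := α) (β := β) (σ := σ) (τ := τ) hX hG t
  have hmS : ∀ t, Measurable (S t) := fun t => (measurable_tsValue k).comp
    ((hmU t).prodMk (measurable_pi_lambda _ fun l => hG.measurable t l))
  have hmA : ∀ t, Measurable (A t) := fun t => measurable_tsArm hX hG t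
  have hmE : ∀ (ylo : EReal) (z : ℝ) t, MeasurableSet {ω | U t ω ∈ H t ∧ A t ω = k ∧
      ylo < S t ω ∧ S t ω ≤ z} := fun ylo z t =>
    (hmU t (hmH t)).inter ((hmA t (measurableSet_singleton k)).inter
      ((measurableSet_lt measurable_const (measurable_coe_real_ereal.comp (hmS t))).inter
        (measurableSet_le (hmS t) measurable_const)))
  have hmE₄ : ∀ t, MeasurableSet (E₄ t) := fun t =>
    (hmU t (hmH t)).inter (measurableSet_lt measurable_const (hmS t))
  have hmV : ∀ n, MeasurableSet (V n) := fun n =>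
    (MeasurableSet.const _).inter (measurableSet_le measurable_const (measurable_sumDev hX k _ n))
  have hV : ∀ n ∈ Finset.range T, P (V n) ≤ if max L 1 ≤ (n : ℝ) then
      ENNReal.ofReal (Real.exp (-(n * (b * Δ) ^ 2 / (2 * σ ^ 2)))) else 0 := by
    intro n _
    split_ifs with hn
    · have hn0 : n ≠ 0 := by
        rintro rfl
        have := (le_max_right L 1).trans hn
        norm_num at this
      refine le_trans (measure_mono fun ω hω => hω.2)
        (measure_sumDev_ge_le hX hsubG k hn0 (by positivity))
    · have : V n = ∅ := by
        ext ω
        simp only [V, Set.mem_ofPred_eq, Set.mem_empty_iff_false, iff_false]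
        exact fun h => hn h.1
      rw [this, measure_empty]
  have hpt : ∀ ω, (tscPulls μ α β σ τ (fun l m => X l m ω) (fun s l => G s l ω) T k : ENNReal)
      ≤ (∑ t ∈ Finset.range T, ((badEvent μ θ α σ X t).indicator 1 ω + (E₁ t).indicator 1 ω
          + (E₂ t).indicator 1 ω + (E₃ t).indicator 1 ω + (E₄ t).indicator 1 ω))
        + (∑ n ∈ Finset.range T, (V n).indicator 1 ω) + ENNReal.ofReal (L + 1) := by
    intro ω
    set x : Fin K → ℕ → ℝ := fun l m => X l m ω with hx
    set N := pulls μ α σ τ (tsSample β σ fun s l => G s l ω) x with hN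
    have hNT : N T k ≤ T := pulls_le T k
    have b1 := sum_ite_lt_le hL0 (N T k)
    have b2 : ∑ n ∈ Finset.range (N T k), (V n).indicator (1 : Ω → ENNReal) ω
        ≤ ∑ n ∈ Finset.range T, (V n).indicator 1 ω :=
      Finset.sum_le_sum_of_subset (Finset.range_subset_range.2 hNT)
    -- The count-indexed sums become sums over rounds pulling `k`, which allows a comparison round
    -- by round.
    rw [hN, ← sum_ite_armAt] at b1 b2
    refine le_trans ?_ (add_le_add (add_le_add le_rfl b2) b1)
    rw [← Finset.sum_add_distrib, ← Finset.sum_add_distrib, tscPulls, pulls_eq_sum]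
    push_cast
    refine Finset.sum_le_sum fun t ht => ?_
    by_cases hk : armAt μ α σ τ (tsSample β σ fun s l => G s l ω) x t = k
    swap
    · simp [hk]
    rw [if_pos hk, if_pos hk, if_pos hk]
    by_cases c1 : ω ∈ badEvent μ θ α σ X t
    · rw [Set.indicator_of_mem c1]
      simp only [Pi.one_apply, add_assoc]
      exact le_self_add
    by_cases c2 : (N t k : ℝ) < max L 1
    · rw [if_pos c2]
      exact le_add_self
    rw [not_lt] at c2
    have hn0 : N t k ≠ 0 := fun h0 => by
      have := (le_max_right L 1).trans c2
      rw [h0] at this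
      norm_num at this
    by_cases c3 : ω ∈ V (N t k)
    · rw [Set.indicator_of_mem c3]
      refine le_trans ?_ le_self_add
      exact le_add_self
    have hUH : U t ω ∈ H t := by
      refine ⟨mem_confSet_of_notMem_badEvent (n := N t) (fun l => pulls_le t l) c1, c2, ?_⟩
      have h3 : ¬ (N t k * (b * Δ) ≤ sumDev (fun m => X k m ω) (μ k θ) (N t k)) :=
        fun h => c3 ⟨c2, h⟩
      have h4 := empMean_sub (x := x) (n := N t) (l := k) hn0 (μ k θ)
      have hn' : (0 : ℝ) < N t k := by exact_mod_cast Nat.pos_of_ne_zero hn0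
      have h5 : sumDev (fun m => X k m ω) (μ k θ) (N t k) / N t k < b * Δ := by
        rw [div_lt_iff₀ hn']; linarith
      have h6 : empMean x (N t) k - μ k θ < b * Δ := h4.trans_lt h5
      change empMean x (N t) k < _
      linarith
    refine le_trans ?_ le_self_add
    refine le_trans ?_ le_self_add
    rcases le_or_gt (S t ω) (y a₁) with s1 | s1
    · have : ω ∈ E₁ t := ⟨hUH, hk, EReal.bot_lt_coe _, s1⟩
      rw [Set.indicator_of_mem this]
      simp only [Pi.one_apply, add_assoc, add_left_comm _ (1 : ENNReal)]
      exact le_self_add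
    rcases le_or_gt (S t ω) (y a₂) with s2 | s2
    · have : ω ∈ E₂ t := ⟨hUH, hk, EReal.coe_lt_coe_iff.2 s1, s2⟩
      rw [Set.indicator_of_mem this]
      simp only [Pi.one_apply, add_assoc, add_left_comm _ (1 : ENNReal)]
      exact le_self_add
    rcases le_or_gt (S t ω) (y a₃) with s3 | s3
    · have : ω ∈ E₃ t := ⟨hUH, hk, EReal.coe_lt_coe_iff.2 s2, s3⟩
      rw [Set.indicator_of_mem this]
      simp only [Pi.one_apply, add_assoc, add_left_comm _ (1 : ENNReal)]
      exact le_self_add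
    · have : ω ∈ E₄ t := ⟨hUH, s3⟩
      rw [Set.indicator_of_mem this]
      exact le_add_self
  have hi : ∀ {B : Set Ω}, MeasurableSet B → Measurable (B.indicator (1 : Ω → ENNReal)) :=
    fun h => measurable_one.indicator h
  have hmb := fun t => measurableSet_badEvent (μ := μ) (θ := θ) (α := α) (σ := σ) hX t
  have hmE₁ : ∀ t, MeasurableSet (E₁ t) := hmE _ _
  have hmE₂ : ∀ t, MeasurableSet (E₂ t) := hmE _ _
  have hmE₃ : ∀ t, MeasurableSet (E₃ t) := hmE _ _
  have hms : ∀ t, Measurable fun ω => ((badEvent μ θ α σ X t).indicator (1 : Ω → ENNReal) ω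
      + (E₁ t).indicator 1 ω + (E₂ t).indicator 1 ω + (E₃ t).indicator 1 ω
      + (E₄ t).indicator 1 ω) := fun t =>
    ((((hi (hmb t)).add (hi (hmE₁ t))).add (hi (hmE₂ t))).add (hi (hmE₃ t))).add (hi (hmE₄ t))
  have hint : ∫⁻ ω, ((∑ t ∈ Finset.range T, ((badEvent μ θ α σ X t).indicator 1 ω
          + (E₁ t).indicator 1 ω
          + (E₂ t).indicator 1 ω + (E₃ t).indicator 1 ω + (E₄ t).indicator 1 ω))
        + (∑ n ∈ Finset.range T, (V n).indicator 1 ω) + ENNReal.ofReal (L + 1)) ∂P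
      = (∑ t ∈ Finset.range T, (P (badEvent μ θ α σ X t) + P (E₁ t) + P (E₂ t) + P (E₃ t)
          + P (E₄ t))) + (∑ n ∈ Finset.range T, P (V n)) + ENNReal.ofReal (L + 1) := by
    rw [lintegral_add_right _ measurable_const, lintegral_add_right _
      (Finset.measurable_sum _ fun n _ => hi (hmV n)),
      lintegral_finsetSum _ fun n _ => hi (hmV n), lintegral_finsetSum _ fun t _ => hms t]
    congr 1
    · congr 1
      · refine Finset.sum_congr rfl fun t _ => ?_
        rw [lintegral_add_right _ (hi (hmE₄ t)), lintegral_add_right _ (hi (hmE₃ t)),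
          lintegral_add_right _ (hi (hmE₂ t)), lintegral_add_right _ (hi (hmE₁ t)),
          lintegral_indicator_one (hmb t), lintegral_indicator_one (hmE₁ t),
          lintegral_indicator_one (hmE₂ t), lintegral_indicator_one (hmE₃ t),
          lintegral_indicator_one (hmE₄ t)]
      · exact Finset.sum_congr rfl fun n _ => lintegral_indicator_one (hmV n)
    · simp
  refine (lintegral_mono hpt).trans (hint.le.trans ?_)
  simp only [Finset.sum_add_distrib]
  calc _ ≤ (∑ t ∈ Finset.range T, P (badEvent μ θ α σ X t)
        + totalOdds P β σ (X ks) (y a₁) T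
        + gaussTail ((1 - a₁ - b) * r) * totalOdds P β σ (X ks) (y a₂) T
        + gaussTail ((1 - a₂ - b) * r) * totalOdds P β σ (X ks) (y a₃) T
        + T * gaussTail ((1 - a₃ - b) * r))
        + (∑ n ∈ Finset.range T, (if max L 1 ≤ (n : ℝ) then
            ENNReal.ofReal (Real.exp (-(n * (b * Δ) ^ 2 / (2 * σ ^ 2)))) else 0))
        + ENNReal.ofReal (L + 1) := by
        gcongr with n hn
        exact hV n hn
    _ = _ := by ring

end ThompsonDecomposition

/-! ### Integral comparison for the series over pull counts. -/

section Series

/-- Integral test: `g` dominates the tail integral of `f`, so the terms after the first sum to at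
most `g 1`. -/
lemma sum_le_of_hasDerivAt_le {f g g' : ℝ → ℝ} (hf : AntitoneOn f (Set.Ici 1))
    (hg : ∀ x, 1 ≤ x → HasDerivAt g (g' x) x) (hg' : ∀ x, 1 ≤ x → g' x ≤ -f x)
    (hg0 : ∀ x, 1 ≤ x → 0 ≤ g x) (hf1 : 0 ≤ f 1) (n : ℕ) :
    ∑ i ∈ Finset.range n, f (i + 1) ≤ f 1 + g 1 := by
  have key : ∀ n : ℕ, ∑ i ∈ Finset.range (n + 1), f (i + 1) ≤ f 1 + g 1 - g (n + 1) := by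
    intro n
    induction n with
    | zero => simp
    | succ n ih =>
      rw [Finset.sum_range_succ]
      have hn : (1 : ℝ) ≤ n + 1 := by linarith [n.cast_nonneg (α := ℝ)]
      obtain ⟨c, hc, hce⟩ := exists_hasDerivAt_eq_slope g g'
        (show (n : ℝ) + 1 < n + 1 + 1 by linarith)
        (fun x hx => (hg x (hn.trans hx.1)).continuousAt.continuousWithinAt)
        (fun x hx => hg x (hn.trans hx.1.le))
      have h1 := hg' c (hn.trans hc.1.le)
      have h2 : f (n + 1 + 1) ≤ f c :=
        hf (Set.mem_Ici.2 (hn.trans hc.1.le)) (Set.mem_Ici.2 (by linarith)) hc.2.le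
      rw [hce] at h1
      have h3 : (g (n + 1 + 1) - g (n + 1)) / (n + 1 + 1 - (n + 1)) = g (n + 1 + 1) - g (n + 1) := by
        rw [show (n : ℝ) + 1 + 1 - (n + 1) = 1 by ring, div_one]
      rw [h3] at h1
      push_cast
      linarith
  rcases n with _ | n
  · simpa using add_nonneg hf1 (hg0 1 le_rfl)
  · have := key n
    have := hg0 (n + 1) (by linarith [n.cast_nonneg (α := ℝ)])
    linarith

lemma hasDerivAt_exp_neg_sqrt {δ x : ℝ} (hx : 0 < x) :
    HasDerivAt (fun x => Real.exp (-(δ * √x))) (-(δ / (2 * √x)) * Real.exp (-(δ * √x))) x := by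
  have h := (((Real.hasDerivAt_sqrt hx.ne').const_mul δ).neg).exp
  refine HasDerivAt.congr_deriv (f' := Real.exp (-(δ * √x)) * -(δ * (1 / (2 * √x)))) h ?_
  ring

lemma sum_exp_neg_sqrt_div_sqrt_le {δ : ℝ} (hδ : 0 < δ) (n : ℕ) :
    ∑ i ∈ Finset.range n, Real.exp (-(δ * √((i : ℝ) + 1))) / √((i : ℝ) + 1)
      ≤ Real.exp (-δ) * (1 + 2 / δ) := by
  have h := sum_le_of_hasDerivAt_le (f := fun x => Real.exp (-(δ * √x)) / √x)
    (g := fun x => 2 / δ * Real.exp (-(δ * √x)))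
    (g' := fun x => 2 / δ * (-(δ / (2 * √x)) * Real.exp (-(δ * √x)))) ?_ ?_ ?_ ?_ ?_ n
  · refine h.trans (le_of_eq ?_)
    simp
    ring
  · intro x hx y hy hxy
    have hx' : (0 : ℝ) < x := lt_of_lt_of_le one_pos hx
    have h1 : 0 < √x := Real.sqrt_pos.2 hx'
    dsimp only
    gcongr
  · intro x hx
    exact (hasDerivAt_exp_neg_sqrt (by linarith)).const_mul _
  · intro x hx
    have h1 : 0 < √x := Real.sqrt_pos.2 (by linarith)
    refine le_of_eq ?_
    field_simp
  · intro x hx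
    positivity
  · positivity

lemma one_div_add_one_le_log {u : ℝ} (hu : 0 < u) : 1 / (u + 1) ≤ Real.log (1 + 1 / u) := by
  have h := Real.one_sub_inv_le_log_of_pos (show 0 < 1 + 1 / u by positivity)
  refine le_trans (le_of_eq ?_) h
  field_simp
  ring

/-- With `u = δ√x` the tail integral is twice the exponential integral `E₁(u)`, and `g` encodes the
bound `E₁(u) ≤ exp(-u) log(1 + 1/u)`. -/
lemma sum_exp_neg_sqrt_div_le {δ : ℝ} (hδ : 0 < δ) (n : ℕ) :
    ∑ i ∈ Finset.range n, Real.exp (-(δ * √((i : ℝ) + 1))) / ((i : ℝ) + 1)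
      ≤ Real.exp (-δ) * (1 + 2 * Real.log (1 + 1 / δ)) := by
  have h := sum_le_of_hasDerivAt_le (f := fun x => Real.exp (-(δ * √x)) / x)
    (g := fun x => 2 * (Real.exp (-(δ * √x)) * Real.log (1 + 1 / (δ * √x))))
    (g' := fun x => 2 * (-(δ / (2 * √x)) * Real.exp (-(δ * √x)) * Real.log (1 + 1 / (δ * √x))
      + Real.exp (-(δ * √x)) * (-(δ / (2 * √x)) / (δ * √x) ^ 2 / (1 + 1 / (δ * √x)))))
    ?_ ?_ ?_ ?_ ?_ n
  · refine h.trans (le_of_eq ?_)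
    simp
    ring
  · intro x hx y hy hxy
    have hx' : (0 : ℝ) < x := lt_of_lt_of_le one_pos hx
    dsimp only
    gcongr
  · intro x hx
    have hx0 : 0 < x := by linarith
    have h1 : 0 < √x := Real.sqrt_pos.2 hx0
    have hl : HasDerivAt (fun x => Real.log (1 + 1 / (δ * √x)))
        (-(δ / (2 * √x)) / (δ * √x) ^ 2 / (1 + 1 / (δ * √x))) x := by
      have h2 := ((((Real.hasDerivAt_sqrt hx0.ne').const_mul δ).inv (by positivity)).const_add 1).log
        (by simp only [Pi.inv_apply]; positivity)
      convert h2 using 1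
      · simp only [one_div]; rfl
      · simp only [Pi.inv_apply, one_div]
        ring
    exact ((hasDerivAt_exp_neg_sqrt hx0).mul hl).const_mul 2
  · intro x hx
    have hx0 : 0 < x := by linarith
    have h1 : 0 < √x := Real.sqrt_pos.2 hx0
    have h2 := one_div_add_one_le_log (u := δ * √x) (by positivity)
    have h3 : √x * √x = x := Real.mul_self_sqrt hx0.le
    have h4 : δ / √x * (1 / (δ * √x + 1)) ≤ δ / √x * Real.log (1 + 1 / (δ * √x)) := by gcongr
    -- Equality holds with `1/(u+1)` in place of the logarithm, `u = δ√x`; then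
    -- `one_div_add_one_le_log` applies.
    have h5 : 1 / x ≤ δ / √x * Real.log (1 + 1 / (δ * √x)) + 1 / (x * (δ * √x + 1)) := by
      refine le_trans (le_of_eq ?_) (add_le_add_left h4 _)
      have : x = √x ^ 2 := (Real.sq_sqrt hx0.le).symm
      clear h4 h2
      generalize √x = s at *
      subst this
      field_simp
    have h6 := mul_le_mul_of_nonneg_left h5 (Real.exp_nonneg (-(δ * √x)))
    have h7 : 2 * (-(δ / (2 * √x)) * Real.exp (-(δ * √x)) * Real.log (1 + 1 / (δ * √x))
      + Real.exp (-(δ * √x)) * (-(δ / (2 * √x)) / (δ * √x) ^ 2 / (1 + 1 / (δ * √x))))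
      = -(Real.exp (-(δ * √x)) *
        (δ / √x * Real.log (1 + 1 / (δ * √x)) + 1 / (x * (δ * √x + 1)))) := by
      generalize Real.log (1 + 1 / (δ * √x)) = l
      generalize Real.exp (-(δ * √x)) = e
      have : x = √x ^ 2 := (Real.sq_sqrt hx0.le).symm
      generalize √x = s at *
      subst this
      field_simp
      ring
    rw [h7, neg_le_neg_iff]
    refine le_trans (le_of_eq ?_) h6
    ring
  · intro x hx
    have hx0 : 0 < x := by linarith
    have h1 : 0 < √x := Real.sqrt_pos.2 hx0
    have h2 := one_div_add_one_le_log (u := δ * √x) (by positivity)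
    have : 0 < 1 / (δ * √x + 1) := by positivity
    have : 0 ≤ Real.log (1 + 1 / (δ * √x)) := by linarith
    positivity
  · positivity

end Series

/-! ### Expected total odds through a mixture of exponentials. -/

section TotalOdds

/-- A mixture of exponentials that dominates the odds function of the standard normal law. -/
noncomputable def oddsMajorant (z : ℝ) : ENNReal :=
  ∫⁻ s in Set.Ioi (1 : ℝ), ENNReal.ofReal ((s + 5 / 4) * Real.exp (s * z - s ^ 2 / 2))

lemma lintegral_Ioi_mul_exp_neg {d : ℝ} (hd : 0 < d) :
    ∫⁻ s in Set.Ioi (1 : ℝ), ENNReal.ofReal ((s + 5 / 4) * Real.exp (-(d * s)))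
      = ENNReal.ofReal (Real.exp (-d) * (1 / d ^ 2 + 9 / 4 / d)) := by
  set g : ℝ → ℝ := fun s => -(((s + 5 / 4) / d + 1 / d ^ 2) * Real.exp (-(d * s))) with hg
  have hder : ∀ s ∈ Set.Ici (1 : ℝ), HasDerivAt g ((s + 5 / 4) * Real.exp (-(d * s))) s := by
    intro s _
    have h1 : HasDerivAt (fun s : ℝ => (s + 5 / 4) / d + 1 / d ^ 2) (1 / d) s :=
      (((hasDerivAt_id s).add_const _).div_const d).add_const _
    have h2 : HasDerivAt (fun s : ℝ => Real.exp (-(d * s))) (Real.exp (-(d * s)) * -(d * 1)) s :=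
      (((hasDerivAt_id s).const_mul d).neg).exp
    refine (h1.mul h2).neg.congr_deriv ?_
    field_simp
    ring
  have hpos : ∀ s ∈ Set.Ioi (1 : ℝ), 0 ≤ (s + 5 / 4) * Real.exp (-(d * s)) := by
    intro s hs
    have : (1 : ℝ) < s := hs
    positivity
  have hlim : Tendsto g atTop (nhds 0) := by
    have h1 := tendsto_rpow_mul_exp_neg_mul_atTop_nhds_zero 1 d hd
    have h0 := tendsto_rpow_mul_exp_neg_mul_atTop_nhds_zero 0 d hd
    have h2 := ((h1.const_mul (1 / d)).add (h0.const_mul (5 / 4 / d + 1 / d ^ 2))).neg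
    simp only [mul_zero, add_zero, neg_zero] at h2
    refine h2.congr fun s => ?_
    simp only [hg, Real.rpow_one, Real.rpow_zero, neg_mul]
    ring
  rw [← ofReal_integral_eq_lintegral_ofReal
    (integrableOn_Ioi_deriv_of_nonneg' hder hpos hlim)
    ((ae_restrict_iff' measurableSet_Ioi).2 (Eventually.of_forall hpos)),
    integral_Ioi_of_hasDerivAt_of_nonneg' hder hpos hlim]
  congr 1
  simp only [hg, mul_one]
  ring

/-- By Tonelli the weight `exp(-s²/2)` cancels the bound `exp(s²/2)` on the moment generating
function, leaving a Laplace integral in `d`. -/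
lemma lintegral_oddsMajorant_le {Ω : Type*} [MeasurableSpace Ω] {P : Measure Ω} [SFinite P]
    {W : Ω → ℝ} (hW : Measurable W)
    (h : ∀ s : ℝ, ∫⁻ ω, ENNReal.ofReal (Real.exp (s * W ω)) ∂P
      ≤ ENNReal.ofReal (Real.exp (s ^ 2 / 2))) {d : ℝ} (hd : 0 < d) :
    ∫⁻ ω, oddsMajorant (W ω - d) ∂P
      ≤ ENNReal.ofReal (Real.exp (-d) * (1 / d ^ 2 + 9 / 4 / d)) := by
  unfold oddsMajorant
  rw [lintegral_lintegral_swap]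
  · rw [← lintegral_Ioi_mul_exp_neg hd]
    refine setLIntegral_mono (by fun_prop) fun s hs => ?_
    have hs1 : (1 : ℝ) < s := hs
    have e : ∀ ω, ENNReal.ofReal ((s + 5 / 4) * Real.exp (s * (W ω - d) - s ^ 2 / 2))
        = ENNReal.ofReal ((s + 5 / 4) * Real.exp (-(d * s) - s ^ 2 / 2))
          * ENNReal.ofReal (Real.exp (s * W ω)) := fun ω => by
      rw [← ENNReal.ofReal_mul (by positivity), mul_assoc, ← Real.exp_add]
      congr 3
      ring
    simp only [e]
    rw [lintegral_const_mul _ (by fun_prop)]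
    refine (mul_le_mul_right (h s) _).trans (le_of_eq ?_)
    rw [← ENNReal.ofReal_mul (by positivity), mul_assoc, ← Real.exp_add]
    congr 3
    ring
  · refine Measurable.aemeasurable ?_
    unfold Function.uncurry
    fun_prop

variable {K : ℕ} {Θ : Type*} {μ : Fin K → Θ → ℝ} {θ : Θ} {ks : Fin K} {β : ℝ} {σ : ℝ≥0}
  {ν : Fin K → Measure ℝ} {Ω : Type*} [MeasurableSpace Ω] {P : Measure Ω}
  [IsProbabilityMeasure P] {X : Fin K → ℕ → Ω → ℝ}

lemma lintegral_exp_mul_sumDev_le (hX : IsRewardTable P ν X)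
    (hsubG : ∀ l, HasSubgaussianMGF (fun r => r - μ l θ) (σ ^ 2) (ν l)) (l : Fin K) (n : ℕ)
    (s : ℝ) :
    ∫⁻ ω, ENNReal.ofReal (Real.exp (s * sumDev (fun m => X l m ω) (μ l θ) n)) ∂P
      ≤ ENNReal.ofReal (Real.exp (n * σ ^ 2 * s ^ 2 / 2)) := by
  have h := hasSubgaussianMGF_sumDev (P := P) hX hsubG l n
  rw [← ofReal_integral_eq_lintegral_ofReal (h.integrable_exp_mul s)
    (Eventually.of_forall fun ω => Real.exp_nonneg _)]
  refine ENNReal.ofReal_le_ofReal ((h.mgf_le s).trans (le_of_eq ?_))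
  push_cast
  rfl

/-- The standardized level is `W - d` with `d = (a/√κ)√(i+1)`. Here `W` is centred and sub-Gaussian
with proxy `1/β`, at most `1`; this is where `β ≥ 1` enters. -/
lemma lintegral_sampleOdds_le (hmaj : ∀ z, gaussOdds z ≤ oddsMajorant z) (hβ : 1 ≤ β)
    (hσ : 0 < σ) (hX : IsRewardTable P ν X)
    (hsubG : ∀ l, HasSubgaussianMGF (fun r => r - μ l θ) (σ ^ 2) (ν l)) {Δ : ℝ} (hΔ : 0 < Δ)
    {κ a : ℝ} (hκ : κ = β * σ ^ 2 / Δ ^ 2) (ha : 0 < a) (i : ℕ) :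
    ∫⁻ ω, sampleOdds β σ (μ ks θ - a * Δ)
        ((∑ m ∈ Finset.range (i + 1), X ks m ω) / (i + 1 : ℕ)) (i + 1) ∂P
      ≤ ENNReal.ofReal (Real.exp (-(a / √κ * √((i : ℝ) + 1)))
        * (1 / (a / √κ * √((i : ℝ) + 1)) ^ 2 + 9 / 4 / (a / √κ * √((i : ℝ) + 1)))) := by
  have hσ' : (0 : ℝ) < σ := NNReal.coe_pos.2 hσ
  have hβ0 : 0 < β := by linarith
  have hi : (0 : ℝ) < (i : ℝ) + 1 := by positivity
  have hκ0 : 0 < κ := by rw [hκ]; positivity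
  have hd : 0 < a / √κ * √((i : ℝ) + 1) := by positivity
  set S : ℝ := √(β * σ ^ 2 / ((i + 1 : ℕ) : ℝ)) with hS
  have hS0 : 0 < S := by rw [hS]; positivity
  have hSd : a * Δ / S = a / √κ * √((i : ℝ) + 1) := by
    have : S = Δ * (√κ / √((i : ℝ) + 1)) := by
      rw [hS, hκ, ← Real.sqrt_div (by positivity)]
      rw [show β * (σ : ℝ) ^ 2 / ((i + 1 : ℕ) : ℝ) = Δ ^ 2 * (β * σ ^ 2 / Δ ^ 2 / ((i : ℝ) + 1)) by
        push_cast; field_simp, Real.sqrt_mul (by positivity), Real.sqrt_sq hΔ.le]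
    rw [this]
    field_simp
  set c : ℝ := -(1 / (((i : ℝ) + 1) * S)) with hc
  have hcW : ∀ ω, (μ ks θ - a * Δ - (∑ m ∈ Finset.range (i + 1), X ks m ω) / (i + 1 : ℕ)) / S
      = c * sumDev (fun m => X ks m ω) (μ ks θ) (i + 1) - a / √κ * √((i : ℝ) + 1) := by
    intro ω
    rw [← hSd, hc]
    simp only [sumDev, Finset.sum_sub_distrib, Finset.sum_const, Finset.card_range, nsmul_eq_mul]
    push_cast
    field_simp
    ring
  have hpt : ∀ ω, sampleOdds β σ (μ ks θ - a * Δ)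
        ((∑ m ∈ Finset.range (i + 1), X ks m ω) / (i + 1 : ℕ)) (i + 1)
      ≤ oddsMajorant (c * sumDev (fun m => X ks m ω) (μ ks θ) (i + 1)
        - a / √κ * √((i : ℝ) + 1)) := by
    intro ω
    rw [sampleOdds, if_neg (Nat.succ_ne_zero i), ← hS, hcW]
    exact hmaj _
  refine (lintegral_mono hpt).trans (lintegral_oddsMajorant_le
    ((measurable_sumDev hX ks _ _).const_mul c) (fun s => ?_) hd)
  have h1 := lintegral_exp_mul_sumDev_le (P := P) hX hsubG ks (i + 1) (s * c)
  simp only [← mul_assoc]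
  refine h1.trans (ENNReal.ofReal_le_ofReal (Real.exp_le_exp.2 ?_))
  have h2 : ((i + 1 : ℕ) : ℝ) * σ ^ 2 * (s * c) ^ 2 = s ^ 2 / β := by
    have : S ^ 2 = β * σ ^ 2 / ((i + 1 : ℕ) : ℝ) := Real.sq_sqrt (by positivity)
    rw [hc, mul_pow, neg_sq, div_pow, mul_pow, this]
    push_cast
    field_simp
  rw [h2]
  have : s ^ 2 / β ≤ s ^ 2 := div_le_self (sq_nonneg s) hβ
  linarith

/-- The bound of the total odds, as a function of the normalized level. -/
noncomputable def oddsBound (δ : ℝ) : ℝ :=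
  Real.exp (-δ) * (1 + 2 * Real.log (1 + 1 / δ) + 9 / 4 * (2 + δ))

lemma totalOdds_le (hmaj : ∀ z, gaussOdds z ≤ oddsMajorant z) (hβ : 1 ≤ β)
    (hσ : 0 < σ) (hX : IsRewardTable P ν X)
    (hsubG : ∀ l, HasSubgaussianMGF (fun r => r - μ l θ) (σ ^ 2) (ν l)) {Δ : ℝ} (hΔ : 0 < Δ)
    {κ a : ℝ} (hκ : κ = β * σ ^ 2 / Δ ^ 2) (ha : 0 < a) (T : ℕ) :
    totalOdds P β σ (X ks) (μ ks θ - a * Δ) T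
      ≤ ENNReal.ofReal (κ / a ^ 2 * oddsBound (a / √κ)) := by
  have hσ' : (0 : ℝ) < σ := NNReal.coe_pos.2 hσ
  have hκ0 : 0 < κ := by rw [hκ]; positivity
  set δ := a / √κ with hδ
  have hδ0 : 0 < δ := by positivity
  have hκδ : κ / a ^ 2 = 1 / δ ^ 2 := by
    rw [hδ, div_pow, Real.sq_sqrt hκ0.le]; field_simp
  calc totalOdds P β σ (X ks) (μ ks θ - a * Δ) T
      ≤ ∑ j ∈ Finset.range (T + 1), ∫⁻ ω, sampleOdds β σ (μ ks θ - a * Δ)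
          ((∑ m ∈ Finset.range j, X ks m ω) / j) j ∂P :=
        -- The extra term permits the shift `j = i + 1`; the term `j = 0` vanishes by the definition
        -- of `sampleOdds`.
        Finset.sum_le_sum_of_subset (Finset.range_subset_range.2 (Nat.le_succ T))
    _ = ∑ i ∈ Finset.range T, ∫⁻ ω, sampleOdds β σ (μ ks θ - a * Δ)
          ((∑ m ∈ Finset.range (i + 1), X ks m ω) / (i + 1 : ℕ)) (i + 1) ∂P := by
        rw [Finset.sum_range_succ']
        simp [sampleOdds]
    _ ≤ ∑ i ∈ Finset.range T, ENNReal.ofReal (Real.exp (-(δ * √((i : ℝ) + 1)))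
        * (1 / (δ * √((i : ℝ) + 1)) ^ 2 + 9 / 4 / (δ * √((i : ℝ) + 1)))) :=
        Finset.sum_le_sum fun i _ => lintegral_sampleOdds_le hmaj hβ hσ hX hsubG hΔ hκ ha i
    _ = ENNReal.ofReal (∑ i ∈ Finset.range T, (Real.exp (-(δ * √((i : ℝ) + 1)))
        * (1 / (δ * √((i : ℝ) + 1)) ^ 2 + 9 / 4 / (δ * √((i : ℝ) + 1))))) :=
        (ENNReal.ofReal_sum_of_nonneg fun i _ => by positivity).symm
    _ ≤ _ := by
        refine ENNReal.ofReal_le_ofReal ?_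
        have e : ∀ i : ℕ, Real.exp (-(δ * √((i : ℝ) + 1)))
            * (1 / (δ * √((i : ℝ) + 1)) ^ 2 + 9 / 4 / (δ * √((i : ℝ) + 1)))
            = 1 / δ ^ 2 * (Real.exp (-(δ * √((i : ℝ) + 1))) / ((i : ℝ) + 1))
              + 9 / 4 / δ * (Real.exp (-(δ * √((i : ℝ) + 1))) / √((i : ℝ) + 1)) := fun i => by
          rw [mul_pow, Real.sq_sqrt (by positivity)]
          field_simp
        simp only [e, Finset.sum_add_distrib, ← Finset.mul_sum]
        have h1 := sum_exp_neg_sqrt_div_le hδ0 T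
        have h2 := sum_exp_neg_sqrt_div_sqrt_le hδ0 T
        rw [hκδ]
        calc _ ≤ 1 / δ ^ 2 * (Real.exp (-δ) * (1 + 2 * Real.log (1 + 1 / δ)))
              + 9 / 4 / δ * (Real.exp (-δ) * (1 + 2 / δ)) := by gcongr
          _ = _ := by unfold oddsBound; field_simp; ring

end TotalOdds

/-! ### Gaussian tails and the Mills ratio. -/

section Gaussian

/-- The Gaussian weight `e^{-t²/2}`. -/
noncomputable def gw (t : ℝ) : ℝ := Real.exp (-(t ^ 2 / 2))

/-- The integral of the Gaussian weight over `(z, ∞)`. -/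
noncomputable def gtail (z : ℝ) : ℝ := ∫ t in Set.Ioi z, gw t

/-- The integral of the Gaussian weight over `(-∞, z]`. -/
noncomputable def ghead (z : ℝ) : ℝ := ∫ t in Set.Iic z, gw t

lemma gw_pos (t : ℝ) : 0 < gw t := Real.exp_pos _

lemma gw_neg (t : ℝ) : gw (-t) = gw t := by simp [gw]

lemma continuous_gw : Continuous gw := by unfold gw; fun_prop

lemma gw_eq (t : ℝ) : gw t = Real.exp (-(1 / 2) * t ^ 2) := by unfold gw; congr 1; ring

lemma integrable_gw : Integrable gw := by
  have : gw = fun t => Real.exp (-(1 / 2) * t ^ 2) := funext gw_eq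
  rw [this]
  exact integrable_exp_neg_mul_sq (by norm_num)

lemma integral_gw : ∫ t, gw t = √(2 * Real.pi) := by
  have : gw = fun t => Real.exp (-(1 / 2) * t ^ 2) := funext gw_eq
  rw [this, integral_gaussian]
  congr 1
  field_simp

lemma ghead_add_gtail (z : ℝ) : ghead z + gtail z = √(2 * Real.pi) := by
  rw [← integral_gw]
  exact intervalIntegral.integral_Iic_add_Ioi integrable_gw.integrableOn integrable_gw.integrableOn

lemma ghead_neg (z : ℝ) : ghead (-z) = gtail z := by
  unfold ghead gtail
  have h := integral_comp_neg_Iic (-z) gw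
  simp only [gw_neg, neg_neg] at h
  exact h

lemma gtail_zero : gtail 0 = √(2 * Real.pi) / 2 := by
  have h1 := ghead_add_gtail 0
  have h2 := ghead_neg 0
  rw [neg_zero] at h2
  linarith

lemma ghead_eq (z : ℝ) : ghead z = √(2 * Real.pi) / 2 + ∫ t in (0 : ℝ)..z, gw t := by
  have h1 := intervalIntegral.integral_Iic_sub_Iic (a := 0) (b := z)
    integrable_gw.integrableOn integrable_gw.integrableOn
  have h2 := ghead_add_gtail 0
  have h3 := gtail_zero
  change ghead z - ghead 0 = _ at h1
  linarith

lemma hasDerivAt_ghead (z : ℝ) : HasDerivAt ghead (gw z) z := by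
  have h : ghead = fun z => √(2 * Real.pi) / 2 + ∫ t in (0 : ℝ)..z, gw t := funext ghead_eq
  rw [h]
  exact (intervalIntegral.integral_hasDerivAt_right
    (continuous_gw.intervalIntegrable _ _) (continuous_gw.stronglyMeasurableAtFilter _ _)
    continuous_gw.continuousAt).const_add _

lemma gtail_eq (z : ℝ) : gtail z = √(2 * Real.pi) - ghead z := by
  linarith [ghead_add_gtail z]

lemma hasDerivAt_gtail (z : ℝ) : HasDerivAt gtail (-gw z) z := by
  have h : gtail = fun z => √(2 * Real.pi) - ghead z := funext gtail_eq
  rw [h]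
  exact (hasDerivAt_ghead z).const_sub _

lemma ghead_pos (z : ℝ) : 0 < ghead z := by
  have h1 : 0 ≤ ghead (z - 1) := integral_nonneg fun t => (gw_pos t).le
  have h2 : StrictMono ghead := strictMono_of_hasDerivAt_pos hasDerivAt_ghead gw_pos
  exact h1.trans_lt (h2 (by linarith))

lemma gtail_pos (z : ℝ) : 0 < gtail z := by rw [← ghead_neg]; exact ghead_pos _

lemma gtail_antitone : Antitone gtail :=
  antitone_of_hasDerivAt_nonpos hasDerivAt_gtail fun z => neg_nonpos.2 (gw_pos z).le

lemma hasDerivAt_gw (z : ℝ) : HasDerivAt gw (-z * gw z) z := by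
  have h : HasDerivAt (fun t : ℝ => -(t ^ 2 / 2)) (-z) z := by
    refine ((hasDerivAt_pow 2 z).div_const 2).neg.congr_deriv ?_
    norm_num
  refine h.exp.congr_deriv ?_
  unfold gw
  ring

lemma tendsto_gw : Tendsto gw atTop (nhds 0) := by
  unfold gw
  refine Real.tendsto_exp_neg_atTop_nhds_zero.comp ?_
  exact (tendsto_pow_atTop two_ne_zero).atTop_div_const two_pos

lemma tendsto_gtail : Tendsto gtail atTop (nhds 0) := by
  have h := intervalIntegral_tendsto_integral_Ioi (f := gw) 0 integrable_gw.integrableOn tendsto_id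
  have h2 : ∀ z, gtail z = gtail 0 - ∫ t in (0 : ℝ)..z, gw t := fun z => by
    rw [gtail_eq, ghead_eq, gtail_zero]; ring
  have : gtail = fun z => gtail 0 - ∫ t in (0 : ℝ)..z, gw t := funext h2
  rw [this]
  have h3 := h.const_sub (gtail 0)
  rw [show gtail 0 - ∫ t in Set.Ioi 0, gw t = 0 from sub_self _] at h3
  exact h3

/-- Comparison of the Gaussian tail with a function `b` times the weight. -/
lemma gtail_le_of_hasDerivAt {b b' : ℝ → ℝ} {z : ℝ} (hb : ∀ t, z ≤ t → HasDerivAt b (b' t) t)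
    (h : ∀ t, z ≤ t → b' t - t * b t ≤ -1) (hlim : Tendsto (fun t => gw t * b t) atTop (nhds 0)) :
    gtail z ≤ gw z * b z := by
  have hd : ∀ t, z ≤ t → HasDerivAt (fun t => gtail t - gw t * b t)
      (-gw t - (-t * gw t * b t + gw t * b' t)) t := fun t ht =>
    (hasDerivAt_gtail t).sub ((hasDerivAt_gw t).mul (hb t ht))
  have hmono : MonotoneOn (fun t => gtail t - gw t * b t) (Set.Ici z) := by
    refine monotoneOn_of_hasDerivWithinAt_nonneg (convex_Ici z)
      (fun t ht => (hd t ht).continuousAt.continuousWithinAt)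
      (fun t ht => (hd t (interior_subset ht)).hasDerivWithinAt) fun t ht => ?_
    have h1 := h t (interior_subset ht)
    have h2 := gw_pos t
    nlinarith
  have ht := tendsto_gtail.sub hlim
  rw [sub_zero] at ht
  have := ge_of_tendsto ht (eventually_atTop.2 ⟨z, fun t ht => hmono Set.self_mem_Ici ht ht⟩)
  dsimp only at this
  linarith

lemma le_gtail_of_hasDerivAt {b b' : ℝ → ℝ} {z : ℝ} (hb : ∀ t, z ≤ t → HasDerivAt b (b' t) t)
    (h : ∀ t, z ≤ t → -1 ≤ b' t - t * b t) (hlim : Tendsto (fun t => gw t * b t) atTop (nhds 0)) :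
    gw z * b z ≤ gtail z := by
  have hd : ∀ t, z ≤ t → HasDerivAt (fun t => gtail t - gw t * b t)
      (-gw t - (-t * gw t * b t + gw t * b' t)) t := fun t ht =>
    (hasDerivAt_gtail t).sub ((hasDerivAt_gw t).mul (hb t ht))
  have hmono : AntitoneOn (fun t => gtail t - gw t * b t) (Set.Ici z) := by
    refine antitoneOn_of_hasDerivWithinAt_nonpos (convex_Ici z)
      (fun t ht => (hd t ht).continuousAt.continuousWithinAt)
      (fun t ht => (hd t (interior_subset ht)).hasDerivWithinAt) fun t ht => ?_
    have h1 := h t (interior_subset ht)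
    have h2 := gw_pos t
    nlinarith
  have ht := tendsto_gtail.sub hlim
  rw [sub_zero] at ht
  have := le_of_tendsto ht (eventually_atTop.2 ⟨z, fun t ht => hmono Set.self_mem_Ici ht ht⟩)
  dsimp only at this
  linarith

lemma tendsto_gw_mul {b : ℝ → ℝ} (h : ∀ t, 1 ≤ t → 0 ≤ b t ∧ b t ≤ 1) :
    Tendsto (fun t => gw t * b t) atTop (nhds 0) := by
  refine squeeze_zero' ?_ ?_ tendsto_gw
  · filter_upwards [eventually_ge_atTop 1] with t ht using mul_nonneg (gw_pos t).le (h t ht).1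
  · filter_upwards [eventually_ge_atTop 1] with t ht using
      mul_le_of_le_one_right (gw_pos t).le (h t ht).2

/-- The rational factor is the third convergent of Laplace's continued fraction for the Mills ratio;
odd convergents bound it from above. -/
lemma gtail_le {z : ℝ} (hz : 0 < z) : gtail z ≤ gw z * ((z ^ 2 + 2) / (z ^ 3 + 3 * z)) := by
  refine gtail_le_of_hasDerivAt (b := fun t => (t ^ 2 + 2) / (t ^ 3 + 3 * t))
    (b' := fun t => (2 * t * (t ^ 3 + 3 * t) - (t ^ 2 + 2) * (3 * t ^ 2 + 3)) / (t ^ 3 + 3 * t) ^ 2)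
    (fun t ht => ?_) (fun t ht => ?_) (tendsto_gw_mul fun t ht => ⟨by positivity, ?_⟩)
  · have ht0 : 0 < t := hz.trans_le ht
    have h1 : HasDerivAt (fun t : ℝ => t ^ 2 + 2) (2 * t) t := by
      simpa using (hasDerivAt_pow 2 t).add_const 2
    have h2 : HasDerivAt (fun t : ℝ => t ^ 3 + 3 * t) (3 * t ^ 2 + 3) t := by
      exact ((hasDerivAt_pow 3 t).add ((hasDerivAt_id t).const_mul 3)).congr_deriv (by norm_num)
    exact h1.div h2 (by positivity)
  · have ht0 : 0 < t := hz.trans_le ht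
    have h3 : 0 < t ^ 3 + 3 * t := by positivity
    rw [mul_div_assoc', ← sub_nonneg]
    have : -1 - ((2 * t * (t ^ 3 + 3 * t) - (t ^ 2 + 2) * (3 * t ^ 2 + 3)) / (t ^ 3 + 3 * t) ^ 2
        - t * (t ^ 2 + 2) / (t ^ 3 + 3 * t)) = 6 / (t ^ 3 + 3 * t) ^ 2 := by
      field_simp
      ring
    rw [this]
    positivity
  · rw [div_le_one (by positivity)]
    nlinarith [mul_nonneg (sub_nonneg.2 ht) (sq_nonneg t)]

/-- The fourth convergent; even ones bound from below. -/
lemma le_gtail {z : ℝ} (hz : 0 < z) :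
    gw z * ((z ^ 3 + 5 * z) / (z ^ 4 + 6 * z ^ 2 + 3)) ≤ gtail z := by
  refine le_gtail_of_hasDerivAt (b := fun t => (t ^ 3 + 5 * t) / (t ^ 4 + 6 * t ^ 2 + 3))
    (b' := fun t => ((3 * t ^ 2 + 5) * (t ^ 4 + 6 * t ^ 2 + 3)
      - (t ^ 3 + 5 * t) * (4 * t ^ 3 + 12 * t)) / (t ^ 4 + 6 * t ^ 2 + 3) ^ 2)
    (fun t ht => ?_) (fun t ht => ?_) (tendsto_gw_mul fun t ht => ⟨by positivity, ?_⟩)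
  · have ht0 : 0 < t := hz.trans_le ht
    have h1 : HasDerivAt (fun t : ℝ => t ^ 3 + 5 * t) (3 * t ^ 2 + 5) t := by
      exact ((hasDerivAt_pow 3 t).add ((hasDerivAt_id t).const_mul 5)).congr_deriv (by norm_num)
    have h2 : HasDerivAt (fun t : ℝ => t ^ 4 + 6 * t ^ 2 + 3) (4 * t ^ 3 + 12 * t) t := by
      refine (((hasDerivAt_pow 4 t).add ((hasDerivAt_pow 2 t).const_mul 6)).add_const 3).congr_deriv ?_
      norm_num
      ring
    exact h1.div h2 (by positivity)
  · have ht0 : 0 < t := hz.trans_le ht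
    have h3 : 0 < t ^ 4 + 6 * t ^ 2 + 3 := by positivity
    rw [mul_div_assoc', ← sub_nonneg]
    have : ((3 * t ^ 2 + 5) * (t ^ 4 + 6 * t ^ 2 + 3)
      - (t ^ 3 + 5 * t) * (4 * t ^ 3 + 12 * t)) / (t ^ 4 + 6 * t ^ 2 + 3) ^ 2
        - t * (t ^ 3 + 5 * t) / (t ^ 4 + 6 * t ^ 2 + 3) - -1
        = 24 / (t ^ 4 + 6 * t ^ 2 + 3) ^ 2 := by
      field_simp
      ring
    rw [this]
    positivity
  · rw [div_le_one (by positivity)]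
    nlinarith [mul_nonneg (sub_nonneg.2 ht) (pow_nonneg (zero_le_one.trans ht) 3), sq_nonneg (t - 1),
      sq_nonneg t]

lemma mul_gtail_le (z : ℝ) : z * gtail z ≤ gw z := by
  rcases le_or_gt z 0 with hz | hz
  · exact (mul_nonpos_of_nonpos_of_nonneg hz (gtail_pos z).le).trans (gw_pos z).le
  · have h := gtail_le hz
    calc z * gtail z ≤ z * (gw z * ((z ^ 2 + 2) / (z ^ 3 + 3 * z))) := by gcongr
      _ = gw z * ((z ^ 2 + 2) / (z ^ 2 + 3)) := by field_simp
      _ ≤ gw z := mul_le_of_le_one_right (gw_pos z).le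
          ((div_le_one (by positivity)).2 (by linarith))

/-- The second derivative has the sign of `2 gw z - z gtail z`, positive by `mul_gtail_le`. Up to
affine changes this is the odds function, which is therefore convex. -/
lemma convexOn_inv_gtail : ConvexOn ℝ Set.univ fun z => (gtail z)⁻¹ := by
  have hd : ∀ z, HasDerivAt (fun z => (gtail z)⁻¹) (gw z / gtail z ^ 2) z := fun z => by
    refine ((hasDerivAt_gtail z).inv (gtail_pos z).ne').congr_deriv ?_
    rw [neg_neg]
  refine Monotone.convexOn_univ_of_deriv (fun z => (hd z).differentiableAt) ?_
  rw [funext fun z => (hd z).deriv]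
  have hd2 : ∀ z, HasDerivAt (fun z => gw z / gtail z ^ 2)
      ((-z * gw z * gtail z ^ 2 - gw z * (2 * gtail z * -gw z)) / (gtail z ^ 2) ^ 2) z := fun z => by
    refine ((hasDerivAt_gw z).div ((hasDerivAt_gtail z).pow 2)
      (pow_ne_zero 2 (gtail_pos z).ne')).congr_deriv ?_
    simp
  refine monotone_of_hasDerivAt_nonneg hd2 fun z => div_nonneg ?_ (sq_nonneg _)
  have h1 := mul_gtail_le z
  have h2 := gw_pos z
  have h3 := gtail_pos z
  have : -z * gw z * gtail z ^ 2 - gw z * (2 * gtail z * -gw z)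
      = gw z * gtail z * (2 * gw z - z * gtail z) := by ring
  rw [this]
  have : 0 ≤ 2 * gw z - z * gtail z := by linarith
  positivity

lemma gaussTail_eq (z : ℝ) : gaussTail z = ENNReal.ofReal (gtail z / √(2 * Real.pi)) := by
  unfold gaussTail gtail
  rw [gaussianReal_apply_eq_integral _ one_ne_zero, ← integral_div]
  congr 1
  refine integral_congr_ae (Eventually.of_forall fun t => ?_)
  simp only [gaussianPDFReal, gw, NNReal.coe_one, mul_one, sub_zero]
  rw [neg_div, div_eq_inv_mul]
  ring

lemma gaussCdf_eq (z : ℝ) : gaussCdf z = ENNReal.ofReal (ghead z / √(2 * Real.pi)) := by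
  unfold gaussCdf ghead
  rw [gaussianReal_apply_eq_integral _ one_ne_zero, ← integral_div]
  congr 1
  refine integral_congr_ae (Eventually.of_forall fun t => ?_)
  simp only [gaussianPDFReal, gw, NNReal.coe_one, mul_one, sub_zero]
  rw [neg_div, div_eq_inv_mul]
  ring

lemma gaussOdds_eq (z : ℝ) : gaussOdds z = ENNReal.ofReal (ghead z / gtail z) := by
  have hc : 0 < √(2 * Real.pi) := by positivity
  have := gtail_pos z
  rw [gaussOdds, gaussTail_eq, gaussCdf_eq, ← ENNReal.ofReal_div_of_pos (by positivity)]
  congr 1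
  field_simp

end Gaussian

/-! ### Convexity of the majorant and the chord-tangent criterion. -/

section Majorant

/-- Closed form of the majorant of the odds function. -/
noncomputable def oddsMaj (z : ℝ) : ℝ :=
  Real.exp (z - 1 / 2) + (z + 5 / 4) * (Real.exp (z ^ 2 / 2) * ghead (z - 1))

/-- Derivative of the majorant of the odds function. -/
noncomputable def oddsMaj' (z : ℝ) : ℝ :=
  (z + 9 / 4) * Real.exp (z - 1 / 2)
    + (1 + z ^ 2 + 5 / 4 * z) * (Real.exp (z ^ 2 / 2) * ghead (z - 1))

lemma exp_mul_eq (s z : ℝ) :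
    Real.exp (s * z - s ^ 2 / 2) = Real.exp (z ^ 2 / 2) * gw (s - z) := by
  rw [gw, ← Real.exp_add]; congr 1; ring

lemma hasDerivAt_exp_mul (s z : ℝ) :
    HasDerivAt (fun s => Real.exp (s * z - s ^ 2 / 2))
      ((z - s) * Real.exp (s * z - s ^ 2 / 2)) s := by
  have h : HasDerivAt (fun s : ℝ => s * z - s ^ 2 / 2) (z - s) s :=
    (((hasDerivAt_id s).mul_const z).sub ((hasDerivAt_pow 2 s).div_const 2)).congr_deriv
      (by norm_num)
  exact h.exp.congr_deriv (mul_comm _ _)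

lemma hasDerivAt_gtail_sub (s z : ℝ) :
    HasDerivAt (fun s => Real.exp (z ^ 2 / 2) * gtail (s - z))
      (-Real.exp (s * z - s ^ 2 / 2)) s := by
  have h := ((hasDerivAt_gtail (s - z)).comp s ((hasDerivAt_id s).sub_const z)).const_mul
    (Real.exp (z ^ 2 / 2))
  refine h.congr_deriv ?_
  rw [exp_mul_eq]
  ring

lemma tendsto_mul_exp_mul (z A : ℝ) :
    Tendsto (fun s => (s + A) * Real.exp (s * z - s ^ 2 / 2)) atTop (nhds 0) := by
  have h1 := tendsto_rpow_mul_exp_neg_mul_atTop_nhds_zero 1 1 one_pos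
  have h0 := tendsto_rpow_mul_exp_neg_mul_atTop_nhds_zero 0 1 one_pos
  have h2 := h1.add (h0.const_mul |A|)
  simp only [mul_zero, add_zero, Real.rpow_one, Real.rpow_zero, one_mul, neg_mul] at h2
  refine squeeze_zero_norm' ?_ h2
  -- For `s ≥ 2z + 2` the exponent is at most `-s`.
  filter_upwards [eventually_ge_atTop (max 0 (2 * z + 2))] with s hs
  have hs0 : 0 ≤ s := (le_max_left _ _).trans hs
  have hs1 : 2 * z + 2 ≤ s := (le_max_right _ _).trans hs
  rw [norm_mul, Real.norm_of_nonneg (Real.exp_nonneg _), ← add_mul]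
  refine mul_le_mul ?_ (Real.exp_le_exp.2 (by nlinarith)) (Real.exp_nonneg _)
    (by positivity)
  exact (norm_add_le _ _).trans (by rw [Real.norm_of_nonneg hs0, Real.norm_eq_abs])

lemma tendsto_gtail_sub (z : ℝ) :
    Tendsto (fun s => Real.exp (z ^ 2 / 2) * gtail (s - z)) atTop (nhds 0) := by
  have h := (tendsto_gtail.comp (tendsto_atTop_add_const_right _ (-z) tendsto_id)).const_mul
    (Real.exp (z ^ 2 / 2))
  rw [mul_zero] at h
  exact h

lemma integral_oddsMaj (z : ℝ) :
    IntegrableOn (fun s => (s + 5 / 4) * Real.exp (s * z - s ^ 2 / 2)) (Set.Ioi 1) ∧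
    ∫ s in Set.Ioi (1 : ℝ), (s + 5 / 4) * Real.exp (s * z - s ^ 2 / 2) = oddsMaj z := by
  set g : ℝ → ℝ := fun s => -(Real.exp (s * z - s ^ 2 / 2)
    + (z + 5 / 4) * (Real.exp (z ^ 2 / 2) * gtail (s - z))) with hg
  have hd : ∀ s ∈ Set.Ici (1 : ℝ), HasDerivAt g ((s + 5 / 4) * Real.exp (s * z - s ^ 2 / 2)) s :=
    fun s _ => by
      refine ((hasDerivAt_exp_mul s z).add
        ((hasDerivAt_gtail_sub s z).const_mul (z + 5 / 4))).neg.congr_deriv ?_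
      ring
  have hpos : ∀ s ∈ Set.Ioi (1 : ℝ), 0 ≤ (s + 5 / 4) * Real.exp (s * z - s ^ 2 / 2) :=
    fun s hs => by
      have : (1 : ℝ) < s := hs
      positivity
  have hlim : Tendsto g atTop (nhds 0) := by
    have h1 : Tendsto (fun s => Real.exp (s * z - s ^ 2 / 2)) atTop (nhds 0) := by
      have := (tendsto_mul_exp_mul z 1).sub (tendsto_mul_exp_mul z 0)
      rw [sub_zero] at this
      refine this.congr fun s => ?_
      ring
    have := (h1.add ((tendsto_gtail_sub z).const_mul (z + 5 / 4))).neg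
    simp only [mul_zero, add_zero, neg_zero] at this
    exact this
  refine ⟨integrableOn_Ioi_deriv_of_nonneg' hd hpos hlim, ?_⟩
  rw [integral_Ioi_of_hasDerivAt_of_nonneg' hd hpos hlim]
  simp only [hg, oddsMaj]
  rw [← ghead_neg (1 - z), neg_sub]
  ring_nf

/-- The integrand is the `z`-derivative of the one in `integral_oddsMaj`, so this integral supplies
the slope of the tangents. -/
lemma integral_oddsMaj' (z : ℝ) :
    IntegrableOn (fun s => s * ((s + 5 / 4) * Real.exp (s * z - s ^ 2 / 2))) (Set.Ioi 1) ∧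
    ∫ s in Set.Ioi (1 : ℝ), s * ((s + 5 / 4) * Real.exp (s * z - s ^ 2 / 2)) = oddsMaj' z := by
  set g : ℝ → ℝ := fun s => -((s + (z + 5 / 4)) * Real.exp (s * z - s ^ 2 / 2)
    + (1 + z ^ 2 + 5 / 4 * z) * (Real.exp (z ^ 2 / 2) * gtail (s - z))) with hg
  have hd : ∀ s ∈ Set.Ici (1 : ℝ),
      HasDerivAt g (s * ((s + 5 / 4) * Real.exp (s * z - s ^ 2 / 2))) s := fun s _ => by
    refine ((((hasDerivAt_id s).add_const (z + 5 / 4)).mul (hasDerivAt_exp_mul s z)).add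
      ((hasDerivAt_gtail_sub s z).const_mul (1 + z ^ 2 + 5 / 4 * z))).neg.congr_deriv ?_
    simp only [id]
    ring
  have hpos : ∀ s ∈ Set.Ioi (1 : ℝ), 0 ≤ s * ((s + 5 / 4) * Real.exp (s * z - s ^ 2 / 2)) :=
    fun s hs => by
      have : (1 : ℝ) < s := hs
      positivity
  have hlim : Tendsto g atTop (nhds 0) := by
    have := ((tendsto_mul_exp_mul z (z + 5 / 4)).add
      ((tendsto_gtail_sub z).const_mul (1 + z ^ 2 + 5 / 4 * z))).neg
    simp only [mul_zero, add_zero, neg_zero] at this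
    exact this
  refine ⟨integrableOn_Ioi_deriv_of_nonneg' hd hpos hlim, ?_⟩
  rw [integral_Ioi_of_hasDerivAt_of_nonneg' hd hpos hlim]
  simp only [hg, oddsMaj']
  rw [← ghead_neg (1 - z), neg_sub]
  ring_nf

lemma oddsMajorant_eq (z : ℝ) : oddsMajorant z = ENNReal.ofReal (oddsMaj z) := by
  obtain ⟨h1, h2⟩ := integral_oddsMaj z
  rw [oddsMajorant, ← h2, ofReal_integral_eq_lintegral_ofReal h1]
  refine (ae_restrict_iff' measurableSet_Ioi).2 (Eventually.of_forall fun s hs => ?_)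
  have : (1 : ℝ) < s := hs
  simp only [Pi.zero_apply]
  positivity

/-- Apply `1 + x ≤ exp x` under the integral sign. -/
lemma oddsMaj_tangent (m z : ℝ) : oddsMaj m + oddsMaj' m * (z - m) ≤ oddsMaj z := by
  obtain ⟨h1, h2⟩ := integral_oddsMaj m
  obtain ⟨h3, h4⟩ := integral_oddsMaj' m
  obtain ⟨h5, h6⟩ := integral_oddsMaj z
  rw [← h2, ← h4, ← h6, ← integral_mul_const, ← integral_add h1 (h3.mul_const _)]
  refine setIntegral_mono_on (h1.add (h3.mul_const _)) h5 measurableSet_Ioi fun s hs => ?_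
  have hs1 : (1 : ℝ) < s := hs
  have e : Real.exp (s * z - s ^ 2 / 2)
      = Real.exp (s * m - s ^ 2 / 2) * Real.exp (s * (z - m)) := by
    rw [← Real.exp_add]; congr 1; ring
  have h7 := Real.add_one_le_exp (s * (z - m))
  rw [e]
  have h8 : 0 ≤ (s + 5 / 4) * Real.exp (s * m - s ^ 2 / 2) := by positivity
  nlinarith [mul_le_mul_of_nonneg_left h7 h8]

/-- On `[u, v]` the convex odds function lies below its chord and the convex majorant above its
tangent at `m`. Chord and tangent are affine, so the endpoints decide. -/
lemma odds_le_of_chord_tangent {u v m : ℝ} (huv : u < v)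
    (hu : ghead u / gtail u ≤ oddsMaj m + oddsMaj' m * (u - m))
    (hv : ghead v / gtail v ≤ oddsMaj m + oddsMaj' m * (v - m)) {z : ℝ} (hz : z ∈ Set.Icc u v) :
    ghead z / gtail z ≤ oddsMaj z := by
  refine le_trans ?_ (oddsMaj_tangent m z)
  have hodds : ∀ z, ghead z / gtail z = √(2 * Real.pi) * (gtail z)⁻¹ - 1 := fun z => by
    have := (gtail_pos z).ne'
    rw [← ghead_add_gtail z]
    field_simp
    ring
  rw [hodds] at hu hv ⊢
  have hc : 0 < √(2 * Real.pi) := by positivity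
  obtain ⟨h1, h2⟩ := hz
  have hd : 0 < v - u := by linarith
  have hconv := convexOn_inv_gtail.2 (Set.mem_univ u) (Set.mem_univ v)
    (div_nonneg (sub_nonneg.2 h2) hd.le) (div_nonneg (sub_nonneg.2 h1) hd.le)
    (by rw [← add_div]; rw [show v - z + (z - u) = v - u by ring, div_self hd.ne'])
  simp only [smul_eq_mul] at hconv
  have hz : (v - z) / (v - u) * u + (z - u) / (v - u) * v = z := by field_simp; ring
  rw [hz] at hconv
  have ha : 0 ≤ (v - z) / (v - u) := div_nonneg (by linarith) hd.le
  have hb : 0 ≤ (z - u) / (v - u) := div_nonneg (by linarith) hd.le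
  have hab : (v - z) / (v - u) + (z - u) / (v - u) = 1 := by
    rw [← add_div, show v - z + (z - u) = v - u by ring, div_self hd.ne']
  set a := (v - z) / (v - u)
  set b := (z - u) / (v - u)
  have h5 := mul_le_mul_of_nonneg_left hu ha
  have h6 := mul_le_mul_of_nonneg_left hv hb
  have h7 := mul_le_mul_of_nonneg_left hconv hc.le
  have h8 : oddsMaj m + oddsMaj' m * (z - m)
      = a * (oddsMaj m + oddsMaj' m * (u - m)) + b * (oddsMaj m + oddsMaj' m * (v - m)) := by
    rw [← hz]
    linear_combination (-(oddsMaj m) + oddsMaj' m * m) * hab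
  rw [h8]
  have h9 : a + b = 1 := hab
  nlinarith

end Majorant

/-! ### Numerical verification that the majorant dominates the odds. -/

section Numerics

/-- Partial sums of the series of `e^{-u}`. -/
noncomputable def expPartial (n : ℕ) (u : ℝ) : ℝ :=
  ∑ k ∈ Finset.range n, (-u) ^ k / (k.factorial : ℝ)

/-- Partial sums of the series of the integral of the Gaussian weight over `[0, y]`. -/
noncomputable def gwPartial (n : ℕ) (y : ℝ) : ℝ :=
  ∑ k ∈ Finset.range n, (-1) ^ k * y ^ (2 * k + 1) / (2 ^ k * (k.factorial : ℝ) * (2 * k + 1))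

lemma hasDerivAt_expPartial_succ (n : ℕ) (u : ℝ) :
    HasDerivAt (expPartial (n + 1)) (-expPartial n u) u := by
  induction n with
  | zero =>
    have : expPartial (0 + 1) = fun _ => 1 := by ext; simp [expPartial]
    rw [this]
    simpa [expPartial] using hasDerivAt_const u (1 : ℝ)
  | succ n ih =>
    have h1 : expPartial (n + 1 + 1)
        = fun u => expPartial (n + 1) u + (-u) ^ (n + 1) / ((n + 1).factorial : ℝ) := by
      ext; rw [expPartial, Finset.sum_range_succ]; rfl
    have h2 : expPartial (n + 1) u = expPartial n u + (-u) ^ n / (n.factorial : ℝ) := by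
      rw [expPartial, Finset.sum_range_succ]; rfl
    rw [h1, h2]
    have h3 : HasDerivAt (fun u : ℝ => (-u) ^ (n + 1) / ((n + 1).factorial : ℝ))
        (-((-u) ^ n / (n.factorial : ℝ))) u := by
      refine (((hasDerivAt_neg u).pow (n + 1)).div_const _).congr_deriv ?_
      rw [Nat.factorial_succ]
      push_cast
      have : (n.factorial : ℝ) ≠ 0 := by positivity
      have : (n : ℝ) + 1 ≠ 0 := by positivity
      field_simp
    exact (ih.add h3).congr_deriv (by ring)

/-- Differentiation turns the claim for `n + 1` into the one for `n`, and the difference vanishes at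
`0` for positive orders. -/
lemma alternating_expPartial (n : ℕ) {u : ℝ} (hu : 0 ≤ u) :
    0 ≤ (-1) ^ n * (Real.exp (-u) - expPartial n u) := by
  induction n generalizing u with
  | zero => simpa [expPartial] using Real.exp_nonneg (-u)
  | succ n ih =>
    have hd : ∀ u, HasDerivAt (fun u => (-1) ^ (n + 1) * (Real.exp (-u) - expPartial (n + 1) u))
        ((-1) ^ n * (Real.exp (-u) - expPartial n u)) u := fun u => by
      refine (((hasDerivAt_neg u).exp.sub (hasDerivAt_expPartial_succ n u)).const_mul
        ((-1) ^ (n + 1))).congr_deriv ?_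
      rw [pow_succ]
      ring
    have hm := monotoneOn_of_hasDerivWithinAt_nonneg (convex_Ici (0 : ℝ))
      (fun t _ => (hd t).continuousAt.continuousWithinAt)
      (fun t _ => (hd t).hasDerivWithinAt) (fun t ht => ih (interior_subset ht))
    have h0 := hm Set.self_mem_Ici hu hu
    refine le_trans (le_of_eq ?_) h0
    simp [expPartial, Finset.sum_range_succ']

lemma hasDerivAt_gwPartial (n : ℕ) (y : ℝ) :
    HasDerivAt (gwPartial n) (expPartial n (y ^ 2 / 2)) y := by
  unfold gwPartial expPartial
  refine HasDerivAt.fun_sum fun k _ => ?_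
  refine (((hasDerivAt_pow (2 * k + 1) y).const_mul ((-1) ^ k)).div_const _).congr_deriv ?_
  have h : (2 : ℝ) * k + 1 ≠ 0 := by positivity
  have h2 : (k.factorial : ℝ) ≠ 0 := by positivity
  rw [neg_pow (y ^ 2 / 2), div_pow, ← pow_mul, show 2 * k + 1 - 1 = 2 * k from rfl]
  push_cast
  field_simp

lemma alternating_gwPartial (n : ℕ) {y : ℝ} (hy : 0 ≤ y) :
    0 ≤ (-1) ^ n * (ghead y - √(2 * Real.pi) / 2 - gwPartial n y) := by
  have hd : ∀ y, HasDerivAt (fun y => (-1) ^ n * (ghead y - √(2 * Real.pi) / 2 - gwPartial n y))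
      ((-1) ^ n * (Real.exp (-(y ^ 2 / 2)) - expPartial n (y ^ 2 / 2))) y := fun y =>
    (((hasDerivAt_ghead y).sub_const _).sub (hasDerivAt_gwPartial n y)).const_mul _
  have hm := monotoneOn_of_hasDerivWithinAt_nonneg (convex_Ici (0 : ℝ))
    (fun t _ => (hd t).continuousAt.continuousWithinAt)
    (fun t _ => (hd t).hasDerivWithinAt)
    (fun t _ => alternating_expPartial n (by positivity))
  have h0 := hm Set.self_mem_Ici hy hy
  refine le_trans (le_of_eq ?_) h0
  have : gwPartial n 0 = 0 := by simp [gwPartial]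
  simp only [this, ghead_eq 0]
  simp

lemma exp_neg_bounds {u : ℝ} (hu : 0 ≤ u) :
    expPartial 10 u ≤ Real.exp (-u) ∧ Real.exp (-u) ≤ expPartial 9 u := by
  have h1 := alternating_expPartial 10 hu
  have h2 := alternating_expPartial 9 hu
  norm_num at h1 h2
  exact ⟨h1, h2⟩

lemma exp_bounds {u : ℝ} (hu : 0 ≤ u) (h : 0 < expPartial 10 u) :
    (expPartial 9 u)⁻¹ ≤ Real.exp u ∧ Real.exp u ≤ (expPartial 10 u)⁻¹ := by
  obtain ⟨h1, h2⟩ := exp_neg_bounds hu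
  rw [Real.exp_neg] at h1 h2
  exact ⟨inv_le_of_inv_le₀ (Real.exp_pos u) h2, (le_inv_comm₀ h (Real.exp_pos u)).1 h1⟩

lemma sqrt_two_pi_bounds : 2.50662 < √(2 * Real.pi) ∧ √(2 * Real.pi) < 2.50663 := by
  constructor
  · refine Real.lt_sqrt_of_sq_lt ?_
    linarith [Real.pi_gt_d6]
  · rw [Real.sqrt_lt' (by norm_num)]
    linarith [Real.pi_lt_d6]

/-- `1.25331` and `1.253315` enclose `√(2π)/2`. For the Taylor sums of the integral from `0`, an
even number of terms bounds from below, an odd number from above. -/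
lemma ghead_bounds {y l h : ℝ} (hy : 0 ≤ y) (hl : l ≤ 1.25331 + gwPartial 10 y)
    (hh : 1.253315 + gwPartial 11 y ≤ h) : l ≤ ghead y ∧ ghead y ≤ h := by
  have h1 : 0 ≤ ghead y - √(2 * Real.pi) / 2 - gwPartial 10 y := by
    linarith [alternating_gwPartial 10 hy]
  have h2 : ghead y - √(2 * Real.pi) / 2 - gwPartial 11 y ≤ 0 := by
    linarith [alternating_gwPartial 11 hy]
  obtain ⟨h3, h4⟩ := sqrt_two_pi_bounds
  constructor <;> linarith

lemma ghead_neg_bounds {y l h : ℝ} (hy : 0 ≤ y) (hl : l ≤ 1.25331 - gwPartial 11 y)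
    (hh : 1.253315 - gwPartial 10 y ≤ h) : l ≤ ghead (-y) ∧ ghead (-y) ≤ h := by
  have h1 : 0 ≤ ghead y - √(2 * Real.pi) / 2 - gwPartial 10 y := by
    linarith [alternating_gwPartial 10 hy]
  have h2 : ghead y - √(2 * Real.pi) / 2 - gwPartial 11 y ≤ 0 := by
    linarith [alternating_gwPartial 11 hy]
  obtain ⟨h3, h4⟩ := sqrt_two_pi_bounds
  rw [ghead_neg, gtail_eq]
  constructor <;> linarith

/-- `ru`, `rv` bound the odds at the endpoints. The tangent at `m` is linear in `e = exp(m - 1/2)`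
and `w = exp(m²/2) ghead(m - 1)`, so `hlin` only needs numerical intervals for these two. -/
lemma odds_le_of_bounds {u v m el eh fl fh pl ph ru rv : ℝ} (huv : u < v) (hru : 0 ≤ ru)
    (hrv : 0 ≤ rv) (hpl : 0 ≤ pl)
    (he : el ≤ Real.exp (m - 1 / 2) ∧ Real.exp (m - 1 / 2) ≤ eh)
    (hf : fl ≤ Real.exp (m ^ 2 / 2) ∧ Real.exp (m ^ 2 / 2) ≤ fh)
    (hp : pl ≤ ghead (m - 1) ∧ ghead (m - 1) ≤ ph)
    (hu : ghead u * (1 + ru) ≤ ru * 2.50662) (hv : ghead v * (1 + rv) ≤ rv * 2.50662)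
    (hlin : ∀ e w : ℝ, el ≤ e → e ≤ eh → fl * pl ≤ w → w ≤ fh * ph →
      ru ≤ e + (m + 5 / 4) * w + ((m + 9 / 4) * e + (1 + m ^ 2 + 5 / 4 * m) * w) * (u - m) ∧
      rv ≤ e + (m + 5 / 4) * w + ((m + 9 / 4) * e + (1 + m ^ 2 + 5 / 4 * m) * w) * (v - m))
    {z : ℝ} (hz : z ∈ Set.Icc u v) : ghead z / gtail z ≤ oddsMaj z := by
  obtain ⟨h1, h2⟩ := hlin _ (Real.exp (m ^ 2 / 2) * ghead (m - 1)) he.1 he.2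
    (mul_le_mul hf.1 hp.1 hpl (Real.exp_nonneg _))
    (mul_le_mul hf.2 hp.2 (ghead_pos _).le ((Real.exp_nonneg _).trans hf.2))
  have hc := sqrt_two_pi_bounds.1
  have key : ∀ t r : ℝ, 0 ≤ r → ghead t * (1 + r) ≤ r * 2.50662 → ghead t / gtail t ≤ r := by
    intro t r hr ht
    rw [div_le_iff₀ (gtail_pos t), gtail_eq]
    nlinarith
  exact odds_le_of_chord_tangent huv ((key u ru hru hu).trans h1) ((key v rv hrv hv).trans h2) hz

/-- First of five intervals covering `[-5/4, 3/2]`, each with its tangent point `m` near the middle.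
-/
lemma odds_le_oddsMaj_of_le_neg_half {z : ℝ} (hz : z ∈ Set.Icc (-(5 / 4) : ℝ) (-(1 / 2))) :
    ghead z / gtail z ≤ oddsMaj z := by
  have hu : 0.26480 ≤ ghead (-(5 / 4)) ∧ ghead (-(5 / 4)) ≤ 0.26485 :=
    ghead_neg_bounds (by norm_num) (by norm_num [gwPartial, Finset.sum_range_succ, Nat.factorial])
      (by norm_num [gwPartial, Finset.sum_range_succ, Nat.factorial])
  have hv : 0.77336 ≤ ghead (-(1 / 2)) ∧ ghead (-(1 / 2)) ≤ 0.77341 :=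
    ghead_neg_bounds (by norm_num) (by norm_num [gwPartial, Finset.sum_range_succ, Nat.factorial])
      (by norm_num [gwPartial, Finset.sum_range_succ, Nat.factorial])
  have hp : 0.08058 ≤ ghead (-(37 / 20)) ∧ ghead (-(37 / 20)) ≤ 0.08063 :=
    ghead_neg_bounds (by norm_num) (by norm_num [gwPartial, Finset.sum_range_succ, Nat.factorial])
      (by norm_num [gwPartial, Finset.sum_range_succ, Nat.factorial])
  have he := exp_neg_bounds (u := 27 / 20) (by norm_num)
  have hf := exp_bounds (u := 289 / 800) (by norm_num)
    (by norm_num [expPartial, Finset.sum_range_succ, Nat.factorial])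
  norm_num [expPartial, Finset.sum_range_succ, Nat.factorial] at he hf
  refine odds_le_of_bounds (m := -(17 / 20)) (el := 0.25904) (eh := 0.25945) (fl := 1.43492)
    (fh := 1.43533) (pl := 0.08058) (ph := 0.08063) (ru := 0.1184) (rv := 0.4467)
    (by norm_num) (by norm_num) (by norm_num) (by norm_num) ?_ ?_ ?_ ?_ ?_ ?_ hz
  · norm_num; constructor <;> linarith [he.1, he.2]
  · norm_num; constructor <;> linarith [hf.1, hf.2]
  · norm_num; norm_num at hp; exact hp
  · linarith [hu.2]
  · linarith [hv.2]
  · intro e w h1 h2 h3 h4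
    norm_num at h3 h4 ⊢
    constructor <;> linarith

lemma odds_le_oddsMaj_of_nonpos {z : ℝ} (hz : z ∈ Set.Icc (-(1 / 2) : ℝ) 0) :
    ghead z / gtail z ≤ oddsMaj z := by
  have hu : 0.77336 ≤ ghead (-(1 / 2)) ∧ ghead (-(1 / 2)) ≤ 0.77341 :=
    ghead_neg_bounds (by norm_num) (by norm_num [gwPartial, Finset.sum_range_succ, Nat.factorial])
      (by norm_num [gwPartial, Finset.sum_range_succ, Nat.factorial])
  have hv : 1.25329 ≤ ghead 0 ∧ ghead 0 ≤ 1.25334 :=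
    ghead_bounds (by norm_num) (by norm_num [gwPartial, Finset.sum_range_succ, Nat.factorial])
      (by norm_num [gwPartial, Finset.sum_range_succ, Nat.factorial])
  have hp : 0.26480 ≤ ghead (-(5 / 4)) ∧ ghead (-(5 / 4)) ≤ 0.26485 :=
    ghead_neg_bounds (by norm_num) (by norm_num [gwPartial, Finset.sum_range_succ, Nat.factorial])
      (by norm_num [gwPartial, Finset.sum_range_succ, Nat.factorial])
  have he := exp_neg_bounds (u := 3 / 4) (by norm_num)
  have hf := exp_bounds (u := 1 / 32) (by norm_num)
    (by norm_num [expPartial, Finset.sum_range_succ, Nat.factorial])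
  norm_num [expPartial, Finset.sum_range_succ, Nat.factorial] at he hf
  refine odds_le_of_bounds (m := -(1 / 4)) (el := 0.47216) (eh := 0.47257) (fl := 1.03154)
    (fh := 1.03195) (pl := 0.26480) (ph := 0.26485) (ru := 0.4467) (rv := 1.0009)
    (by norm_num) (by norm_num) (by norm_num) (by norm_num) ?_ ?_ ?_ ?_ ?_ ?_ hz
  · norm_num; constructor <;> linarith [he.1, he.2]
  · norm_num; constructor <;> linarith [hf.1, hf.2]
  · norm_num; norm_num at hp; exact hp
  · linarith [hu.2]
  · linarith [hv.2]
  · intro e w h1 h2 h3 h4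
    norm_num at h3 h4 ⊢
    constructor <;> linarith

lemma odds_le_oddsMaj_of_le_nine_twentieths {z : ℝ} (hz : z ∈ Set.Icc (0 : ℝ) (9 / 20)) :
    ghead z / gtail z ≤ oddsMaj z := by
  have hu : 1.25329 ≤ ghead 0 ∧ ghead 0 ≤ 1.25334 :=
    ghead_bounds (by norm_num) (by norm_num [gwPartial, Finset.sum_range_succ, Nat.factorial])
      (by norm_num [gwPartial, Finset.sum_range_succ, Nat.factorial])
  have hv : 1.68855 ≤ ghead (9 / 20) ∧ ghead (9 / 20) ≤ 1.68860 :=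
    ghead_bounds (by norm_num) (by norm_num [gwPartial, Finset.sum_range_succ, Nat.factorial])
      (by norm_num [gwPartial, Finset.sum_range_succ, Nat.factorial])
  have hp : 0.53102 ≤ ghead (-(4 / 5)) ∧ ghead (-(4 / 5)) ≤ 0.53107 :=
    ghead_neg_bounds (by norm_num) (by norm_num [gwPartial, Finset.sum_range_succ, Nat.factorial])
      (by norm_num [gwPartial, Finset.sum_range_succ, Nat.factorial])
  have he := exp_neg_bounds (u := 3 / 10) (by norm_num)
  have hf := exp_bounds (u := 1 / 50) (by norm_num)
    (by norm_num [expPartial, Finset.sum_range_succ, Nat.factorial])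
  norm_num [expPartial, Finset.sum_range_succ, Nat.factorial] at he hf
  refine odds_le_of_bounds (m := 1 / 5) (el := 0.74061) (eh := 0.74102) (fl := 1.02000)
    (fh := 1.02041) (pl := 0.53102) (ph := 0.53107) (ru := 1.0009) (rv := 2.0659)
    (by norm_num) (by norm_num) (by norm_num) (by norm_num) ?_ ?_ ?_ ?_ ?_ ?_ hz
  · norm_num; constructor <;> linarith [he.1, he.2]
  · norm_num; constructor <;> linarith [hf.1, hf.2]
  · norm_num; norm_num at hp; exact hp
  · linarith [hu.2]
  · linarith [hv.2]
  · intro e w h1 h2 h3 h4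
    norm_num at h3 h4 ⊢
    constructor <;> linarith

lemma odds_le_oddsMaj_of_le_nineteen_twentieths {z : ℝ} (hz : z ∈ Set.Icc (9 / 20 : ℝ) (19 / 20)) :
    ghead z / gtail z ≤ oddsMaj z := by
  have hu : 1.68855 ≤ ghead (9 / 20) ∧ ghead (9 / 20) ≤ 1.68860 :=
    ghead_bounds (by norm_num) (by norm_num [gwPartial, Finset.sum_range_succ, Nat.factorial])
      (by norm_num [gwPartial, Finset.sum_range_succ, Nat.factorial])
  have hv : 2.07783 ≤ ghead (19 / 20) ∧ ghead (19 / 20) ≤ 2.07788 :=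
    ghead_bounds (by norm_num) (by norm_num [gwPartial, Finset.sum_range_succ, Nat.factorial])
      (by norm_num [gwPartial, Finset.sum_range_succ, Nat.factorial])
  have hp : 0.91031 ≤ ghead (-(7 / 20)) ∧ ghead (-(7 / 20)) ≤ 0.91036 :=
    ghead_neg_bounds (by norm_num) (by norm_num [gwPartial, Finset.sum_range_succ, Nat.factorial])
      (by norm_num [gwPartial, Finset.sum_range_succ, Nat.factorial])
  have he := exp_bounds (u := 3 / 20) (by norm_num)
    (by norm_num [expPartial, Finset.sum_range_succ, Nat.factorial])
  have hf := exp_bounds (u := 169 / 800) (by norm_num)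
    (by norm_num [expPartial, Finset.sum_range_succ, Nat.factorial])
  norm_num [expPartial, Finset.sum_range_succ, Nat.factorial] at he hf
  refine odds_le_of_bounds (m := 13 / 20) (el := 1.16163) (eh := 1.16204) (fl := 1.23502)
    (fh := 1.23543) (pl := 0.91031) (ph := 0.91036) (ru := 2.0659) (rv := 4.8501)
    (by norm_num) (by norm_num) (by norm_num) (by norm_num) ?_ ?_ ?_ ?_ ?_ ?_ hz
  · norm_num; constructor <;> linarith [he.1, he.2]
  · norm_num; constructor <;> linarith [hf.1, hf.2]
  · norm_num; norm_num at hp; exact hp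
  · linarith [hu.2]
  · linarith [hv.2]
  · intro e w h1 h2 h3 h4
    norm_num at h3 h4 ⊢
    constructor <;> linarith

lemma odds_le_oddsMaj_of_le_three_halves {z : ℝ} (hz : z ∈ Set.Icc (19 / 20 : ℝ) (3 / 2)) :
    ghead z / gtail z ≤ oddsMaj z := by
  have hu : 2.07783 ≤ ghead (19 / 20) ∧ ghead (19 / 20) ≤ 2.07788 :=
    ghead_bounds (by norm_num) (by norm_num [gwPartial, Finset.sum_range_succ, Nat.factorial])
      (by norm_num [gwPartial, Finset.sum_range_succ, Nat.factorial])
  have hv : 2.33914 ≤ ghead (3 / 2) ∧ ghead (3 / 2) ≤ 2.33919 :=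
    ghead_bounds (by norm_num) (by norm_num [gwPartial, Finset.sum_range_succ, Nat.factorial])
      (by norm_num [gwPartial, Finset.sum_range_succ, Nat.factorial])
  have hp : 1.40273 ≤ ghead (3 / 20) ∧ ghead (3 / 20) ≤ 1.40278 :=
    ghead_bounds (by norm_num) (by norm_num [gwPartial, Finset.sum_range_succ, Nat.factorial])
      (by norm_num [gwPartial, Finset.sum_range_succ, Nat.factorial])
  have he := exp_bounds (u := 13 / 20) (by norm_num)
    (by norm_num [expPartial, Finset.sum_range_succ, Nat.factorial])
  have hf := exp_bounds (u := 529 / 800) (by norm_num)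
    (by norm_num [expPartial, Finset.sum_range_succ, Nat.factorial])
  norm_num [expPartial, Finset.sum_range_succ, Nat.factorial] at he hf
  refine odds_le_of_bounds (m := 23 / 20) (el := 1.91534) (eh := 1.91575) (fl := 1.93701)
    (fh := 1.93742) (pl := 1.40273) (ph := 1.40278) (ru := 4.8501) (rv := 13.9798)
    (by norm_num) (by norm_num) (by norm_num) (by norm_num) ?_ ?_ ?_ ?_ ?_ ?_ hz
  · norm_num; constructor <;> linarith [he.1, he.2]
  · norm_num; constructor <;> linarith [hf.1, hf.2]
  · norm_num; norm_num at hp; exact hp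
  · linarith [hu.2]
  · linarith [hv.2]
  · intro e w h1 h2 h3 h4
    norm_num at h3 h4 ⊢
    constructor <;> linarith

/-- For `z ≤ -5/4` the coefficient `z + 5/4` is nonpositive, so an upper tail bound on `ghead (z -
1)` bounds the majorant from below; both sides then compare through `exp(z - 1/2)`. -/
lemma odds_le_oddsMaj_left {z : ℝ} (hz : z ≤ -(5 / 4)) : ghead z / gtail z ≤ oddsMaj z := by
  set s := -z with hs
  have hs1 : 5 / 4 ≤ s := by linarith
  have hs0 : 0 < s := by linarith
  have hz' : z = -s := by rw [hs, neg_neg]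
  have hg := (ghead_bounds (y := 5 / 4) (l := 2.2) (h := 3) (by norm_num)
    (by norm_num [gwPartial, Finset.sum_range_succ, Nat.factorial])
    (by norm_num [gwPartial, Finset.sum_range_succ, Nat.factorial])).1
  have hmono : ghead (5 / 4) ≤ ghead s :=
    (monotone_of_hasDerivAt_nonneg hasDerivAt_ghead fun t => (gw_pos t).le) hs1
  have h1 : gtail s ≤ gw s / s := by
    rw [le_div_iff₀ hs0, mul_comm]; exact mul_gtail_le s
  have h2 : gtail (1 + s) ≤ gw (1 + s) / (1 + s) := by
    rw [le_div_iff₀ (by linarith), mul_comm]; exact mul_gtail_le _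
  have e1 : ghead z = gtail s := by rw [hz', ghead_neg]
  have e2 : gtail z = ghead s := by rw [← ghead_neg z]
  have e3 : ghead (z - 1) = gtail (1 + s) := by
    rw [hz', ← ghead_neg]; congr 1; ring
  have e4 : Real.exp (z ^ 2 / 2) * gw (1 + s) = Real.exp (z - 1 / 2) := by
    rw [gw, ← Real.exp_add, hz']; congr 1; ring
  have h3 : Real.exp (z - 1 / 2) * (9 / 4 / (1 + s)) ≤ oddsMaj z := by
    unfold oddsMaj
    rw [e3]
    have h4 : Real.exp (z ^ 2 / 2) * gtail (1 + s) ≤ Real.exp (z - 1 / 2) / (1 + s) := by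
      rw [← e4, mul_div_assoc]; gcongr
    have h5 : (z + 5 / 4) * (Real.exp (z - 1 / 2) / (1 + s))
        ≤ (z + 5 / 4) * (Real.exp (z ^ 2 / 2) * gtail (1 + s)) :=
      mul_le_mul_of_nonpos_left h4 (by linarith)
    refine le_trans (le_of_eq ?_) (add_le_add_right h5 _)
    rw [hz']
    field_simp
    ring
  have h6 : gw s ≤ Real.exp 1 * Real.exp (z - 1 / 2) := by
    rw [gw, ← Real.exp_add]
    refine Real.exp_le_exp.2 ?_
    rw [hz']
    nlinarith [sq_nonneg (s - 1)]
  rw [e1, e2]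
  calc gtail s / ghead s ≤ (gw s / s) / 2.2 :=
        div_le_div₀ (div_nonneg (gw_pos s).le hs0.le) h1 (by norm_num) (by linarith)
    _ ≤ (Real.exp 1 * Real.exp (z - 1 / 2) / s) / 2.2 := by gcongr
    _ ≤ (2.7183 * Real.exp (z - 1 / 2) / s) / 2.2 := by
        gcongr; exact Real.exp_one_lt_d9.le.trans (by norm_num)
    _ = Real.exp (z - 1 / 2) * (2.7183 / (2.2 * s)) := by field_simp
    _ ≤ Real.exp (z - 1 / 2) * (9 / 4 / (1 + s)) := by
        refine mul_le_mul_of_nonneg_left ?_ (Real.exp_nonneg _)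
        rw [div_div, div_le_div_iff₀ (by positivity) (by positivity)]
        linarith
    _ ≤ _ := h3

/-- Here `ghead z ≤ √(2π)`, the majorant is at least `√(2π) exp(z²/2)(z + 1/2)`, and the Mills lower
bound times `z + 1/2` is at least `1`. -/
lemma odds_le_oddsMaj_right {z : ℝ} (hz : 3 / 2 ≤ z) : ghead z / gtail z ≤ oddsMaj z := by
  have hz0 : 0 < z := by linarith
  have hc := sqrt_two_pi_bounds
  have hg := (ghead_bounds (y := 1 / 2) (l := 1.7) (h := 3) (by norm_num)
    (by norm_num [gwPartial, Finset.sum_range_succ, Nat.factorial])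
    (by norm_num [gwPartial, Finset.sum_range_succ, Nat.factorial])).1
  have h1 : gtail (z - 1) ≤ gtail (1 / 2) := gtail_antitone (by linarith)
  have h2 := gtail_eq (1 / 2)
  have h3 := mul_gtail_le (z - 1)
  have h4 := gtail_eq (z - 1)
  -- By the Mills bound at `z - 1` the loss is at most `(9/4) gtail(1/2)`, below `(3/4)√(2π)`.
  have hM : √(2 * Real.pi) * (z + 1 / 2) ≤ gw (z - 1) + (z + 5 / 4) * ghead (z - 1) := by
    have : ghead (z - 1) = √(2 * Real.pi) - gtail (z - 1) := by linarith
    rw [this]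
    nlinarith
  have hmaj : oddsMaj z = Real.exp (z ^ 2 / 2) * (gw (z - 1) + (z + 5 / 4) * ghead (z - 1)) := by
    have : Real.exp (z ^ 2 / 2) * gw (z - 1) = Real.exp (z - 1 / 2) := by
      rw [gw, ← Real.exp_add]; congr 1; ring
    rw [mul_add, this, oddsMaj]; ring
  have hle := le_gtail hz0
  have hpos : 0 < z ^ 4 + 6 * z ^ 2 + 3 := by positivity
  have hb : 1 ≤ (z ^ 3 + 5 * z) / (z ^ 4 + 6 * z ^ 2 + 3) * (z + 1 / 2) := by
    rw [div_mul_eq_mul_div, le_div_iff₀ hpos]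
    nlinarith [mul_nonneg (sub_nonneg.2 hz) (sq_nonneg (z - 1)), mul_nonneg (sub_nonneg.2 hz) hz0.le]
  have hgw : gw z * Real.exp (z ^ 2 / 2) = 1 := by
    rw [gw, ← Real.exp_add]; simp
  rw [div_le_iff₀ (gtail_pos z), hmaj]
  have hM0 : 0 ≤ √(2 * Real.pi) * (z + 1 / 2) := by positivity
  have hhead : ghead z ≤ √(2 * Real.pi) := by linarith [ghead_add_gtail z, gtail_pos z]
  calc ghead z ≤ √(2 * Real.pi) * 1 := by rw [mul_one]; exact hhead
    _ ≤ √(2 * Real.pi) * ((z ^ 3 + 5 * z) / (z ^ 4 + 6 * z ^ 2 + 3) * (z + 1 / 2)) := by gcongr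
    _ = Real.exp (z ^ 2 / 2) * (√(2 * Real.pi) * (z + 1 / 2))
          * (gw z * ((z ^ 3 + 5 * z) / (z ^ 4 + 6 * z ^ 2 + 3))) := by
        linear_combination (-(√(2 * Real.pi) * ((z ^ 3 + 5 * z) / (z ^ 4 + 6 * z ^ 2 + 3)
          * (z + 1 / 2)))) * hgw
    _ ≤ _ := mul_le_mul (by gcongr) hle (mul_nonneg (gw_pos z).le (by positivity))
        (mul_nonneg (Real.exp_nonneg _) (hM0.trans hM))

lemma odds_le_oddsMaj (z : ℝ) : ghead z / gtail z ≤ oddsMaj z := by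
  rcases le_total z (-(5 / 4)) with h | h
  · exact odds_le_oddsMaj_left h
  rcases le_total z (-(1 / 2)) with h1 | h1
  · exact odds_le_oddsMaj_of_le_neg_half ⟨h, h1⟩
  rcases le_total z 0 with h2 | h2
  · exact odds_le_oddsMaj_of_nonpos ⟨h1, h2⟩
  rcases le_total z (9 / 20) with h3 | h3
  · exact odds_le_oddsMaj_of_le_nine_twentieths ⟨h2, h3⟩
  rcases le_total z (19 / 20) with h4 | h4
  · exact odds_le_oddsMaj_of_le_nineteen_twentieths ⟨h3, h4⟩
  rcases le_total z (3 / 2) with h5 | h5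
  · exact odds_le_oddsMaj_of_le_three_halves ⟨h4, h5⟩
  exact odds_le_oddsMaj_right h5

lemma gaussOdds_le_oddsMajorant (z : ℝ) : gaussOdds z ≤ oddsMajorant z := by
  rw [gaussOdds_eq, oddsMajorant_eq]
  exact ENNReal.ofReal_le_ofReal (odds_le_oddsMaj z)

end Numerics

/-! ### Linear bounds for the odds in `Z = 1/δ`. -/

section OddsBound

/-- A tangent line of the logarithm turns the bound on `oddsBound` into a polynomial inequality. -/
lemma oddsBound_inv_le {Z₀ l p q : ℝ} (hZ₀ : 0 < Z₀) (hl : Real.log (1 + Z₀) ≤ l)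
    (hpoly : ∀ Z : ℝ, 0 < Z →
      (5.5 + 2 * (l - Z₀ / (1 + Z₀))) * Z ^ 2 + 2 * Z ^ 3 / (1 + Z₀) + 2.25 * Z
        ≤ (p + q * Z) * (Z ^ 2 + Z + 1 / 2)) {Z : ℝ} (hZ : 0 < Z) :
    oddsBound (1 / Z) ≤ p + q * Z := by
  have hlog : Real.log (1 + Z) ≤ l + (Z - Z₀) / (1 + Z₀) := by
    have h := Real.log_le_sub_one_of_pos (x := (1 + Z) / (1 + Z₀)) (by positivity)
    rw [Real.log_div (by positivity) (by positivity)] at h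
    have : (1 + Z) / (1 + Z₀) - 1 = (Z - Z₀) / (1 + Z₀) := by field_simp; ring
    linarith
  -- Reciprocal of the quadratic lower bound for `exp(1/Z)`.
  have hexp : Real.exp (-(1 / Z)) ≤ Z ^ 2 / (Z ^ 2 + Z + 1 / 2) := by
    rw [Real.exp_neg, inv_le_comm₀ (Real.exp_pos _) (by positivity), inv_div]
    refine le_trans (le_of_eq ?_) (Real.quadratic_le_exp_of_nonneg (by positivity))
    field_simp
  have hpos : 0 ≤ 1 + 2 * Real.log (1 + Z) + 9 / 4 * (2 + 1 / Z) := by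
    have := Real.log_nonneg (show (1 : ℝ) ≤ 1 + Z by linarith)
    positivity
  unfold oddsBound
  rw [one_div_one_div]
  calc _ ≤ Z ^ 2 / (Z ^ 2 + Z + 1 / 2)
        * (1 + 2 * (l + (Z - Z₀) / (1 + Z₀)) + 9 / 4 * (2 + 1 / Z)) := by gcongr
    _ = ((5.5 + 2 * (l - Z₀ / (1 + Z₀))) * Z ^ 2 + 2 * Z ^ 3 / (1 + Z₀) + 2.25 * Z)
        / (Z ^ 2 + Z + 1 / 2) := by field_simp; ring
    _ ≤ _ := by
      rw [div_le_iff₀ (by positivity)]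
      exact hpoly Z hZ

lemma log_le_of_le_exp {x l : ℝ} (hx : 0 < x) (h : x ≤ Real.exp l) : Real.log x ≤ l :=
  (Real.log_le_iff_le_exp hx).2 h

/-- Among the lines with `Z₀ = 1.5, 2, 3, 4`, a smaller slope costs a larger intercept. The slope
feeds the `κ^(3/2)` coefficient and the intercept the `κ` coefficient. -/
lemma oddsBound_inv_le_tangent_three_halves {Z : ℝ} (hZ : 0 < Z) : oddsBound (1 / Z) ≤ 1.84 + 1.91 * Z := by
  refine oddsBound_inv_le (Z₀ := 1.5) (l := 0.9163) (by norm_num) ?_ ?_ hZ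
  · refine log_le_of_le_exp (by norm_num) (le_trans ?_ (Real.sum_le_exp_of_nonneg (by norm_num) 10))
    norm_num [Finset.sum_range_succ, Nat.factorial]
  · intro Z hZ
    norm_num
    -- `1.305` is close to the minimizer of the cubic difference of the two sides.
    nlinarith [mul_nonneg hZ.le (sq_nonneg (Z - 1.305)), sq_nonneg (Z - 1.305)]

lemma oddsBound_inv_le_tangent_two {Z : ℝ} (hZ : 0 < Z) : oddsBound (1 / Z) ≤ 2.65 + 1.4 * Z := by
  refine oddsBound_inv_le (Z₀ := 2) (l := 1.09862) (by norm_num) ?_ ?_ hZ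
  · refine log_le_of_le_exp (by norm_num) (le_trans ?_ (Real.sum_le_exp_of_nonneg (by norm_num) 12))
    norm_num [Finset.sum_range_succ, Nat.factorial]
  · intro Z hZ
    norm_num
    nlinarith [mul_nonneg hZ.le (sq_nonneg (Z - 2)), sq_nonneg (Z - 2), sq_nonneg Z]

lemma oddsBound_inv_le_tangent_three {Z : ℝ} (hZ : 0 < Z) : oddsBound (1 / Z) ≤ 3.81 + 0.9 * Z := by
  refine oddsBound_inv_le (Z₀ := 3) (l := 1.3863) (by norm_num) ?_ ?_ hZ
  · refine log_le_of_le_exp (by norm_num) (le_trans ?_ (Real.sum_le_exp_of_nonneg (by norm_num) 12))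
    norm_num [Finset.sum_range_succ, Nat.factorial]
  · intro Z hZ
    norm_num
    nlinarith [mul_nonneg hZ.le (sq_nonneg (Z - 3)), sq_nonneg (Z - 3), sq_nonneg Z]

lemma oddsBound_inv_le_tangent_four {Z : ℝ} (hZ : 0 < Z) : oddsBound (1 / Z) ≤ 4.66 + 0.65 * Z := by
  refine oddsBound_inv_le (Z₀ := 4) (l := 1.6095) (by norm_num) ?_ ?_ hZ
  · refine log_le_of_le_exp (by norm_num) (le_trans ?_ (Real.sum_le_exp_of_nonneg (by norm_num) 13))
    norm_num [Finset.sum_range_succ, Nat.factorial]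
  · intro Z hZ
    norm_num
    nlinarith [mul_nonneg hZ.le (sq_nonneg (Z - 4)), sq_nonneg (Z - 4), sq_nonneg Z]

end OddsBound

/-! ### Assembly of the TS-C bound with free parameters. -/

section Assembly

lemma sum_ite_exp_le {c L : ℝ} (hc : 0 < c) (T : ℕ) :
    ∑ n ∈ Finset.range T,
        (if max L 1 ≤ (n : ℝ) then ENNReal.ofReal (Real.exp (-(c * n))) else 0)
      ≤ ENNReal.ofReal (Real.exp (-(c * L)) * (1 + 1 / c)) := by
  -- Telescoping with a potential for the remaining tail; the step is `exp(-c)(1 + 1/c) ≤ 1/c`.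
  have key : ∀ T : ℕ, ∑ n ∈ Finset.range T, (if L ≤ (n : ℝ) then Real.exp (-(c * n)) else 0)
      + Real.exp (-(c * max (T : ℝ) L)) * (1 + 1 / c) ≤ Real.exp (-(c * L)) * (1 + 1 / c) := by
    intro T
    induction T with
    | zero =>
      simp only [Finset.range_zero, Finset.sum_empty, zero_add]
      gcongr
      exact le_max_right _ _
    | succ T ih =>
      rw [Finset.sum_range_succ]
      refine le_trans ?_ ih
      by_cases hT : L ≤ T
      · have h1 : max ((T + 1 : ℕ) : ℝ) L = T + 1 := by
          rw [max_eq_left] <;> push_cast <;> linarith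
        have h0 : Real.exp (-(c * (T + 1))) = Real.exp (-(c * T)) * Real.exp (-c) := by
          rw [← Real.exp_add]; congr 1; ring
        rw [if_pos hT, max_eq_left hT, h1, h0]
        have h2 : Real.exp (-c) ≤ 1 / (1 + c) := by
          rw [Real.exp_neg, inv_eq_one_div]
          exact one_div_le_one_div_of_le (by positivity) (by linarith [Real.add_one_le_exp c])
        have h3 : 1 / (1 + c) * (1 + 1 / c) = 1 / c := by field_simp; ring
        have h4 : Real.exp (-c) * (1 + 1 / c) ≤ 1 / c := by
          exact (mul_le_mul_of_nonneg_right h2 (by positivity)).trans h3.le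
        have := mul_le_mul_of_nonneg_left h4 (Real.exp_pos (-(c * T))).le
        linarith
      · rw [if_neg hT, add_zero]
        gcongr
        linarith
  calc _ ≤ ∑ n ∈ Finset.range T,
        ENNReal.ofReal (if L ≤ (n : ℝ) then Real.exp (-(c * n)) else 0) := by
        refine Finset.sum_le_sum fun n _ => ?_
        split_ifs with h1 h2
        · exact le_rfl
        · exact absurd ((le_max_left _ _).trans h1) h2
        · exact zero_le
        · simp
    _ = ENNReal.ofReal (∑ n ∈ Finset.range T,
          if L ≤ (n : ℝ) then Real.exp (-(c * n)) else 0) := by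
        rw [ENNReal.ofReal_sum_of_nonneg]
        intro n _
        split_ifs <;> positivity
    _ ≤ _ := by
        apply ENNReal.ofReal_le_ofReal
        have : 0 ≤ Real.exp (-(c * max (T : ℝ) L)) * (1 + 1 / c) := by positivity
        linarith [key T]

variable {K : ℕ} {Θ : Type*} {μ : Fin K → Θ → ℝ} {θ : Θ} {ks k : Fin K} {α β : ℝ} {σ : ℝ≥0}
  {τ : ℕ → Finset (Fin K) → Fin K} {ν : Fin K → Measure ℝ}
  {Ω : Type*} [MeasurableSpace Ω] {P : Measure Ω} [IsProbabilityMeasure P]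
  {X : Fin K → ℕ → Ω → ℝ} {G : ℕ → Fin K → Ω → ℝ}

lemma totalOdds_le_of_line (hβ : 1 ≤ β) (hσ : 0 < σ) (hX : IsRewardTable P ν X)
    (hsubG : ∀ l, HasSubgaussianMGF (fun r => r - μ l θ) (σ ^ 2) (ν l)) {Δ : ℝ} (hΔ : 0 < Δ)
    {κ a p q : ℝ} (hκ : κ = β * σ ^ 2 / Δ ^ 2) (ha : 0 < a)
    (hline : ∀ Z : ℝ, 0 < Z → oddsBound (1 / Z) ≤ p + q * Z) (T : ℕ) :
    totalOdds P β σ (X ks) (μ ks θ - a * Δ) T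
      ≤ ENNReal.ofReal (p / a ^ 2 * κ + q / a ^ 3 * (κ * √κ)) := by
  have hσ' : (0 : ℝ) < σ := hσ
  have hκ0 : 0 < κ := by rw [hκ]; positivity
  refine (totalOdds_le gaussOdds_le_oddsMajorant hβ hσ hX hsubG hΔ hκ ha T).trans
    (ENNReal.ofReal_le_ofReal ?_)
  have hs : 0 < √κ := Real.sqrt_pos.2 hκ0
  have h := hline (√κ / a) (by positivity)
  rw [one_div_div] at h
  calc _ ≤ κ / a ^ 2 * (p + q * (√κ / a)) := by gcongr
    _ = _ := by field_simp

/-- Collects the constant, `κ` and `κ^(3/2)` coefficients, so that only numerical bounds `v`, `g₁`,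
`g₂`, `g₃` remain to be supplied. -/
lemma lintegral_tscPulls_le_of_lines (hks : IsBestAt μ ks θ) (hgap : 0 < gap μ θ ks k)
    (hβ : 1 ≤ β) (hσ : 0 < σ) (hτ : IsTieBreaking τ) (hX : IsRewardTable P ν X)
    (hG : IsSamplingNoise P X G)
    (hsubG : ∀ l, HasSubgaussianMGF (fun r => r - μ l θ) (σ ^ 2) (ν l))
    {κ r b a₁ a₂ a₃ : ℝ} (hκ : κ = β * σ ^ 2 / gap μ θ ks k ^ 2) (hb : 0 < b)
    (ha₁ : 0 < a₁) (ha₂ : 0 < a₂) (ha₃ : 0 < a₃)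
    (h₁ : a₁ + b ≤ 1) (h₂ : a₂ + b ≤ 1) (h₃ : a₃ + b ≤ 1)
    {p₁ q₁ p₂ q₂ p₃ q₃ v g₁ g₂ g₃ : ℝ}
    (hline₁ : ∀ Z : ℝ, 0 < Z → oddsBound (1 / Z) ≤ p₁ + q₁ * Z)
    (hline₂ : ∀ Z : ℝ, 0 < Z → oddsBound (1 / Z) ≤ p₂ + q₂ * Z)
    (hline₃ : ∀ Z : ℝ, 0 < Z → oddsBound (1 / Z) ≤ p₃ + q₃ * Z)
    (hp₁ : 0 ≤ p₁) (hp₂ : 0 ≤ p₂) (hp₃ : 0 ≤ p₃) (hq₁ : 0 ≤ q₁) (hq₂ : 0 ≤ q₂) (hq₃ : 0 ≤ q₃)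
    (hv : Real.exp (-(b ^ 2 * r ^ 2 / 2)) ≤ v)
    (hg₁ : gaussTail ((1 - a₁ - b) * r) ≤ ENNReal.ofReal g₁)
    (hg₂ : gaussTail ((1 - a₂ - b) * r) ≤ ENNReal.ofReal g₂) (T : ℕ)
    (hg₃ : T * gaussTail ((1 - a₃ - b) * r) ≤ ENNReal.ofReal g₃)
    (hg₁0 : 0 ≤ g₁) (hg₂0 : 0 ≤ g₂) (hg₃0 : 0 ≤ g₃) :
    ∫⁻ ω, (tscPulls μ α β σ τ (fun l m => X l m ω) (fun s l => G s l ω) T k : ENNReal) ∂P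
      ≤ ∑ t ∈ Finset.range T, P (badEvent μ θ α σ X t)
        + ENNReal.ofReal (1 + v + g₃
          + (r ^ 2 + 2 * v / b ^ 2 + p₁ / a₁ ^ 2 + g₁ * (p₂ / a₂ ^ 2) + g₂ * (p₃ / a₃ ^ 2)) * κ
          + (q₁ / a₁ ^ 3 + g₁ * (q₂ / a₂ ^ 3) + g₂ * (q₃ / a₃ ^ 3)) * (κ * √κ)) := by
  have hσ' : (0 : ℝ) < σ := hσ
  have hβ0 : 0 < β := by linarith
  have hκ0 : 0 < κ := by rw [hκ]; positivity
  have hv0 : 0 ≤ v := (Real.exp_pos _).le.trans hv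
  set Δ := gap μ θ ks k with hΔ
  have hmain := lintegral_tscPulls_le (α := α) hks hgap hβ0 hσ hτ hX hG hsubG (r := r) hκ hb.le
    h₁ h₂ h₃ T
  have hV : ∑ n ∈ Finset.range T, (if max (κ * r ^ 2) 1 ≤ (n : ℝ) then
      ENNReal.ofReal (Real.exp (-(n * (b * Δ) ^ 2 / (2 * σ ^ 2)))) else 0)
      ≤ ENNReal.ofReal (v * (1 + 2 * κ / b ^ 2)) := by
    have h := sum_ite_exp_le (c := (b * Δ) ^ 2 / (2 * σ ^ 2)) (L := κ * r ^ 2)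
      (by positivity) T
    refine le_trans (le_of_eq (Finset.sum_congr rfl fun n _ => ?_))
      (h.trans (ENNReal.ofReal_le_ofReal ?_))
    · congr 4
      ring
    · refine mul_le_mul ?_ (add_le_add_right ?_ 1) (by positivity) hv0
      · refine le_trans (Real.exp_le_exp.2 (neg_le_neg ?_)) hv
        -- `κ` cancels: after `κr²` pulls the overestimation exponent no longer involves `σ` or `Δ`.
        have : (b * Δ) ^ 2 / (2 * σ ^ 2) * (κ * r ^ 2) = β * (b ^ 2 * r ^ 2 / 2) := by
          rw [hκ]; field_simp
        rw [this]
        exact le_mul_of_one_le_left (by positivity) hβ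
      · have : 1 / ((b * Δ) ^ 2 / (2 * σ ^ 2)) = 2 * (1 * σ ^ 2 / Δ ^ 2) / b ^ 2 := by
          field_simp
        rw [this, hκ]
        gcongr
  have ho := fun {a p q : ℝ} (ha : 0 < a)
    (hline : ∀ Z : ℝ, 0 < Z → oddsBound (1 / Z) ≤ p + q * Z) =>
    totalOdds_le_of_line (ks := ks) (p := p) (q := q) hβ hσ hX hsubG hgap hκ ha hline T
  refine hmain.trans ((add_le_add (add_le_add (add_le_add (add_le_add (add_le_add le_rfl hV)
    (ho ha₁ hline₁)) (mul_le_mul' hg₁ (ho ha₂ hline₂)))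
    (mul_le_mul' hg₂ (ho ha₃ hline₃))) hg₃).trans ?_)
  have hs := Real.sqrt_nonneg κ
  rw [← ENNReal.ofReal_mul hg₁0, ← ENNReal.ofReal_mul hg₂0]
  simp only [add_assoc]
  gcongr
  repeat rw [← ENNReal.ofReal_add (by positivity) (by positivity)]
  apply ENNReal.ofReal_le_ofReal
  apply le_of_eq
  ring

lemma gaussTail_le_ofReal {x₀ x g : ℝ} (hx₀ : 0 < x₀) (hx : x₀ ≤ x)
    (h : gw x₀ * ((x₀ ^ 2 + 2) / (x₀ ^ 3 + 3 * x₀)) ≤ 2.50662 * g) :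
    gaussTail x ≤ ENNReal.ofReal g := by
  refine (gaussTail_antitone hx).trans ?_
  rw [gaussTail_eq]
  apply ENNReal.ofReal_le_ofReal
  have hg : 0 ≤ 2.50662 * g := le_trans (mul_nonneg (gw_pos _).le (by positivity)) h
  rw [div_le_iff₀ (by linarith [sqrt_two_pi_bounds.1])]
  nlinarith [gtail_le hx₀, sqrt_two_pi_bounds.1]

lemma gaussTail_zero_le : gaussTail 0 ≤ ENNReal.ofReal (1 / 2) := by
  rw [gaussTail_eq, gtail_zero]
  apply ENNReal.ofReal_le_ofReal
  rw [div_div, div_le_div_iff₀ (by linarith [sqrt_two_pi_bounds.1]) two_pos]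
  linarith

/-- The horizon is put into the exponent, and the rational Mills factor, being decreasing, is
evaluated at `x₀`. -/
lemma natCast_mul_gaussTail_le {T : ℕ} (hT : 1 ≤ T) {x₀ x d g : ℝ} (hx₀ : 0 < x₀) (hx : x₀ ≤ x)
    (hd : Real.exp (Real.log T - x ^ 2 / 2) ≤ d)
    (h : d * ((x₀ ^ 2 + 2) / (x₀ ^ 3 + 3 * x₀)) ≤ 2.50662 * g) :
    T * gaussTail x ≤ ENNReal.ofReal g := by
  have hx' : 0 < x := hx₀.trans_le hx
  have hT0 : (0 : ℝ) < T := by exact_mod_cast hT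
  rw [gaussTail_eq, ← ENNReal.ofReal_natCast, ← ENNReal.ofReal_mul hT0.le]
  apply ENNReal.ofReal_le_ofReal
  have hd0 : 0 ≤ d := (Real.exp_pos _).le.trans hd
  have hg : 0 ≤ 2.50662 * g := le_trans (mul_nonneg hd0 (by positivity)) h
  have hK : (x ^ 2 + 2) / (x ^ 3 + 3 * x) ≤ (x₀ ^ 2 + 2) / (x₀ ^ 3 + 3 * x₀) := by
    rw [div_le_div_iff₀ (by positivity) (by positivity)]
    have : 0 ≤ (x - x₀) * (x ^ 2 * x₀ ^ 2 + 2 * (x ^ 2 + x * x₀ + x₀ ^ 2) - 3 * x * x₀ + 6) := by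
      apply mul_nonneg (by linarith)
      nlinarith [sq_nonneg (x - x₀), sq_nonneg (x * x₀), mul_pos hx' hx₀]
    linarith
  have h1 : T * gtail x ≤ d * ((x₀ ^ 2 + 2) / (x₀ ^ 3 + 3 * x₀)) := by
    calc T * gtail x ≤ T * (gw x * ((x ^ 2 + 2) / (x ^ 3 + 3 * x))) := by
          gcongr; exact gtail_le hx'
      _ = Real.exp (Real.log T - x ^ 2 / 2) * ((x ^ 2 + 2) / (x ^ 3 + 3 * x)) := by
          rw [sub_eq_add_neg, Real.exp_add, Real.exp_log hT0, gw, mul_assoc]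
      _ ≤ _ := by gcongr
  rw [← mul_div_assoc, div_le_iff₀ (by linarith [sqrt_two_pi_bounds.1])]
  nlinarith [sqrt_two_pi_bounds.1]

end Assembly

/-! ### Choice of parameters for each range of horizons. -/

section Horizons

lemma exp_neg_le_expPartial {u v c : ℝ} (hv : 0 ≤ v) (hvu : v ≤ u) (h : expPartial 9 v ≤ c) :
    Real.exp (-u) ≤ c :=
  (Real.exp_le_exp.2 (neg_le_neg hvu)).trans ((exp_neg_bounds hv).2.trans h)

lemma gw_le_expPartial {x c : ℝ} (h : expPartial 9 (x ^ 2 / 2) ≤ c) : gw x ≤ c :=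
  exp_neg_le_expPartial (by positivity) le_rfl h

lemma exp_le_of_one_le_mul_expPartial {u v c : ℝ} (hv : 0 ≤ v) (huv : u ≤ v)
    (hc : 0 < c) (h : 1 ≤ c * expPartial 10 v) : Real.exp u ≤ c := by
  refine (Real.exp_le_exp.2 huv).trans ?_
  have h1 := (exp_neg_bounds hv).1
  have h2 : Real.exp v * Real.exp (-v) = 1 := by rw [← Real.exp_add]; simp
  have h3 : 0 < Real.exp (-v) := Real.exp_pos _
  nlinarith [Real.exp_pos v]

variable {K : ℕ} {Θ : Type*} {μ : Fin K → Θ → ℝ} {θ : Θ} {ks k : Fin K} {α β : ℝ} {σ : ℝ≥0}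
  {τ : ℕ → Finset (Fin K) → Fin K} {ν : Fin K → Measure ℝ}
  {Ω : Type*} [MeasurableSpace Ω] {P : Measure Ω} [IsProbabilityMeasure P]
  {X : Fin K → ℕ → Ω → ℝ} {G : ℕ → Fin K → Ω → ℝ}

/-- With `a₁ + b = 1` the first tail factor is simply `1/2`. In the top layer `log T - x²/2 = 0.64
log T - 0.96`, at most `1.6` on this range. -/
lemma lintegral_tscPulls_le_of_log_le_four (hks : IsBestAt μ ks θ) (hgap : 0 < gap μ θ ks k)
    (hβ : 1 ≤ β) (hσ : 0 < σ) (hτ : IsTieBreaking τ) (hX : IsRewardTable P ν X)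
    (hG : IsSamplingNoise P X G)
    (hsubG : ∀ l, HasSubgaussianMGF (fun r => r - μ l θ) (σ ^ 2) (ν l))
    {κ : ℝ} (hκ : κ = β * σ ^ 2 / gap μ θ ks k ^ 2) {T : ℕ} (hT : 1 ≤ T)
    (hlo : 2.19 ≤ Real.log T) (hhi : Real.log T ≤ 4) :
    ∫⁻ ω, (tscPulls μ α β σ τ (fun l m => X l m ω) (fun s l => G s l ω) T k : ENNReal) ∂P
      ≤ ∑ t ∈ Finset.range T, P (badEvent μ θ α σ X t)
        + ENNReal.ofReal (4.5 * κ * Real.log T + (2.27 + 36.25 * κ + 17.7 * (κ * √κ))) := by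
  have hσ' : (0 : ℝ) < σ := hσ
  have hκ0 : 0 < κ := by rw [hκ]; positivity
  have hr2 : √(4.5 * Real.log T + 12) ^ 2 = 4.5 * Real.log T + 12 :=
    Real.sq_sqrt (by linarith)
  set r := √(4.5 * Real.log T + 12) with hr
  have hr0 : 4.6748 ≤ r := Real.le_sqrt_of_sq_le (by norm_num; linarith)
  refine (lintegral_tscPulls_le_of_lines (α := α) hks hgap hβ hσ hτ hX hG hsubG (r := r)
    (b := 0.3) (a₁ := 0.7) (a₂ := 0.45) (a₃ := 0.3) (v := 0.37402) (g₁ := 0.5) (g₂ := 0.13296)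
    (g₃ := 0.895) hκ
    (by norm_num) (by norm_num) (by norm_num) (by norm_num) (by norm_num) (by norm_num)
    (by norm_num) (fun Z => oddsBound_inv_le_tangent_three_halves) (fun Z => oddsBound_inv_le_tangent_two)
    (fun Z => oddsBound_inv_le_tangent_three) (by norm_num) (by norm_num) (by norm_num) (by norm_num)
    (by norm_num) (by norm_num) ?_ ?_ ?_ T ?_ (by norm_num) (by norm_num) (by norm_num)).trans ?_
  · refine exp_neg_le_expPartial (v := 0.983475) (by norm_num) (by rw [hr2]; linarith) ?_
    norm_num [expPartial, Finset.sum_range_succ, Nat.factorial]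
  · have : (1 - 0.7 - 0.3 : ℝ) * r = 0 := by norm_num
    rw [this]
    exact gaussTail_zero_le.trans (ENNReal.ofReal_le_ofReal (by norm_num))
  · refine gaussTail_le_ofReal (x₀ := 1.1687) (by norm_num) (by linarith) ?_
    have : gw 1.1687 ≤ 0.50515 := gw_le_expPartial
      (by norm_num [expPartial, Finset.sum_range_succ, Nat.factorial])
    norm_num at this ⊢
    linarith
  · refine natCast_mul_gaussTail_le hT (x₀ := 1.8699) (d := 4.9545) (by norm_num) (by linarith)
      (exp_le_of_one_le_mul_expPartial (v := 1.6) (by norm_num) ?_ (by norm_num) ?_) (by norm_num)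
    · rw [mul_pow, hr2]; linarith
    · norm_num [expPartial, Finset.sum_range_succ, Nat.factorial]
  · have : 0 ≤ κ * √κ := by positivity
    refine add_le_add_right (ENNReal.ofReal_le_ofReal ?_) _
    rw [hr2]
    norm_num
    linarith

lemma lintegral_tscPulls_le_of_four_le_log (hks : IsBestAt μ ks θ) (hgap : 0 < gap μ θ ks k)
    (hβ : 1 ≤ β) (hσ : 0 < σ) (hτ : IsTieBreaking τ) (hX : IsRewardTable P ν X)
    (hG : IsSamplingNoise P X G)
    (hsubG : ∀ l, HasSubgaussianMGF (fun r => r - μ l θ) (σ ^ 2) (ν l))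
    {κ : ℝ} (hκ : κ = β * σ ^ 2 / gap μ θ ks k ^ 2) {T : ℕ} (hT : 1 ≤ T)
    (hlo : 4 ≤ Real.log T) :
    ∫⁻ ω, (tscPulls μ α β σ τ (fun l m => X l m ω) (fun s l => G s l ω) T k : ENNReal) ∂P
      ≤ ∑ t ∈ Finset.range T, P (badEvent μ θ α σ X t)
        + ENNReal.ofReal (4.5 * κ * Real.log T + (2.25 + 38.45 * κ + 12.1 * (κ * √κ))) := by
  have hσ' : (0 : ℝ) < σ := hσ
  have hκ0 : 0 < κ := by rw [hκ]; positivity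
  have hκs : 0 ≤ κ * √κ := by positivity
  have hr2 : √(4.5 * Real.log T + 10) ^ 2 = 4.5 * Real.log T + 10 :=
    Real.sq_sqrt (by linarith)
  set r := √(4.5 * Real.log T + 10) with hr
  -- Up to `7` the top-layer exponent `0.4375 log T - 1.25` is still affordable, at most `1.8125`.
  rcases le_total (Real.log T) 7 with hhi | hhi
  · have hr0 : 5.2915 ≤ r := Real.le_sqrt_of_sq_le (by norm_num; linarith)
    refine (lintegral_tscPulls_le_of_lines (α := α) hks hgap hβ hσ hτ hX hG hsubG (r := r)
      (b := 0.25) (a₁ := 0.55) (a₂ := 0.4) (a₃ := 0.25) (v := 0.41688) (g₁ := 0.1631)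
      (g₂ := 0.0329) (g₃ := 0.8325) hκ
      (by norm_num) (by norm_num) (by norm_num) (by norm_num) (by norm_num) (by norm_num)
      (by norm_num) (fun Z => oddsBound_inv_le_tangent_two) (fun Z => oddsBound_inv_le_tangent_three)
      (fun Z => oddsBound_inv_le_tangent_four) (by norm_num) (by norm_num) (by norm_num) (by norm_num)
      (by norm_num) (by norm_num) ?_ ?_ ?_ T ?_ (by norm_num) (by norm_num) (by norm_num)).trans ?_
    · refine exp_neg_le_expPartial (v := 0.875) (by norm_num) (by rw [hr2]; linarith) ?_
      norm_num [expPartial, Finset.sum_range_succ, Nat.factorial]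
    · refine gaussTail_le_ofReal (x₀ := 1.0583) (by norm_num) (by linarith) ?_
      have : gw 1.0583 ≤ 0.57122 := gw_le_expPartial
        (by norm_num [expPartial, Finset.sum_range_succ, Nat.factorial])
      norm_num at this ⊢
      linarith
    · refine gaussTail_le_ofReal (x₀ := 1.852) (by norm_num) (by linarith) ?_
      have : gw 1.852 ≤ 0.1804 := gw_le_expPartial
        (by norm_num [expPartial, Finset.sum_range_succ, Nat.factorial])
      norm_num at this ⊢
      linarith
    · refine natCast_mul_gaussTail_le hT (x₀ := 2.6457) (d := 6.132) (by norm_num) (by linarith)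
        (exp_le_of_one_le_mul_expPartial (v := 1.8125) (by norm_num) ?_ (by norm_num) ?_)
        (by norm_num)
      · rw [mul_pow, hr2]; linarith
      · norm_num [expPartial, Finset.sum_range_succ, Nat.factorial]
    · refine add_le_add_right (ENNReal.ofReal_le_ofReal ?_) _
      rw [hr2]
      norm_num
      linarith
  · have hr0 : 6.442 ≤ r := Real.le_sqrt_of_sq_le (by norm_num; linarith)
    -- With `b = 1/4`, `a₃ = 1/12` one has `1 - a₃ - b = 2/3` and `(2/3)²·4.5/2 = 1`: the top layer
    -- cancels `log T` exactly, for every horizon.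
    refine (lintegral_tscPulls_le_of_lines (α := α) hks hgap hβ hσ hτ hX hG hsubG (r := r)
      (b := 0.25) (a₁ := 0.55) (a₂ := 0.3) (a₃ := 1 / 12) (v := 0.274) (g₁ := 0.107)
      (g₂ := 0.0022) (g₃ := 0.02) hκ
      (by norm_num) (by norm_num) (by norm_num) (by norm_num) (by norm_num) (by norm_num)
      (by norm_num) (fun Z => oddsBound_inv_le_tangent_three) (fun Z => oddsBound_inv_le_tangent_three)
      (fun Z => oddsBound_inv_le_tangent_four) (by norm_num) (by norm_num) (by norm_num) (by norm_num)
      (by norm_num) (by norm_num) ?_ ?_ ?_ T ?_ (by norm_num) (by norm_num) (by norm_num)).trans ?_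
    · refine exp_neg_le_expPartial (v := 1.296875) (by norm_num) (by rw [hr2]; linarith) ?_
      norm_num [expPartial, Finset.sum_range_succ, Nat.factorial]
    · refine gaussTail_le_ofReal (x₀ := 1.288) (by norm_num) (by linarith) ?_
      have : gw 1.288 ≤ 0.438 := gw_le_expPartial
        (by norm_num [expPartial, Finset.sum_range_succ, Nat.factorial])
      norm_num at this ⊢
      linarith
    · refine gaussTail_le_ofReal (x₀ := 2.89) (by norm_num) (by linarith) ?_
      -- The exponent is split in three, since the Taylor polynomial is sharp only for small
      -- arguments.
      have h1 : Real.exp (-1.39) ≤ 0.2493 := exp_neg_le_expPartial (by norm_num) le_rfl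
        (by norm_num [expPartial, Finset.sum_range_succ, Nat.factorial])
      have h2 : gw 2.89 ≤ 0.2493 ^ 3 := by
        refine le_trans ?_ (pow_le_pow_left₀ (Real.exp_pos _).le h1 3)
        rw [← Real.exp_nat_mul]
        exact Real.exp_le_exp.2 (by norm_num)
      norm_num at h2 ⊢
      linarith
    · refine natCast_mul_gaussTail_le hT (x₀ := 4) (d := 0.15) (by norm_num) (by linarith)
        ?_ (by norm_num)
      rw [← neg_sub]
      refine exp_neg_le_expPartial (v := 2) (by norm_num) ?_ ?_
      · rw [mul_pow, hr2]; linarith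
      · norm_num [expPartial, Finset.sum_range_succ, Nat.factorial]
    · refine add_le_add_right (ENNReal.ofReal_le_ofReal ?_) _
      rw [hr2]
      norm_num
      linarith

end Horizons

/-! ### Fitting the lower-order terms under the slack of the bound. -/

section Slack

lemma mul_one_add_sub_log_le_exp {c : ℝ} (hc : 0 < c) (x : ℝ) :
    c * (1 + x - Real.log c) ≤ Real.exp x := by
  have h := Real.add_one_le_exp (x - Real.log c)
  rw [Real.exp_sub, Real.exp_log hc, le_div_iff₀ hc] at h
  linarith

lemma cubic_le_exp (y : ℝ) : 1 + y + y ^ 2 / 2 + y ^ 3 / 6 ≤ Real.exp y := by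
  rcases le_total 0 y with hy | hy
  · refine le_trans (le_of_eq ?_) (Real.sum_le_exp_of_nonneg hy 4)
    norm_num [Finset.sum_range_succ, Nat.factorial]
  · have h := alternating_expPartial 4 (u := -y) (by linarith)
    norm_num [expPartial, Finset.sum_range_succ, Nat.factorial] at h
    exact h

/-- `2.592` exceeds `(56/11)²/10`, the coefficient required in `linear_le_tscSlack`. -/
lemma mul_sq_le_exp_add {x : ℝ} (hx : 0 ≤ x) : 2.592 * x ^ 2 ≤ Real.exp x + 4.5 := by
  rcases le_total x 1.3 with h | h
  · nlinarith [Real.exp_pos x]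
  · have h1 := cubic_le_exp (x - 2.6)
    have h2 : 13.46 ≤ Real.exp 2.6 := by
      refine le_trans ?_ (Real.sum_le_exp_of_nonneg (by norm_num) 12)
      norm_num [Finset.sum_range_succ, Nat.factorial]
    have h3 : Real.exp x = Real.exp 2.6 * Real.exp (x - 2.6) := by
      rw [← Real.exp_add]; congr 1; ring
    obtain ⟨y, rfl⟩ : ∃ y, x = y + 2.6 := ⟨x - 2.6, by ring⟩
    rw [add_sub_cancel_right] at h1 h3
    have h4 : 13.46 * Real.exp y ≤ Real.exp (y + 2.6) := by
      rw [h3]; gcongr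
    nlinarith [mul_nonneg (show 0 ≤ y + 1.3 by linarith) (sq_nonneg y), sq_nonneg (y - 0.01)]

lemma mul_sq_le_exp_add' {x : ℝ} (hx : 0 ≤ x) : 4.05 * x ^ 2 ≤ Real.exp x + 20 := by
  rcases le_total x 2.2 with h | h
  · nlinarith [Real.exp_pos x]
  · have h1 := cubic_le_exp (x - 3)
    have h2 : 20.08 ≤ Real.exp 3 := by
      refine le_trans ?_ (Real.sum_le_exp_of_nonneg (by norm_num) 13)
      norm_num [Finset.sum_range_succ, Nat.factorial]
    have h3 : Real.exp x = Real.exp 3 * Real.exp (x - 3) := by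
      rw [← Real.exp_add]; congr 1; ring
    obtain ⟨y, rfl⟩ : ∃ y, x = y + 3 := ⟨x - 3, by ring⟩
    rw [add_sub_cancel_right] at h1 h3
    have h4 : 20.08 * Real.exp y ≤ Real.exp (y + 3) := by
      rw [h3]; gcongr
    nlinarith [mul_nonneg (show 0 ≤ y + 0.8 by linarith) (sq_nonneg y), sq_nonneg (y - 0.6)]

lemma pow_six_le_exp {x : ℝ} (hx : 0 ≤ x) : 0.0086 * x ^ 6 ≤ Real.exp x := by
  have h1 : 2.718 * (x / 6) ≤ Real.exp (x / 6) := by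
    have h := Real.add_one_le_exp (x / 6 - 1)
    rw [Real.exp_sub, le_div_iff₀ (Real.exp_pos 1)] at h
    nlinarith [Real.exp_one_gt_d9]
  have h2 : Real.exp x = Real.exp (x / 6) ^ 6 := by
    rw [← Real.exp_nat_mul]; congr 1; push_cast; ring
  rw [h2]
  refine le_trans ?_ (pow_le_pow_left₀ (by positivity) h1 6)
  have : 0 ≤ x ^ 6 := by positivity
  rw [mul_pow, div_pow]
  norm_num
  linarith

/-- The part of the regret bound for TS-C that does not depend on the horizon to leading order. -/
noncomputable def tscSlack (β w s : ℝ) (T : ℕ) : ℝ :=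
  Real.exp (11 * w) + 2 * ∑ t ∈ Finset.Icc 1 T, (s / (t : ℝ)) ^ (2 * β)

variable {β w s : ℝ} {T : ℕ}

lemma exp_le_tscSlack (hs : 0 ≤ s) : Real.exp (11 * w) ≤ tscSlack β w s T := by
  have : 0 ≤ ∑ t ∈ Finset.Icc 1 T, (s / (t : ℝ)) ^ (2 * β) :=
    Finset.sum_nonneg fun t _ => by positivity
  unfold tscSlack
  linarith

lemma one_le_tscSlack (hs : 0 ≤ s) (hw : 0 ≤ w) : 1 ≤ tscSlack β w s T :=
  (Real.one_le_exp (by positivity)).trans (exp_le_tscSlack hs)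

lemma rpow_add_rpow_le_sum (hs : 0 ≤ s) (hT : 2 ≤ T) :
    s ^ (2 * β) + (s / 2) ^ (2 * β) ≤ ∑ t ∈ Finset.Icc 1 T, (s / (t : ℝ)) ^ (2 * β) := by
  have h : ({1, 2} : Finset ℕ) ⊆ Finset.Icc 1 T := by
    intro t ht
    simp only [Finset.mem_insert, Finset.mem_singleton] at ht
    rw [Finset.mem_Icc]
    omega
  refine le_trans (le_of_eq ?_)
    (Finset.sum_le_sum_of_subset_of_nonneg h fun t _ _ => by positivity)
  rw [Finset.sum_pair (by norm_num)]
  norm_num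

lemma exp_add_two_mul_sq_le_tscSlack (hβ : 1 ≤ β) (hs : 1 ≤ s) (hT : 2 ≤ T) :
    Real.exp (11 * w) + 2 * s ^ 2 ≤ tscSlack β w s T := by
  have h := rpow_add_rpow_le_sum (β := β) (s := s) (by linarith) hT
  have h1 : s ^ 2 ≤ s ^ (2 * β) := by
    rw [← Real.rpow_natCast]
    exact Real.rpow_le_rpow_of_exponent_le hs (by push_cast; linarith)
  have h2 : 0 ≤ (s / 2) ^ (2 * β) := by positivity
  unfold tscSlack
  linarith

/-- Keep `t = 1, 2`. At `β = 1` they give `1.25 s²`, and the sum increases with `β` when `5 log s ≥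
log 2`; `1.15⁵ ≥ 2` explains the threshold. -/
lemma exp_add_mul_sq_le_tscSlack (hβ : 1 ≤ β) (hs : 1.15 ≤ s) (hT : 2 ≤ T) :
    Real.exp (11 * w) + 2.5 * s ^ 2 ≤ tscSlack β w s T := by
  have hs0 : 0 < s := by linarith
  have h := rpow_add_rpow_le_sum (β := β) (s := s) (by linarith) hT
  have hpow : ∀ u : ℝ, 0 < u → u ^ 2 * (1 + (2 * β - 2) * Real.log u) ≤ u ^ (2 * β) := by
    intro u hu
    have h1 : u ^ (2 * β) = u ^ 2 * Real.exp ((2 * β - 2) * Real.log u) := by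
      rw [← Real.rpow_natCast, mul_comm _ (Real.log u), ← Real.rpow_def_of_pos hu,
        ← Real.rpow_add hu]
      congr 1
      push_cast
      ring
    rw [h1]
    gcongr
    linarith [Real.add_one_le_exp ((2 * β - 2) * Real.log u)]
  have h1 := hpow s hs0
  have h2 := hpow (s / 2) (by linarith)
  have hlog : Real.log (s / 2) = Real.log s - Real.log 2 :=
    Real.log_div hs0.ne' two_ne_zero
  have h5 : Real.log 2 ≤ 5 * Real.log s := by
    have h0 : Real.log (s ^ 5) = 5 * Real.log s := by rw [Real.log_pow]; norm_num
    rw [← h0]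
    apply Real.log_le_log two_pos
    refine le_trans ?_ (pow_le_pow_left₀ (by norm_num) hs 5)
    norm_num
  rw [hlog] at h2
  have h6 : 0 ≤ s ^ 2 * ((2 * β - 2) * (5 * Real.log s - Real.log 2)) :=
    mul_nonneg (by positivity) (mul_nonneg (by linarith) (by linarith))
  have h7 : 1.25 * s ^ 2 ≤ s ^ (2 * β) + (s / 2) ^ (2 * β) := by
    refine le_trans ?_ (add_le_add h1 h2)
    linarith
  unfold tscSlack
  linarith

/-- For `s ≤ 1.15` the exponential beats its tangent of slope `1.15A/11` in `11w`. For larger `s`,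
`A s w ≤ 2.5 s² + (Aw)²/10` splits the product between powers and exponential. -/
lemma le_tscSlack_of_sq_le {A B : ℝ} (hβ : 1 ≤ β) (hw : 0 ≤ w) (hs : 0 ≤ s) (hT : 2 ≤ T)
    (hA : 0 < A) (hlog : 1.15 * A / 11 * (Real.log (1.15 * A / 11) - 1) ≤ B)
    (hsq : ∀ x, 0 ≤ x → (A / 11) ^ 2 / 10 * x ^ 2 ≤ Real.exp x + B) :
    A * (s * w) - B ≤ tscSlack β w s T := by
  rcases le_total s 1.15 with h | h
  · have h1 := mul_one_add_sub_log_le_exp (c := 1.15 * A / 11) (by positivity) (11 * w)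
    have h2 := exp_le_tscSlack (β := β) (w := w) (T := T) hs
    have h3 : A * (s * w) ≤ A * (1.15 * w) := by gcongr
    linarith
  · have h1 := hsq (11 * w) (by positivity)
    have h2 := exp_add_mul_sq_le_tscSlack (w := w) hβ h hT
    nlinarith [sq_nonneg (5 * s - A * w)]

lemma linear_le_tscSlack (hβ : 1 ≤ β) (hw : 0 ≤ w) (hs : 0 ≤ s) (hT : 2 ≤ T) :
    56 * (s * w) - 4.5 ≤ tscSlack β w s T := by
  refine le_tscSlack_of_sq_le hβ hw hs hT (by norm_num) ?_ fun x hx => ?_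
  · have : Real.log (1.15 * 56 / 11) ≤ 1.7685 := by
      refine log_le_of_le_exp (by norm_num)
        (le_trans ?_ (Real.sum_le_exp_of_nonneg (by norm_num) 12))
      norm_num [Finset.sum_range_succ, Nat.factorial]
    linarith
  · refine le_trans ?_ (mul_sq_le_exp_add hx)
    gcongr
    norm_num

lemma linear_le_tscSlack' (hβ : 1 ≤ β) (hw : 0 ≤ w) (hs : 0 ≤ s) (hT : 2 ≤ T) :
    70 * (s * w) - 20 ≤ tscSlack β w s T := by
  refine le_tscSlack_of_sq_le hβ hw hs hT (by norm_num) ?_ fun x hx => ?_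
  · have : Real.log (1.15 * 70 / 11) ≤ 2 := by
      refine log_le_of_le_exp (by norm_num)
        (le_trans ?_ (Real.sum_le_exp_of_nonneg (by norm_num) 8))
      norm_num [Finset.sum_range_succ, Nat.factorial]
    linarith
  · refine le_trans ?_ (mul_sq_le_exp_add' hx)
    gcongr
    norm_num

/-- For `s ≤ 1`, `w ≥ y²` makes the exponential of order `y⁴`. For `s ≥ 1` a weighted AM-GM between
`x⁶`, `x = 11w`, and `2s²` gives `y³`. -/
lemma cube_le_tscSlack (hβ : 1 ≤ β) (hw : 0 ≤ w) (hs : 0 ≤ s) (hT : 2 ≤ T) {y : ℝ}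
    (hy : 1 ≤ y) (hsw : s * w = y ^ 2) : 32 * y ^ 3 ≤ tscSlack β w s T := by
  rcases le_total s 1 with h | h
  · refine le_trans ?_ (exp_le_tscSlack hs)
    have hw2 : y ^ 2 ≤ w := by nlinarith
    have h1 := Real.quadratic_le_exp_of_nonneg (x := 11 * w) (by positivity)
    have h2 : y ^ 2 * y ^ 2 ≤ w * w := by gcongr
    have h3 : y ^ 3 ≤ y ^ 2 * y ^ 2 := by
      rw [← pow_add]
      exact pow_le_pow_right₀ hy (by norm_num)
    nlinarith
  · refine le_trans ?_ (exp_add_two_mul_sq_le_tscSlack hβ h hT)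
    have h1 := pow_six_le_exp (x := 11 * w) (by positivity)
    have hw0 : 0 < w := by
      rcases hw.lt_or_eq with h0 | h0
      · exact h0
      · rw [← h0] at hsw; nlinarith
    have hss : s = y ^ 2 / w := by field_simp; exact hsw
    refine le_trans ?_ (add_le_add_left h1 _)
    obtain ⟨x, rfl⟩ : ∃ x, w = x / 11 := ⟨11 * w, by ring⟩
    have hx : 0 < x := by linarith
    have hss' : s ^ 2 * x ^ 2 = 121 * y ^ 4 := by
      rw [hss]; field_simp; ring
    refine le_of_mul_le_mul_right ?_ (show 0 < x ^ 2 by positivity)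
    have hyg : 0 ≤ y * x ^ 2 := by positivity
    have hy3 : 0 ≤ x ^ 2 * y ^ 3 := by positivity
    -- The product is `g⁴ - 4c³y³g + 3c⁴y⁴` with `g = x²`, `c = 9.77`; `c` is near the optimum, `c³
    -- ≈ 32/(4·0.0086)`.
    have hkey : 0 ≤ (x ^ 2 - 9.77 * y) ^ 2 *
        ((x ^ 2) ^ 2 + 2 * 9.77 * (y * x ^ 2) + 3 * 9.77 ^ 2 * y ^ 2) := by positivity
    have hy4 : 0 ≤ y ^ 4 := by positivity
    have h11 : 11 * (x / 11) = x := by ring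
    rw [h11]
    nlinarith

/-- The `6` is the `3` of the theorem plus `3` saved on the bad event at `t = 1`. With `y = √κ`, the
slack bounds `1` and `56y² - 4.5` cross near `y = 0.313`. -/
lemma sampling_cost_le_tscSlack_of_le_one (hβ : 1 ≤ β) (hw : 0 ≤ w) (hs : 0 ≤ s) (hT : 2 ≤ T)
    (h1 : s * w ≤ 1) :
    2.27 + 36.25 * (s * w) + 17.7 * (s * w * √(s * w)) ≤ 6 + tscSlack β w s T := by
  have hκ : 0 ≤ s * w := by positivity
  have hE1 := one_le_tscSlack (β := β) (T := T) hs hw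
  have hE2 := linear_le_tscSlack hβ hw hs hT
  have hy2 := Real.sq_sqrt hκ
  have hy := Real.sqrt_nonneg (s * w)
  set y := √(s * w)
  rw [← hy2] at h1 hE2 ⊢
  have hy1 : y ≤ 1 := by nlinarith
  rcases le_total y 0.313 with h | h
  · nlinarith [mul_nonneg (mul_nonneg hy hy) (sub_nonneg.2 h), mul_nonneg hy (sub_nonneg.2 h)]
  · nlinarith [mul_nonneg (sub_nonneg.2 h) (sub_nonneg.2 hy1),
      mul_nonneg hy (mul_nonneg (sub_nonneg.2 h) (sub_nonneg.2 hy1))]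

/-- The lower bounds `1`, `56y² - 4.5`, `70y² - 20` and `32y³` on the slack are used in turn as `y =
√κ` grows. -/
lemma sampling_cost_le_tscSlack (hβ : 1 ≤ β) (hw : 0 ≤ w) (hs : 0 ≤ s) (hT : 2 ≤ T) :
    2.25 + 38.45 * (s * w) + 12.1 * (s * w * √(s * w)) ≤ 6 + tscSlack β w s T := by
  have hκ : 0 ≤ s * w := by positivity
  have hE1 := one_le_tscSlack (β := β) (T := T) hs hw
  have hE2 := linear_le_tscSlack hβ hw hs hT
  have hE3 := linear_le_tscSlack' hβ hw hs hT
  have hy2 := Real.sq_sqrt hκ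
  have hy := Real.sqrt_nonneg (s * w)
  have hE4 := fun h => cube_le_tscSlack hβ hw hs hT (y := √(s * w)) h hy2.symm
  set y := √(s * w)
  rw [← hy2] at hE2 hE3 ⊢
  rcases le_total y 0.313 with h | h
  · nlinarith [mul_nonneg (mul_nonneg hy hy) (sub_nonneg.2 h), mul_nonneg hy (sub_nonneg.2 h)]
  rcases le_total y 1.2 with h' | h'
  · nlinarith [mul_nonneg (sub_nonneg.2 h) (sub_nonneg.2 h'),
      mul_nonneg hy (mul_nonneg (sub_nonneg.2 h) (sub_nonneg.2 h'))]
  rcases le_total y 2 with h'' | h''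
  · nlinarith [mul_nonneg (sub_nonneg.2 h') (sub_nonneg.2 h''),
      mul_nonneg hy (mul_nonneg (sub_nonneg.2 h') (sub_nonneg.2 h''))]
  · have hE := hE4 (by linarith)
    nlinarith [mul_nonneg (sub_nonneg.2 h'') (sq_nonneg y)]

end Slack

/-! ### Final bound for TS-C and boundedness of the slack. -/

section Regret

variable {K : ℕ} {Θ : Type*} {μ : Fin K → Θ → ℝ} {θ : Θ} {ks k : Fin K} {α β : ℝ} {σ : ℝ≥0}
  {τ : ℕ → Finset (Fin K) → Fin K} {ν : Fin K → Measure ℝ}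
  {Ω : Type*} [MeasurableSpace Ω] {P : Measure Ω} [IsProbabilityMeasure P]
  {X : Fin K → ℕ → Ω → ℝ} {G : ℕ → Fin K → Ω → ℝ}

/-- At `t = 1` the budget is `2K ≥ 4` whereas a probability is at most `1`, which saves `3`. -/
lemma sum_measure_badEvent_le_sub (hK : 2 ≤ K) (hσ : 0 < σ) (hα : 0 ≤ α)
    (hX : IsRewardTable P ν X)
    (hsubG : ∀ l, HasSubgaussianMGF (fun r => r - μ l θ) (σ ^ 2) (ν l)) {T : ℕ} (hT : 1 ≤ T) :
    ∑ t ∈ Finset.range T, P (badEvent μ θ α σ X t)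
      ≤ ENNReal.ofReal (∑ t ∈ Finset.Icc 1 T, 2 * (K : ℝ) * (t : ℝ) ^ (1 - α) - 3) := by
  have hK' : (2 : ℝ) ≤ K := by exact_mod_cast hK
  have h3 : ∑ t ∈ Finset.Icc 1 T, (if t = 1 then (3 : ℝ) else 0) = 3 := by
    rw [Finset.sum_ite_eq', if_pos (Finset.mem_Icc.2 ⟨le_rfl, hT⟩)]
  have hnn : ∀ t ∈ Finset.Icc 1 T,
      0 ≤ 2 * (K : ℝ) * (t : ℝ) ^ (1 - α) - if t = 1 then (3 : ℝ) else 0 := by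
    intro t _
    split_ifs with h
    · simp only [h, Nat.cast_one, Real.one_rpow]; linarith
    · rw [sub_zero]; positivity
  rw [← h3, ← Finset.sum_sub_distrib, ENNReal.ofReal_sum_of_nonneg hnn]
  refine (sum_range_measure_badEvent_le T).trans (Finset.sum_le_sum fun t ht => ?_)
  split_ifs with h
  · refine prob_le_one.trans (ENNReal.one_le_ofReal.2 ?_)
    simp only [h, Nat.cast_one, Real.one_rpow]
    linarith
  · rw [sub_zero]
    exact measure_badEvent_le hσ hα hX hsubG (Finset.mem_Icc.1 ht).1

lemma integral_tscPulls_le (hks : IsBestAt μ ks θ) (hgap : 0 < gap μ θ ks k)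
    (hβ : 1 ≤ β) (hσ : 0 < σ) (hα : 0 ≤ α) (hτ : IsTieBreaking τ) (hX : IsRewardTable P ν X)
    (hG : IsSamplingNoise P X G)
    (hsubG : ∀ l, HasSubgaussianMGF (fun r => r - μ l θ) (σ ^ 2) (ν l)) (T : ℕ) :
    ∫ ω, (tscPulls μ α β σ τ (fun l m => X l m ω) (fun t l => G t l ω) T k : ℝ) ∂P
      ≤ 4.5 * (1 / gap μ θ ks k ^ 2 * (β * σ ^ 2)) * Real.log T + 3
        + tscSlack β (β * σ ^ 2) (1 / gap μ θ ks k ^ 2) T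
        + ∑ t ∈ Finset.Icc 1 T, 2 * (K : ℝ) * (t : ℝ) ^ (1 - α) := by
  have hK : 2 ≤ K := by
    have hne : ks ≠ k := by rintro rfl; simp [gap] at hgap
    have h1 := ks.isLt
    have h2 := k.isLt
    have h3 : (ks : ℕ) ≠ k := fun h => hne (Fin.ext h)
    omega
  have hK' : (2 : ℝ) ≤ K := by exact_mod_cast hK
  have hσ' : (0 : ℝ) < σ := hσ
  set s := 1 / gap μ θ ks k ^ 2 with hs
  set w := β * (σ : ℝ) ^ 2 with hw
  have hs0 : 0 < s := by positivity
  have hw0 : 0 < w := by positivity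
  have hκ0 : 0 < s * w := by positivity
  have hκ : s * w = β * σ ^ 2 / gap μ θ ks k ^ 2 := by rw [hs, hw]; ring
  have hℓ := Real.log_natCast_nonneg T
  have hE := one_le_tscSlack (β := β) (T := T) hs0.le hw0.le
  set S := ∑ t ∈ Finset.Icc 1 T, 2 * (K : ℝ) * (t : ℝ) ^ (1 - α) with hS
  have hS0 : 0 ≤ S := Finset.sum_nonneg fun t _ => by positivity
  have hℓκ : 0 ≤ 4.5 * (s * w) * Real.log T := by positivity
  have hmeas := measurable_tscPulls_comp (μ := μ) (α := α) (β := β) (σ := σ) (τ := τ) (k := k)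
    hX hG T
  refine integral_natCast_le hmeas (by linarith) ?_
  set B := 4.5 * (s * w) * Real.log T + 3 + tscSlack β w s T + S with hB
  -- If `T ≤ B`, the bound `n_k(T) ≤ T` suffices. Otherwise `B ≥ 3 + 1 + 4` forces `T ≥ 9`, hence
  -- `log T ≥ 2.19`.
  rcases le_or_gt (T : ℝ) B with hTB | hTB
  · calc _ ≤ ∫⁻ _, (T : ENNReal) ∂P := lintegral_mono fun ω => by
          exact Nat.cast_le.2 (pulls_le T k)
      _ = ENNReal.ofReal T := by simp
      _ ≤ _ := ENNReal.ofReal_le_ofReal hTB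
  have hT1 : 1 ≤ T := by
    have : (0 : ℝ) < T := by linarith
    exact_mod_cast this
  have hS4 : 4 ≤ S := by
    have h := Finset.single_le_sum (f := fun t : ℕ => 2 * (K : ℝ) * (t : ℝ) ^ (1 - α))
      (fun t _ => by positivity) (Finset.mem_Icc.2 ⟨le_rfl, hT1⟩)
    simp only [Nat.cast_one, Real.one_rpow] at h
    linarith
  have hT9 : 9 ≤ T := by
    have : (8 : ℝ) < T := by linarith
    exact_mod_cast this
  have hT9' : (9 : ℝ) ≤ T := by exact_mod_cast hT9
  have hlo : 2.19 ≤ Real.log T := by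
    rw [Real.le_log_iff_exp_le (by linarith)]
    exact le_trans (exp_le_of_one_le_mul_expPartial (v := 2.19) (by norm_num) le_rfl
      (by norm_num) (by norm_num [expPartial, Finset.sum_range_succ, Nat.factorial])) hT9'
  have hbad := sum_measure_badEvent_le_sub hK hσ hα hX hsubG hT1
  rw [← hS] at hbad
  have hfin : ∀ {D : ℝ}, 0 ≤ D → D ≤ 6 + tscSlack β w s T →
      ∫⁻ ω, (tscPulls μ α β σ τ (fun l m => X l m ω) (fun t l => G t l ω) T k : ENNReal) ∂P
        ≤ ∑ t ∈ Finset.range T, P (badEvent μ θ α σ X t)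
          + ENNReal.ofReal (4.5 * (s * w) * Real.log T + D) →
      ∫⁻ ω, (tscPulls μ α β σ τ (fun l m => X l m ω) (fun t l => G t l ω) T k : ENNReal) ∂P
        ≤ ENNReal.ofReal B := by
    intro D hD0 hD h
    refine h.trans ((add_le_add_left hbad _).trans ?_)
    rw [← ENNReal.ofReal_add (by linarith) (by linarith)]
    apply ENNReal.ofReal_le_ofReal
    linarith
  rcases le_total (Real.log T) 4 with hhi | hhi
  · have hκ1 : s * w ≤ 1 := by
      by_contra! hcon
      have h1 := linear_le_tscSlack (T := T) hβ hw0.le hs0.le (by omega)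
      have h2 : (T : ℝ) ≤ Real.exp 4 := (Real.log_le_iff_le_exp (by linarith)).1 hhi
      have h3 : Real.exp 4 ≤ 55 := by
        have h4 : Real.exp 4 = Real.exp 1 ^ 4 := by rw [← Real.exp_nat_mul]; norm_num
        rw [h4]
        refine (pow_le_pow_left₀ (Real.exp_pos 1).le Real.exp_one_lt_d9.le 4).trans ?_
        norm_num
      have h5 : 4.5 * 1 * 2.19 ≤ 4.5 * (s * w) * Real.log T := by gcongr
      linarith
    refine hfin ?_ (sampling_cost_le_tscSlack_of_le_one hβ hw0.le hs0.le (by omega) hκ1)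
      (lintegral_tscPulls_le_of_log_le_four hks hgap hβ hσ hτ hX hG hsubG hκ hT1 hlo hhi)
    positivity
  · refine hfin ?_ (sampling_cost_le_tscSlack hβ hw0.le hs0.le (by omega))
      (lintegral_tscPulls_le_of_four_le_log hks hgap hβ hσ hτ hX hG hsubG hκ hT1 hhi)
    positivity

lemma tscSlack_eq (β Δ : ℝ) (T : ℕ) :
    tscSlack β (β * σ ^ 2) (1 / Δ ^ 2) T = Real.exp (11 * β * (σ : ℝ) ^ 2)
      + 2 * ∑ t ∈ Finset.Icc 1 T, (1 / ((t : ℝ) * Δ ^ 2)) ^ (2 * β) := by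
  unfold tscSlack
  rw [mul_assoc]
  congr 2
  refine Finset.sum_congr rfl fun t _ => ?_
  rw [div_div, mul_comm (Δ ^ 2)]

lemma tscSlack_le (hβ : 1 < β) (w : ℝ) {s : ℝ} (hs : 0 ≤ s) :
    ∃ C : ℝ, ∀ T : ℕ, tscSlack β w s T ≤ C := by
  obtain ⟨C, hC⟩ := sum_Icc_rpow_le (s := -(2 * β)) (by linarith)
  refine ⟨Real.exp (11 * w) + 2 * (s ^ (2 * β) * C), fun T => ?_⟩
  have h : ∑ t ∈ Finset.Icc 1 T, (s / (t : ℝ)) ^ (2 * β)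
      = s ^ (2 * β) * ∑ t ∈ Finset.Icc 1 T, (t : ℝ) ^ (-(2 * β)) := by
    rw [Finset.mul_sum]
    refine Finset.sum_congr rfl fun t _ => ?_
    rw [Real.div_rpow hs (Nat.cast_nonneg t), Real.rpow_neg (Nat.cast_nonneg t), div_eq_mul_inv]
  unfold tscSlack
  rw [h]
  have : 0 ≤ s ^ (2 * β) := by positivity
  gcongr
  exact hC T

end Regret

end StructuredBandit

open StructuredBandit in
theorem theorem3 {K : ℕ} {Θ : Type*} (μ : Fin K → Θ → ℝ) (θstar : Θ)
    (kstar : Fin K) (hkstar : IsBestAt μ kstar θstar)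
    (k : Fin K) (hsubopt : 0 < gap μ θstar kstar k) (hcomp : IsCompetitive μ θstar kstar k)
    (σ : ℝ≥0) (hσ : 0 < σ) (α : ℝ) (hα : 2 < α)
    (τ : ℕ → Finset (Fin K) → Fin K) (hτ : IsTieBreaking τ)
    (ν : Fin K → Measure ℝ) [∀ l, IsProbabilityMeasure (ν l)]
    (hmean : ∀ l, ∫ r, r ∂(ν l) = μ l θstar)
    (hsubG : ∀ l, HasSubgaussianMGF (fun r => r - μ l θstar) (σ ^ 2) (ν l))
    {Ω : Type*} [MeasurableSpace Ω] (P : Measure Ω) [IsProbabilityMeasure P]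
    (X : Fin K → ℕ → Ω → ℝ) (hX : IsRewardTable P ν X) :
    ((∀ T : ℕ,
        Integrable (fun ω => (ucbcPulls μ α σ τ (fun l m => X l m ω) T k : ℝ)) P ∧
        ∫ ω, (ucbcPulls μ α σ τ (fun l m => X l m ω) T k : ℝ) ∂P
          ≤ 8 * α * (σ : ℝ) ^ 2 * Real.log T / gap μ θstar kstar k ^ 2 + 2 * α / (α - 2)
            + ∑ t ∈ Finset.Icc 1 T, 2 * (K : ℝ) * (t : ℝ) ^ (1 - α)) ∧
      (fun T : ℕ => ∫ ω, (ucbcPulls μ α σ τ (fun l m => X l m ω) T k : ℝ) ∂P)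
        =O[atTop] (fun T : ℕ => Real.log T)) ∧
    (∀ β : ℝ, 1 < β → ∀ G : ℕ → Fin K → Ω → ℝ, IsSamplingNoise P X G →
      (∀ T : ℕ,
        Integrable (fun ω =>
          (tscPulls μ α β σ τ (fun l m => X l m ω) (fun t l => G t l ω) T k : ℝ)) P ∧
        ∫ ω, (tscPulls μ α β σ τ (fun l m => X l m ω) (fun t l => G t l ω) T k : ℝ) ∂P
          ≤ 9 * β * (σ : ℝ) ^ 2 * Real.log T / (2 * gap μ θstar kstar k ^ 2) + 3
            + Real.exp (11 * β * (σ : ℝ) ^ 2)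
            + 2 * ∑ t ∈ Finset.Icc 1 T,
                (1 / ((t : ℝ) * gap μ θstar kstar k ^ 2)) ^ (2 * β)
            + ∑ t ∈ Finset.Icc 1 T, 2 * (K : ℝ) * (t : ℝ) ^ (1 - α)) ∧
      (fun T : ℕ =>
          ∫ ω, (tscPulls μ α β σ τ (fun l m => X l m ω) (fun t l => G t l ω) T k : ℝ) ∂P)
        =O[atTop] (fun T : ℕ => Real.log T)) := by
  have hσ' : (0 : ℝ) < σ := hσ
  have hK0 : (0 : ℝ) ≤ K := Nat.cast_nonneg K
  -- `α > 2` makes `t^(1-α)` summable, so the last sum is bounded uniformly in `T`.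
  obtain ⟨C, hC⟩ := sum_Icc_rpow_le (s := 1 - α) (by linarith)
  have hS : ∀ T : ℕ, ∑ t ∈ Finset.Icc 1 T, 2 * (K : ℝ) * (t : ℝ) ^ (1 - α) ≤ 2 * K * C :=
    fun T => by
      rw [← Finset.mul_sum]
      gcongr
      exact hC T
  constructor
  · have hbound : ∀ T : ℕ,
        ∫ ω, (ucbcPulls μ α σ τ (fun l m => X l m ω) T k : ℝ) ∂P
          ≤ 8 * α * (σ : ℝ) ^ 2 * Real.log T / gap μ θstar kstar k ^ 2 + 2 * α / (α - 2)
            + ∑ t ∈ Finset.Icc 1 T, 2 * (K : ℝ) * (t : ℝ) ^ (1 - α) := by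
      intro T
      have hℓ := Real.log_natCast_nonneg T
      -- Absorbs the `+1` from rounding the count threshold.
      have h1 : 1 ≤ 2 * α / (α - 2) := by
        rw [le_div_iff₀ (by linarith)]; linarith
      refine (integral_natCast_le (measurable_ucbcPulls hX T) ?_
        (lintegral_ucbcPulls_le hkstar hsubopt hσ (by linarith) hτ hX hsubG T)).trans ?_
      · have : 0 ≤ ∑ t ∈ Finset.Icc 1 T, 2 * (K : ℝ) * (t : ℝ) ^ (1 - α) :=
          Finset.sum_nonneg fun t _ => by positivity
        positivity
      · gcongr
    refine ⟨fun T => ⟨integrable_natCast_of_le (measurable_ucbcPulls hX T)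
      fun ω => pulls_le T k, hbound T⟩, ?_⟩
    refine isBigO_log_of_le (a := 8 * α * (σ : ℝ) ^ 2 / gap μ θstar kstar k ^ 2)
      (b := 2 * α / (α - 2) + 2 * K * C)
      (fun T => integral_nonneg fun ω => Nat.cast_nonneg _) fun T => ?_
    refine (hbound T).trans ?_
    rw [div_mul_eq_mul_div]
    linarith [hS T]
  · intro β hβ G hG
    have hbound := fun T => integral_tscPulls_le hkstar hsubopt hβ.le hσ
      (show 0 ≤ α by linarith) hτ hX hG hsubG T
    refine ⟨fun T => ⟨integrable_natCast_of_le (measurable_tscPulls_comp hX hG T)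
      fun ω => pulls_le T k, (hbound T).trans (le_of_eq ?_)⟩, ?_⟩
    · rw [tscSlack_eq]
      have : 4.5 * (1 / gap μ θstar kstar k ^ 2 * (β * (σ : ℝ) ^ 2)) * Real.log T
          = 9 * β * (σ : ℝ) ^ 2 * Real.log T / (2 * gap μ θstar kstar k ^ 2) := by
        field_simp
        ring
      rw [this]
      ring
    · obtain ⟨D, hD⟩ := tscSlack_le hβ (β * σ ^ 2)
        (show 0 ≤ 1 / gap μ θstar kstar k ^ 2 by positivity)
      refine isBigO_log_of_le (a := 4.5 * (1 / gap μ θstar kstar k ^ 2 * (β * (σ : ℝ) ^ 2)))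
        (b := 3 + D + 2 * K * C)
        (fun T => integral_nonneg fun ω => Nat.cast_nonneg _) fun T => ?_
      linarith [hbound T, hS T, hD T]
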